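/- Let $\mathcal C$ be a stable model category (a pointed model category whose suspension functor $\Sigma$ is an equivalence of $Ho(\mathcal C)$), let $C_\bullet, D_\bullet$ be simplicial objects in $Ho(\mathcal C)$, and let $f_\bullet : C_\bullet\to D_\bullet$ be a simplicial map in $Ho(\mathcal C)$. Write $d_m : C_m\to C_{m-1}$ and $d_m : D_m\to D_{m-1}$ for the alternating sums of the face maps. Suppose that $C_\bullet$ and $D_\bullet$ are totalizable, and fix totalizations: sequences of cofibrations $0\simeq F_{-1}\to F_0\to F_1\to\cdots$ in $\mathcal C$ (one for $C_\bullet$, one for $D_\bullet$), with identifications $F_m/F_{m-1}\cong\Sigma^m C_m$ (resp. $\Sigma^m D_m$) in $Ho(\mathcal C)$ under which the connecting maps $F_m/F_{m-1}\to\Sigma(F_{m-1}/F_{m-2})$ are $\Sigma^m d_m$. Let $n\ge 2$, and let $Tot(Gr^3_n\mathcal F C_*)=F_n/F_{n-3}$, with its filtration $F_{n-2}/F_{n-3}\to F_{n-1}/F_{n-3}\to F_n/F_{n-3}$ and subquotients $Gr^1_m\mathcal F C_*=F_m/F_{m-1}$, $m=n-2,n-1,n$; similarly for $D_*$. A filtration-preserving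 map is a morphism in the homotopy category of filtered objects (sequences of three objects of $\mathcal C$, up to stagewise weak equivalence); it agrees with $f_m$ if it induces $\Sigma^m f_m$ on $Gr^1_m$. The totalizations determine nullhomotopies of $d_{n-1}d_n : C_n\to C_{n-2}$ and of $d_{n-1}d_n : D_n\to D_{n-2}$, which induce a nullhomotopy of the difference $f_{n-2}d_{n-1}d_n-d_{n-1}d_nf_n : C_n\to D_{n-2}$. Any choice of homotopies $f_{n-2}d_{n-1}\simeq d_{n-1}f_{n-1}$ and $f_{n-1}d_n\simeq d_nf_n$ gives a second nullhomotopy of it. The first-order Toda bracket $T(2,n-2;f_\bullet)\subseteq[\Sigma C_n,D_{n-2}]$ is the set of all classes of maps $\Sigma C_n\to D_{n-2}$ obtained by gluing these two nullhomotopies, for all choices of the two homotopies; it is said to vanish if it contains $0$. Then: (a) There is a filtration-preserving map $Tot(Gr^3_n\mathcal F C_*)\to Tot(Gr^3_n\mathcal F D_*)$ agreeing with $f_m$ on the subquotients $Gr^1_m$ for $m=n,n-1,n-2$ if and only if $T(2,n-2;f_\bullet)$ vanishes. (b) If $f_n,f_{n-1},f_{n-2}$ are isomorphisms in $Ho(\mathcal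 C)$ (that is, weak equivalences), then there is a filtration-preserving weak equivalence $Tot(Gr^3_n\mathcal F C_*)\to Tot(Gr^3_n\mathcal F D_*)$ agreeing with $f_m$ on $Gr^1_m$ for $m=n,n-1,n-2$ if and only if $T(2,n-2;f_\bullet)$ vanishes. -/

import Mathlib

open CategoryTheory Limits ZeroObject HomotopicalAlgebra Opposite

universe v u

namespace StableTot

/-- The homotopy category of a model category: the localization at the weak equivalences. -/
abbrev Ho (𝒞 : Type u) [Category.{v} 𝒞] [ModelCategory 𝒞] : Type u :=
  (weakEquivalences 𝒞).Localization

/-- The localization functor `𝒞 ⥤ Ho 𝒞`. -/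
abbrev toHo (𝒞 : Type u) [Category.{v} 𝒞] [ModelCategory 𝒞] : 𝒞 ⥤ Ho 𝒞 :=
  (weakEquivalences 𝒞).Q

lemma toHo_isIso {𝒞 : Type u} [Category.{v} 𝒞] [ModelCategory 𝒞] {X Y : 𝒞} (f : X ⟶ Y)
    [WeakEquivalence f] : IsIso ((toHo 𝒞).map f) :=
  Localization.inverts (toHo 𝒞) (weakEquivalences 𝒞) f (mem_weakEquivalences f)

lemma cokernel_hom_ext {𝒞 : Type u} [Category.{v} 𝒞] [HasZeroMorphisms 𝒞] [ModelCategory 𝒞]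
    {X P Z : 𝒞} {i : X ⟶ P} {a b : cokernel i ⟶ Z} (h : cokernel.π i ≫ a = cokernel.π i ≫ b) :
    a = b :=
  (cancel_epi (cokernel.π i)).1 h

/-- Collapsing `X` turns `j : P ⟶ R` into a cobase change of `j`. -/
lemma isPushout_cokernelMap {𝒞 : Type u} [Category.{v} 𝒞] [HasZeroMorphisms 𝒞] [ModelCategory 𝒞]
    {X P R : 𝒞} (i : X ⟶ P) (j : P ⟶ R) (k : X ⟶ R) (h : i ≫ j = k) :
    IsPushout j (cokernel.π i) (cokernel.π k) (cokernel.map i k (𝟙 X) j (by simp [h])) := by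
  subst h
  refine ⟨⟨by simp⟩, ⟨PushoutCocone.IsColimit.mk _
    (fun s => cokernel.desc _ s.inl (by
      rw [Category.assoc, s.condition, ← Category.assoc, cokernel.condition, zero_comp]))
    (fun s => by simp) (fun s => ?_) (fun s m h₁ h₂ => ?_)⟩⟩
  · apply cokernel_hom_ext
    simpa using s.condition
  · apply cokernel_hom_ext
    simpa using h₁

section Cone

variable {𝒞 : Type u} [Category.{v} 𝒞] [HasZeroMorphisms 𝒞] [ModelCategory 𝒞]

lemma cofibration_cokernelMap {X P R : 𝒞} (i : X ⟶ P) (j : P ⟶ R) (k : X ⟶ R) (h : i ≫ j = k)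
    [Cofibration j] : Cofibration (cokernel.map i k (𝟙 X) j (by simp [h])) := by
  rw [cofibration_iff]
  exact MorphismProperty.of_isPushout (isPushout_cokernelMap i j k h).flip (mem_cofibrations j)

lemma weakEquivalence_cokernelMap {X P R : 𝒞} (i : X ⟶ P) (j : P ⟶ R) (k : X ⟶ R)
    (h : i ≫ j = k) [Cofibration j] [WeakEquivalence j] :
    WeakEquivalence (cokernel.map i k (𝟙 X) j (by simp [h])) := by
  rw [weakEquivalence_iff]
  exact (MorphismProperty.of_isPushout (isPushout_cokernelMap i j k h).flip
    (mem_trivialCofibrations j)).2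

lemma isCofibrant_of_isZero {X : 𝒞} (hX : IsZero X) : IsCofibrant X := by
  have : IsIso (initial.to X) :=
    ⟨0, initialIsInitial.hom_ext _ _, hX.eq_of_src _ _⟩
  infer_instance

lemma isCofibrant_cokernel {X P : 𝒞} (i : X ⟶ P) [Cofibration i] : IsCofibrant (cokernel i) := by
  have h : IsZero (cokernel (𝟙 X)) :=
    (IsZero.iff_id_eq_zero _).2 (cokernel_hom_ext (by
      rw [Category.comp_id, comp_zero, ← Category.id_comp (cokernel.π (𝟙 X)),
        cokernel.condition]))
  have := isCofibrant_of_isZero h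
  have := cofibration_cokernelMap (𝟙 X) i i (Category.id_comp i)
  exact isCofibrant_of_cofibration (cokernel.map (𝟙 X) i (𝟙 X) i rfl)

variable [HasZeroObject 𝒞]

/-- A chosen factorization of `X ⟶ 0` as a cofibration followed by a trivial fibration. -/
noncomputable def coneFact (X : 𝒞) :
    MorphismProperty.MapFactorizationData (cofibrations 𝒞) (trivialFibrations 𝒞)
      (0 : X ⟶ (0 : 𝒞)) :=
  MorphismProperty.factorizationData _ _ _

/-- The cone `CX`. -/
noncomputable def cone (X : 𝒞) : 𝒞 := (coneFact X).Z

/-- The inclusion `X ⟶ CX` of the base of the cone, a cofibration. -/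
noncomputable def coneι (X : 𝒞) : X ⟶ cone X := (coneFact X).i

instance (X : 𝒞) : Cofibration (coneι X) := inferInstanceAs (Cofibration (coneFact X).i)

lemma cone_trivialFibration (X : 𝒞) : trivialFibrations 𝒞 (0 : cone X ⟶ (0 : 𝒞)) := by
  have h := (coneFact X).hp
  rwa [(isZero_zero 𝒞).eq_of_tgt (coneFact X).p 0] at h

/-- Extension of a map along a cofibration, when the target is fibrant and contractible. -/
lemma exists_extension {X R P : 𝒞} (i : X ⟶ R) [Cofibration i]
    (hP : trivialFibrations 𝒞 (0 : P ⟶ (0 : 𝒞))) (a : X ⟶ P) :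
    ∃ b : R ⟶ P, i ≫ b = a := by
  obtain ⟨_, _⟩ := (mem_trivialFibrations_iff _).1 hP
  have sq : CommSq a i (0 : P ⟶ (0 : 𝒞)) 0 := ⟨by simp⟩
  exact ⟨sq.lift, sq.fac_left⟩

/-- An extension of `f : X ⟶ Y` to the cones. -/
noncomputable def coneMap {X Y : 𝒞} (f : X ⟶ Y) : cone X ⟶ cone Y :=
  (exists_extension (coneι X) (cone_trivialFibration Y) (f ≫ coneι Y)).choose

@[simp]
lemma coneι_coneMap {X Y : 𝒞} (f : X ⟶ Y) : coneι X ≫ coneMap f = f ≫ coneι Y :=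
  (exists_extension (coneι X) (cone_trivialFibration Y) (f ≫ coneι Y)).choose_spec

@[simp]
lemma coneι_coneMap_assoc {X Y Z : 𝒞} (f : X ⟶ Y) (g : cone Y ⟶ Z) :
    coneι X ≫ coneMap f ≫ g = f ≫ coneι Y ≫ g := by
  rw [← Category.assoc, coneι_coneMap, Category.assoc]

/-- Two extensions to a contractible fibrant object become equal in the homotopy category
after collapsing the bases. -/
lemma toHo_cokernelMap_eq {X Y P Q : 𝒞} (i : X ⟶ P) [Cofibration i] (j : Y ⟶ Q)
    (hQ : trivialFibrations 𝒞 (0 : Q ⟶ (0 : 𝒞))) (f : X ⟶ Y) (a b : P ⟶ Q)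
    (ha : i ≫ a = f ≫ j) (hb : i ≫ b = f ≫ j) :
    (toHo 𝒞).map (cokernel.map i j f a ha) = (toHo 𝒞).map (cokernel.map i j f b hb) := by
  let d := MorphismProperty.factorizationData (cofibrations 𝒞) (trivialFibrations 𝒞)
    (pushout.desc (𝟙 P) (𝟙 P) rfl : pushout i i ⟶ P)
  let i₀ : P ⟶ d.Z := pushout.inl i i ≫ d.i
  let i₁ : P ⟶ d.Z := pushout.inr i i ≫ d.i
  have h₁ : i ≫ i₁ = i ≫ i₀ := by simp [i₀, i₁, pushout.condition_assoc]
  have w₀ : i₀ ≫ d.p = 𝟙 P := by simp [i₀, pushout.inl_desc]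
  have w₁ : i₁ ≫ d.p = 𝟙 P := by simp [i₁, pushout.inr_desc]
  obtain ⟨H, hH⟩ := exists_extension d.i hQ (pushout.desc a b (by rw [ha, hb]))
  have ea : i₀ ≫ H = a := by simp [i₀, hH, pushout.inl_desc]
  have eb : i₁ ≫ H = b := by simp [i₁, hH, pushout.inr_desc]
  have : WeakEquivalence i₀ := weakEquivalence_of_postcomp_of_fac w₀
  have := weakEquivalence_cokernelMap i i₀ (i ≫ i₀) rfl
  let c₀ : cokernel i ⟶ cokernel (i ≫ i₀) := cokernel.map i (i ≫ i₀) (𝟙 X) i₀ (by simp)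
  let c₁ : cokernel i ⟶ cokernel (i ≫ i₀) := cokernel.map i (i ≫ i₀) (𝟙 X) i₁ (by simp [h₁])
  let p : cokernel (i ≫ i₀) ⟶ cokernel i := cokernel.map (i ≫ i₀) i (𝟙 X) d.p (by simp [w₀])
  let h : cokernel (i ≫ i₀) ⟶ cokernel j := cokernel.map (i ≫ i₀) j f H (by simp [ea, ha])
  have : WeakEquivalence c₀ := this
  have := toHo_isIso c₀
  have e₀ : c₀ ≫ p = 𝟙 _ := by
    apply cokernel_hom_ext; simp [c₀, p, reassoc_of% w₀]
  have e₁ : c₁ ≫ p = 𝟙 _ := by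
    apply cokernel_hom_ext; simp [c₁, p, reassoc_of% w₁]
  have : IsIso ((toHo 𝒞).map p) := by
    have e := congrArg (toHo 𝒞).map e₀
    rw [Functor.map_comp, CategoryTheory.Functor.map_id] at e
    exact (IsIso.eq_inv_of_hom_inv_id e) ▸ inferInstance
  have e : (toHo 𝒞).map c₀ = (toHo 𝒞).map c₁ := by
    rw [← cancel_mono ((toHo 𝒞).map p), ← Functor.map_comp, ← Functor.map_comp, e₀, e₁]
  have fa : cokernel.map i j f a ha = c₀ ≫ h := by
    apply cokernel_hom_ext; simp [c₀, h, reassoc_of% ea]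
  have fb : cokernel.map i j f b hb = c₁ ≫ h := by
    apply cokernel_hom_ext; simp [c₁, h, reassoc_of% eb]
  rw [fa, fb, Functor.map_comp, Functor.map_comp, e]

/-- The suspension `CX / X` of an object. -/
noncomputable abbrev suspObj (X : 𝒞) : 𝒞 := cokernel (coneι X)

/-- The map induced on suspensions; it depends on the choice of `coneMap` only up to homotopy. -/
noncomputable def suspMap {X Y : 𝒞} (f : X ⟶ Y) : suspObj X ⟶ suspObj Y :=
  cokernel.map (coneι X) (coneι Y) f (coneMap f) (coneι_coneMap f)

lemma toHo_suspMap_eq {X Y : 𝒞} (f : X ⟶ Y) (a : cone X ⟶ cone Y)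
    (ha : coneι X ≫ a = f ≫ coneι Y) :
    (toHo 𝒞).map (suspMap f) = (toHo 𝒞).map (cokernel.map (coneι X) (coneι Y) f a ha) :=
  toHo_cokernelMap_eq _ _ (cone_trivialFibration Y) f _ _ (coneι_coneMap f) ha

variable (𝒞) in
/-- The suspension of cofibrant objects, with values in the homotopy category. -/
noncomputable def suspCofibrant : CofibrantObject 𝒞 ⥤ Ho 𝒞 where
  obj X := (toHo 𝒞).obj (suspObj X.obj)
  map f := (toHo 𝒞).map (suspMap f.hom)
  map_id X := by
    rw [toHo_suspMap_eq _ (𝟙 _) (by simp), ← CategoryTheory.Functor.map_id]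
    congr 1
    apply cokernel_hom_ext
    simp
  map_comp f g := by
    rw [toHo_suspMap_eq _ (coneMap f.hom ≫ coneMap g.hom) (by simp), ← Functor.map_comp]
    congr 1
    apply cokernel_hom_ext
    simp [suspMap]

lemma isIso_suspMap_of_trivialCofibration {X Y : 𝒞} (f : X ⟶ Y)
    [Cofibration f] [WeakEquivalence f] : IsIso ((toHo 𝒞).map (suspMap f)) := by
  let d := MorphismProperty.factorizationData (trivialCofibrations 𝒞) (fibrations 𝒞)
    (0 : pushout (coneι X) f ⟶ (0 : 𝒞))
  let m : cone X ⟶ d.Z := pushout.inl _ _ ≫ d.i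
  let j : Y ⟶ d.Z := pushout.inr _ _ ≫ d.i
  have hmj : coneι X ≫ m = f ≫ j := by simp [m, j, pushout.condition_assoc]
  have hZ : trivialFibrations 𝒞 (0 : d.Z ⟶ (0 : 𝒞)) := by
    have e : d.p = 0 := (isZero_zero 𝒞).eq_of_tgt _ _
    obtain ⟨_, _⟩ := (mem_trivialFibrations_iff _).1 (cone_trivialFibration X)
    have : Fibration (0 : d.Z ⟶ (0 : 𝒞)) := e ▸ inferInstance
    have : WeakEquivalence (0 : d.Z ⟶ (0 : 𝒞)) :=
      weakEquivalence_of_precomp_of_fac (f := m) (fg := (0 : cone X ⟶ (0 : 𝒞))) (by simp)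
    exact mem_trivialFibrations _
  obtain ⟨r, hr⟩ := exists_extension j (cone_trivialFibration Y) (coneι Y)
  obtain ⟨s, hs⟩ := exists_extension (coneι Y) hZ j
  let m' : suspObj X ⟶ cokernel j := cokernel.map (coneι X) j f m hmj
  let r' : cokernel j ⟶ suspObj Y := cokernel.map j (coneι Y) (𝟙 Y) r (by simp [hr])
  let s' : suspObj Y ⟶ cokernel j := cokernel.map (coneι Y) j (𝟙 Y) s (by simp [hs])
  have em : (toHo 𝒞).map (suspMap f) = (toHo 𝒞).map m' ≫ (toHo 𝒞).map r' := by
    rw [toHo_suspMap_eq f (m ≫ r) (by rw [← Category.assoc, hmj, Category.assoc, hr]),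
      ← Functor.map_comp]
    congr 1
    apply cokernel_hom_ext
    simp [m', r']
  have ers : (toHo 𝒞).map r' ≫ (toHo 𝒞).map s' = 𝟙 _ := by
    have := toHo_cokernelMap_eq j j hZ (𝟙 Y) (r ≫ s) (𝟙 _)
      (by rw [← Category.assoc, hr, hs]; simp) (by simp)
    rw [← Functor.map_comp, ← CategoryTheory.Functor.map_id]
    refine Eq.trans ?_ (this.trans ?_)
    · congr 1
      apply cokernel_hom_ext
      simp [r', s']
    · congr 1
      apply cokernel_hom_ext
      simp
  have esr : (toHo 𝒞).map s' ≫ (toHo 𝒞).map r' = 𝟙 _ := by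
    have := toHo_cokernelMap_eq (coneι Y) (coneι Y) (cone_trivialFibration Y) (𝟙 Y) (s ≫ r) (𝟙 _)
      (by rw [← Category.assoc, hs, hr]; simp) (by simp)
    rw [← Functor.map_comp, ← CategoryTheory.Functor.map_id]
    refine Eq.trans ?_ (this.trans ?_)
    · congr 1
      apply cokernel_hom_ext
      simp [r', s']
    · congr 1
      apply cokernel_hom_ext
      simp
  have : IsIso ((toHo 𝒞).map r') := ⟨_, ers, esr⟩
  -- `m'` is the isomorphism `CX / X ≅ (CX ⊔ Y) / Y` followed by a trivial cofibration
  let c : suspObj X ⟶ cokernel (pushout.inr (coneι X) f) :=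
    cokernel.map (coneι X) (pushout.inr (coneι X) f) f (pushout.inl _ _) pushout.condition
  let c' : cokernel (pushout.inr (coneι X) f) ⟶ suspObj X :=
    cokernel.desc _ (pushout.desc (cokernel.π (coneι X)) 0 (by simp)) (by simp [pushout.inr_desc])
  have : IsIso c := by
    refine ⟨c', ?_, ?_⟩
    · apply cokernel_hom_ext
      simp [c, c', pushout.inl_desc]
    · apply cokernel_hom_ext
      apply pushout.hom_ext
      · simp [c, c', pushout.inl_desc_assoc]
      · simp [c, c', pushout.inr_desc_assoc]
  have := weakEquivalence_cokernelMap (pushout.inr (coneι X) f) d.i j rfl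
  have hm : WeakEquivalence m' := by
    have e : m' = c ≫ cokernel.map (pushout.inr (coneι X) f) j (𝟙 Y) d.i (by simp [j]) := by
      apply cokernel_hom_ext
      simp [m', c, m]
    rw [e]
    infer_instance
  have := toHo_isIso m'
  rw [em]
  infer_instance

lemma suspCofibrant_inverts :
    (weakEquivalences (CofibrantObject 𝒞)).IsInvertedBy (suspCofibrant 𝒞) := by
  intro X Y f hf
  have hf' : WeakEquivalence f.hom := (weakEquivalence_iff _).2 hf
  obtain ⟨h⟩ := (inferInstance : Nonempty (CofibrantBrownFactorization f.hom))
  have : IsCofibrant h.Z := isCofibrant_of_cofibration h.s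
  let Z : CofibrantObject 𝒞 := CofibrantObject.mk h.Z
  let i : X ⟶ Z := CofibrantObject.homMk h.i
  let s : Y ⟶ Z := CofibrantObject.homMk h.s
  let p : Z ⟶ Y := CofibrantObject.homMk h.p
  have hi : IsIso ((suspCofibrant 𝒞).map i) := isIso_suspMap_of_trivialCofibration h.i
  have hs : IsIso ((suspCofibrant 𝒞).map s) := isIso_suspMap_of_trivialCofibration h.s
  have sp : s ≫ p = 𝟙 _ := by ext; exact h.s_p
  have ip : i ≫ p = f := by ext; exact h.fac
  have e := congrArg (suspCofibrant 𝒞).map sp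
  rw [Functor.map_comp, CategoryTheory.Functor.map_id] at e
  have hp : IsIso ((suspCofibrant 𝒞).map p) := IsIso.eq_inv_of_hom_inv_id e ▸ inferInstance
  rw [← ip, Functor.map_comp]
  infer_instance

variable (𝒞) in
/-- The suspension functor `Σ` of the homotopy category of a pointed model category. -/
noncomputable def susp : Ho 𝒞 ⥤ Ho 𝒞 :=
  Localization.lift (suspCofibrant 𝒞) suspCofibrant_inverts (CofibrantObject.ι ⋙ toHo 𝒞)

/-- On a cofibrant object `X`, the suspension is computed by `CX / X`. -/
noncomputable def suspIso (X : 𝒞) [IsCofibrant X] :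
    (susp 𝒞).obj ((toHo 𝒞).obj X) ≅ (toHo 𝒞).obj (suspObj X) :=
  (Localization.fac (suspCofibrant 𝒞) suspCofibrant_inverts (CofibrantObject.ι ⋙ toHo 𝒞)).app
    (CofibrantObject.mk X)

lemma isZero_toHo_zero : IsZero ((toHo 𝒞).obj (0 : 𝒞)) := by
  have hi : IsIso (initial.to (0 : 𝒞)) :=
    ⟨0, initialIsInitial.hom_ext _ _, (isZero_zero 𝒞).eq_of_src _ _⟩
  have ht : IsIso (terminal.from (0 : 𝒞)) :=
    ⟨0, (isZero_zero 𝒞).eq_of_src _ _, terminalIsTerminal.hom_ext _ _⟩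
  have hc : IsCofibrant (0 : 𝒞) := inferInstance
  have hf : IsFibrant (0 : 𝒞) := inferInstance
  have := Localization.essSurj (toHo 𝒞) (weakEquivalences 𝒞)
  refine ⟨fun Y => ?_, fun Y => ?_⟩
  · let X := (toHo 𝒞).objPreimage Y
    let w := FibrantObject.HoCat.iResolutionObj X
    have := toHo_isIso w
    let e : Y ≅ _ := ((toHo 𝒞).objObjPreimageIso Y).symm ≪≫ asIso ((toHo 𝒞).map w)
    refine ⟨⟨⟨(toHo 𝒞).map 0 ≫ e.inv⟩, fun g => ?_⟩⟩
    obtain ⟨g', hg'⟩ := map_surjective_of_isLocalization (toHo 𝒞) _ _ (g ≫ e.hom)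
    rw [← cancel_mono e.hom, ← hg', (isZero_zero 𝒞).eq_of_src g' 0]
    simp
  · let X := (toHo 𝒞).objPreimage Y
    let w := CofibrantObject.HoCat.pResolutionObj X
    have := toHo_isIso w
    let e : _ ≅ Y := asIso ((toHo 𝒞).map w) ≪≫ (toHo 𝒞).objObjPreimageIso Y
    refine ⟨⟨⟨e.inv ≫ (toHo 𝒞).map 0⟩, fun g => ?_⟩⟩
    obtain ⟨g', hg'⟩ := map_surjective_of_isLocalization (toHo 𝒞) _ _ (e.hom ≫ g)
    rw [← cancel_epi e.hom, ← hg', (isZero_zero 𝒞).eq_of_tgt g' 0]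
    simp

instance : HasZeroObject (Ho 𝒞) := ⟨_, isZero_toHo_zero⟩

/-- The zero morphisms of the homotopy category: those that factor through the zero object. -/
noncomputable instance : HasZeroMorphisms (Ho 𝒞) := HasZeroObject.zeroMorphismsOfZeroObject

variable (𝒞) in
/-- A pointed model category is stable if the suspension functor of its homotopy category is an
equivalence of categories. -/
class StableModelCategory : Prop where
  isEquivalence_susp : (susp 𝒞).IsEquivalence

variable (𝒞) in
/-- The iterated suspension `Σᵐ`, normalized by `Σᵐ⁺¹ X = Σ (Σᵐ X)`. -/
noncomputable def suspIter : ℕ → (Ho 𝒞 ⥤ Ho 𝒞)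
  | 0 => 𝟭 _
  | m + 1 => suspIter m ⋙ susp 𝒞

variable (𝒞) in
/-- The identification `Σ (Σᵐ X) = Σᵐ (Σ X)` of two bracketings of the same iterate of `Σ`. -/
noncomputable def suspIterSusp : ∀ m : ℕ, suspIter 𝒞 m ⋙ susp 𝒞 ≅ susp 𝒞 ⋙ suspIter 𝒞 m
  | 0 => Iso.refl _
  | m + 1 => Functor.isoWhiskerRight (suspIterSusp m) (susp 𝒞)

open Simplicial

open Classical in
/-- The alternating sum `∑ (-1)ⁱ dᵢ : Cₘ₊₁ ⟶ Cₘ` of the face maps of a simplicial object in the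
homotopy category. It is formed in the additive structure of `Ho 𝒞`: for a stable `𝒞` there is
exactly one such structure, so that the first case of the definition applies and does not depend
on a choice. -/
noncomputable def altSum (C : SimplicialObject (Ho 𝒞)) (m : ℕ) : C _⦋m + 1⦌ ⟶ C _⦋m⦌ :=
  if h : Nonempty (Preadditive (Ho 𝒞)) then
    letI := h.some
    AlgebraicTopology.AlternatingFaceMapComplex.objD C m
  else 0

/-! ### Filtered objects -/

variable (𝒞) in
/-- A filtered object with three stages: cofibrations `X₀ ⟶ X₁ ⟶ X₂` between cofibrant objects. -/
structure ThreeStage where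
  X₀ : 𝒞
  X₁ : 𝒞
  X₂ : 𝒞
  i₁ : X₀ ⟶ X₁
  i₂ : X₁ ⟶ X₂
  cofibrant : IsCofibrant X₀
  cofibration₁ : Cofibration i₁
  cofibration₂ : Cofibration i₂

namespace ThreeStage

/-- The subquotients of a filtered object with three stages are `X₀`, `X₁ / X₀`, `X₂ / X₁`. -/
noncomputable abbrev gr₁ (X : ThreeStage 𝒞) : 𝒞 := cokernel X.i₁

/-- The subquotient `X₂ / X₁`. -/
noncomputable abbrev gr₂ (X : ThreeStage 𝒞) : 𝒞 := cokernel X.i₂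

/-- A strict map of filtered objects. -/
structure Hom (X Y : ThreeStage 𝒞) where
  f₀ : X.X₀ ⟶ Y.X₀
  f₁ : X.X₁ ⟶ Y.X₁
  f₂ : X.X₂ ⟶ Y.X₂
  comm₁ : X.i₁ ≫ f₁ = f₀ ≫ Y.i₁
  comm₂ : X.i₂ ≫ f₂ = f₁ ≫ Y.i₂

namespace Hom

variable {X Y : ThreeStage 𝒞}

/-- The map induced on `X₁ / X₀`. -/
noncomputable abbrev gr₁ (f : Hom X Y) : X.gr₁ ⟶ Y.gr₁ := cokernel.map _ _ f.f₀ f.f₁ f.comm₁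

/-- The map induced on `X₂ / X₁`. -/
noncomputable abbrev gr₂ (f : Hom X Y) : X.gr₂ ⟶ Y.gr₂ := cokernel.map _ _ f.f₁ f.f₂ f.comm₂

/-- The map is a weak equivalence at every stage of the filtration. -/
def IsWeakEquivalence (f : Hom X Y) : Prop :=
  WeakEquivalence f.f₀ ∧ WeakEquivalence f.f₁ ∧ WeakEquivalence f.f₂

end Hom

/-- A filtration-preserving map `X ⇝ Y` up to homotopy, that is, a morphism from `X` to `Y` in the
homotopy category of filtered objects, represented by a strict map from `X` to a filtered object
`Z` together with a stagewise weak equivalence from `Y` to `Z`. -/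
structure HoMap (X Y : ThreeStage 𝒞) where
  Z : ThreeStage 𝒞
  a : Hom X Z
  b : Hom Y Z
  hb : b.IsWeakEquivalence

namespace HoMap

variable {X Y : ThreeStage 𝒞}

/-- The filtration-preserving map is a weak equivalence (at every stage, so in particular on the
total objects `X₂` and `Y₂`). -/
def IsWeakEquivalence (g : HoMap X Y) : Prop := g.a.IsWeakEquivalence

/-- The maps induced by `g` on the three subquotients are equal, in the homotopy category,
to `φ₀`, `φ₁` and `φ₂`. -/
def AgreesWith (g : HoMap X Y) (φ₀ : (toHo 𝒞).obj X.X₀ ⟶ (toHo 𝒞).obj Y.X₀)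
    (φ₁ : (toHo 𝒞).obj X.gr₁ ⟶ (toHo 𝒞).obj Y.gr₁)
    (φ₂ : (toHo 𝒞).obj X.gr₂ ⟶ (toHo 𝒞).obj Y.gr₂) : Prop :=
  (toHo 𝒞).map g.a.f₀ = φ₀ ≫ (toHo 𝒞).map g.b.f₀ ∧
  (toHo 𝒞).map g.a.gr₁ = φ₁ ≫ (toHo 𝒞).map g.b.gr₁ ∧
  (toHo 𝒞).map g.a.gr₂ = φ₂ ≫ (toHo 𝒞).map g.b.gr₂

end HoMap

end ThreeStage

variable (𝒞) in
/-- A sequence of cofibrations `0 ≅ F₋₁ ⟶ F₀ ⟶ F₁ ⟶ ⋯`, where `obj m` stands for `Fₘ₋₁`. -/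
structure Filtration where
  obj : ℕ → 𝒞
  map : ∀ m, obj m ⟶ obj (m + 1)
  isZero : IsZero (obj 0)
  cofibration : ∀ m, Cofibration (map m)

attribute [instance] Filtration.cofibration ThreeStage.cofibrant ThreeStage.cofibration₁
  ThreeStage.cofibration₂

/-- The isomorphism `(R / X) / (P / X) ≅ R / P`. -/
noncomputable def quotientIso {X P R : 𝒞} (i : X ⟶ P) (j : P ⟶ R) :
    cokernel (cokernel.map i (i ≫ j) (𝟙 X) j (by simp)) ≅ cokernel j where
  hom := cokernel.desc _ (cokernel.desc _ (cokernel.π j) (by simp))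
    (cokernel_hom_ext (by simp))
  inv := cokernel.map _ _ (cokernel.π i) (cokernel.π (i ≫ j)) (by simp)
  hom_inv_id := cokernel_hom_ext (cokernel_hom_ext (by simp))
  inv_hom_id := cokernel_hom_ext (by simp)

namespace Filtration

instance (F : Filtration 𝒞) (m : ℕ) : IsCofibrant (F.obj m) := by
  induction m with
  | zero => exact isCofibrant_of_isZero F.isZero
  | succ m ih => exact isCofibrant_of_cofibration (F.map m)

/-- The subquotient `Gr¹ₘ = Fₘ / Fₘ₋₁`. -/
noncomputable abbrev gr (F : Filtration 𝒞) (m : ℕ) : 𝒞 := cokernel (F.map m)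

/-- The subquotient `Gr³ₖ₊₂ = Fₖ₊₂ / Fₖ₋₁` with its filtration
`Fₖ / Fₖ₋₁ ⟶ Fₖ₊₁ / Fₖ₋₁ ⟶ Fₖ₊₂ / Fₖ₋₁`. -/
noncomputable def gr3 (F : Filtration 𝒞) (k : ℕ) : ThreeStage 𝒞 where
  X₀ := cokernel (F.map k)
  X₁ := cokernel (F.map k ≫ F.map (k + 1))
  X₂ := cokernel ((F.map k ≫ F.map (k + 1)) ≫ F.map (k + 2))
  i₁ := cokernel.map _ _ (𝟙 _) (F.map (k + 1)) (by simp)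
  i₂ := cokernel.map _ _ (𝟙 _) (F.map (k + 2)) (by simp)
  cofibrant := isCofibrant_cokernel _
  cofibration₁ := cofibration_cokernelMap _ _ _ rfl
  cofibration₂ := cofibration_cokernelMap _ _ _ rfl

/-- The middle subquotient of `Gr³ₖ₊₂` is `Gr¹ₖ₊₁`. -/
noncomputable def gr3Iso₁ (F : Filtration 𝒞) (k : ℕ) : (F.gr3 k).gr₁ ≅ F.gr (k + 1) :=
  quotientIso (F.map k) (F.map (k + 1))

/-- The top subquotient of `Gr³ₖ₊₂` is `Gr¹ₖ₊₂`. -/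
noncomputable def gr3Iso₂ (F : Filtration 𝒞) (k : ℕ) : (F.gr3 k).gr₂ ≅ F.gr (k + 2) :=
  quotientIso (F.map k ≫ F.map (k + 1)) (F.map (k + 2))

/-- `δ` is the connecting morphism `Fₘ₊₁ / Fₘ ⟶ Σ (Fₘ / Fₘ₋₁)`: with `B = Fₘ` and `E = Fₘ₊₁`, it is
the composite in the homotopy category of the inverse of the weak equivalence `E ⊔_B CB ⟶ E / B`,
the map `E ⊔_B CB ⟶ CB / B = Σ B`, and the suspension of `Fₘ ⟶ Fₘ / Fₘ₋₁`. -/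
def IsConnecting (F : Filtration 𝒞) (m : ℕ)
    (δ : (toHo 𝒞).obj (F.gr (m + 1)) ⟶ (susp 𝒞).obj ((toHo 𝒞).obj (F.gr m))) : Prop :=
  (toHo 𝒞).map (pushout.desc (cokernel.π (F.map (m + 1))) 0 (by simp) :
      pushout (F.map (m + 1)) (coneι (F.obj (m + 1))) ⟶ F.gr (m + 1)) ≫ δ =
    (toHo 𝒞).map (pushout.desc 0 (cokernel.π (coneι (F.obj (m + 1)))) (by simp) :
      pushout (F.map (m + 1)) (coneι (F.obj (m + 1))) ⟶ suspObj (F.obj (m + 1))) ≫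
      (suspIso (F.obj (m + 1))).inv ≫ (susp 𝒞).map ((toHo 𝒞).map (cokernel.π (F.map m)))

end Filtration

/-- A totalization of a simplicial object `C` in the homotopy category: a filtration
`F₀ ⟶ F₁ ⟶ ⋯` in `𝒞` (the skeletal filtration of the homotopy colimit of the `Fₘ`), with
identifications `Fₘ / Fₘ₋₁ ≅ Σᵐ Cₘ` in the homotopy category under which the connecting morphism
`Fₘ₊₁ / Fₘ ⟶ Σ (Fₘ / Fₘ₋₁)` is the (suspended) alternating sum of the face maps. -/
structure Totalization (C : SimplicialObject (Ho 𝒞)) extends Filtration 𝒞 where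
  grIso : ∀ m, (toHo 𝒞).obj (toFiltration.gr m) ≅ (suspIter 𝒞 m).obj (C _⦋m⦌)
  isConnecting : ∀ m, toFiltration.IsConnecting m
    ((grIso (m + 1)).hom ≫ (susp 𝒞).map ((suspIter 𝒞 m).map (altSum C m)) ≫
      (susp 𝒞).map (grIso m).inv)

namespace Totalization

variable {C D : SimplicialObject (Ho 𝒞)} (S : Totalization C) (T : Totalization D)

/-- A filtration-preserving map `Gr³ₖ₊₂ ⇝ Gr³ₖ₊₂` between two totalizations agrees with the maps
`fₘ` on the subquotients `Gr¹ₘ ≅ Σᵐ Cₘ`, `m = k, k + 1, k + 2`. -/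
def Gr3MapAgrees (f : C ⟶ D) (k : ℕ)
    (g : ThreeStage.HoMap (S.gr3 k) (T.gr3 k)) : Prop :=
  g.AgreesWith
    ((S.grIso k).hom ≫ (suspIter 𝒞 k).map (f.app (op ⦋k⦌)) ≫ (T.grIso k).inv)
    ((toHo 𝒞).map (S.gr3Iso₁ k).hom ≫
      ((S.grIso (k + 1)).hom ≫ (suspIter 𝒞 (k + 1)).map (f.app (op ⦋k + 1⦌)) ≫
        (T.grIso (k + 1)).inv) ≫ (toHo 𝒞).map (T.gr3Iso₁ k).inv)
    ((toHo 𝒞).map (S.gr3Iso₂ k).hom ≫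
      ((S.grIso (k + 2)).hom ≫ (suspIter 𝒞 (k + 2)).map (f.app (op ⦋k + 2⦌)) ≫
        (T.grIso (k + 2)).inv) ≫ (toHo 𝒞).map (T.gr3Iso₂ k).inv)

end Totalization

/-! ### Nullhomotopies and Toda brackets -/

variable (𝒞) in
/-- Maps `X₂ ⟶ X₁ ⟶ X₀` between bifibrant objects with a nullhomotopy `N` of the composite. -/
structure CoherentComplex where
  X₀ : 𝒞
  X₁ : 𝒞
  X₂ : 𝒞
  cofibrant₀ : IsCofibrant X₀
  cofibrant₁ : IsCofibrant X₁
  cofibrant₂ : IsCofibrant X₂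
  fibrant₀ : IsFibrant X₀
  fibrant₁ : IsFibrant X₁
  fibrant₂ : IsFibrant X₂
  d₁ : X₁ ⟶ X₀
  d₂ : X₂ ⟶ X₁
  N : cone X₂ ⟶ X₀
  hN : coneι X₂ ≫ N = d₂ ≫ d₁

attribute [instance] CoherentComplex.cofibrant₀ CoherentComplex.cofibrant₁
  CoherentComplex.cofibrant₂ CoherentComplex.fibrant₀ CoherentComplex.fibrant₁
  CoherentComplex.fibrant₂

namespace CoherentComplex

variable (K : CoherentComplex 𝒞)

/-- The suspension of `X₂` as the union of two cones. -/
noncomputable abbrev doubleCone : 𝒞 := pushout (coneι K.X₂) (coneι K.X₂)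

instance : IsCofibrant K.doubleCone :=
  have : IsCofibrant (cone K.X₂) := isCofibrant_of_cofibration (coneι K.X₂)
  isCofibrant_of_cofibration (pushout.inl (coneι K.X₂) (coneι K.X₂))

/-- The mapping cone of `X₁ ⟶ X₀`. -/
noncomputable abbrev mappingCone : 𝒞 := pushout K.d₁ (coneι K.X₁)

/-- The map from the suspension of `X₂` to the mapping cone of `X₁ ⟶ X₀` given by the two
nullhomotopies of `X₂ ⟶ X₁ ⟶ X₀ ⟶ mappingCone`: the one induced by `N`, and the one induced by the
nullhomotopy of `X₁ ⟶ X₀ ⟶ mappingCone`. -/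
noncomputable def attach : K.doubleCone ⟶ K.mappingCone :=
  pushout.desc (K.N ≫ pushout.inl _ _) (coneMap K.d₂ ≫ pushout.inr _ _) (by
    rw [← Category.assoc, K.hN, Category.assoc, pushout.condition, coneι_coneMap_assoc])

/-- The total object of `X₂ ⟶ X₁ ⟶ X₀`, filtered by `X₀`, by the mapping cone of `X₁ ⟶ X₀` and by
the mapping cone of `attach`. -/
noncomputable def tot : ThreeStage 𝒞 where
  X₀ := K.X₀
  X₁ := K.mappingCone
  X₂ := pushout K.attach (coneι K.doubleCone)
  i₁ := pushout.inl _ _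
  i₂ := pushout.inl _ _
  cofibrant := inferInstance
  cofibration₁ := inferInstance
  cofibration₂ := inferInstance

/-- The identification of the middle subquotient of the total object with `Σ X₁`. -/
noncomputable def totGr₁ :
    (toHo 𝒞).obj K.tot.gr₁ ⟶ (susp 𝒞).obj ((toHo 𝒞).obj K.X₁) :=
  (toHo 𝒞).map (cokernel.desc _ (pushout.desc 0 (cokernel.π (coneι K.X₁)) (by simp))
    (pushout.inl_desc _ _ _)) ≫ (suspIso K.X₁).inv

/-- The identification of the top subquotient of the total object with `Σ Σ X₂`. -/
noncomputable def totGr₂ :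
    (toHo 𝒞).obj K.tot.gr₂ ⟶ (susp 𝒞).obj ((susp 𝒞).obj ((toHo 𝒞).obj K.X₂)) :=
  (toHo 𝒞).map (cokernel.desc _ (pushout.desc 0 (cokernel.π (coneι K.doubleCone)) (by simp))
    (pushout.inl_desc _ _ _)) ≫ (suspIso K.doubleCone).inv ≫
    (susp 𝒞).map ((toHo 𝒞).map (pushout.desc 0 (cokernel.π (coneι K.X₂)) (by simp) :
      K.doubleCone ⟶ suspObj K.X₂) ≫ (suspIso K.X₂).inv)

end CoherentComplex

/-- A presentation of the subquotient `Gr³ₖ₊₂` of a totalization of `C`: maps `X₂ ⟶ X₁ ⟶ X₀` modelling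
`Σᵏ Cₖ₊₂ ⟶ Σᵏ Cₖ₊₁ ⟶ Σᵏ Cₖ`, with a nullhomotopy of the composite, and a filtered weak equivalence
of their total object with `Gr³ₖ₊₂` that is compatible with the identifications of the
subquotients. So the nullhomotopy is the one that underlies the totalization. -/
structure Presentation {C : SimplicialObject (Ho 𝒞)} (T : Totalization C) (k : ℕ) where
  K : CoherentComplex 𝒞
  e₀ : (toHo 𝒞).obj K.X₀ ≅ (suspIter 𝒞 k).obj (C _⦋k⦌)
  e₁ : (toHo 𝒞).obj K.X₁ ≅ (suspIter 𝒞 k).obj (C _⦋k + 1⦌)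
  e₂ : (toHo 𝒞).obj K.X₂ ≅ (suspIter 𝒞 k).obj (C _⦋k + 2⦌)
  g : ThreeStage.HoMap K.tot (T.gr3 k)
  isWeakEquivalence : g.IsWeakEquivalence
  agrees : g.AgreesWith
    (e₀.hom ≫ (T.grIso k).inv)
    (K.totGr₁ ≫ (susp 𝒞).map e₁.hom ≫ (T.grIso (k + 1)).inv ≫ (toHo 𝒞).map (T.gr3Iso₁ k).inv)
    (K.totGr₂ ≫ (susp 𝒞).map ((susp 𝒞).map e₂.hom) ≫ (T.grIso (k + 2)).inv ≫
      (toHo 𝒞).map (T.gr3Iso₂ k).inv)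

/-- Let `h` be a homotopy from `u` to `u'`, let `N` be a nullhomotopy of `u` and let `N'` be one of
`u'`. Then `N`, `h` and `N'` define a map `CX ⊔_X I ⊔_X CX ⟶ Y`, whose source becomes the suspension
of `X` when the first cone and the cylinder are collapsed. The statement is that `t : Σ X ⟶ Y` is
the homotopy class obtained in this way. -/
def IsGluing {X Y : 𝒞} [IsCofibrant X] {I : Cylinder X} {u u' : X ⟶ Y} (h : I.LeftHomotopy u u')
    (N N' : cone X ⟶ Y) (hN : coneι X ≫ N = u) (hN' : coneι X ≫ N' = u')
    (t : (susp 𝒞).obj ((toHo 𝒞).obj X) ⟶ (toHo 𝒞).obj Y) : Prop :=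
  (toHo 𝒞).map (pushout.desc h.h (coprod.desc N N')
      (by rw [Precylinder.i, coprod.desc_comp, coprod.map_desc, h.h₀, h.h₁, hN, hN']) :
      pushout I.i (coprod.map (coneι X) (coneι X)) ⟶ Y) =
    (toHo 𝒞).map (pushout.desc 0 (coprod.desc 0 (cokernel.π (coneι X)))
      (by
        rw [comp_zero, coprod.map_desc, comp_zero, cokernel.condition]
        apply coprod.hom_ext <;> simp only [coprod.inl_desc, coprod.inr_desc, comp_zero]) :
      pushout I.i (coprod.map (coneι X) (coneι X)) ⟶ suspObj X) ≫ (suspIso X).inv ≫ t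

/-- Maps `φᵢ : Xᵢ ⟶ X'ᵢ` between the objects of two coherent complexes, with a homotopy in each of
the two squares. The cylinder map `J` serves to restrict the homotopy `H₁` along `X₂ ⟶ X₁`. -/
structure HomotopySquares (K K' : CoherentComplex 𝒞) where
  φ₀ : K.X₀ ⟶ K'.X₀
  φ₁ : K.X₁ ⟶ K'.X₁
  φ₂ : K.X₂ ⟶ K'.X₂
  I₁ : Cylinder K.X₁
  I₂ : Cylinder K.X₂
  I₂' : Cylinder K.X₂
  good₁ : I₁.IsGood
  good₂ : I₂.IsGood
  good₂' : I₂'.IsGood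
  J : I₂.I ⟶ I₁.I
  i₀_J : I₂.i₀ ≫ J = K.d₂ ≫ I₁.i₀
  i₁_J : I₂.i₁ ≫ J = K.d₂ ≫ I₁.i₁
  J_π : J ≫ I₁.π = I₂.π ≫ K.d₂
  H₁ : I₁.LeftHomotopy (K.d₁ ≫ φ₀) (φ₁ ≫ K'.d₁)
  H₂ : I₂'.LeftHomotopy (K.d₂ ≫ φ₁) (φ₂ ≫ K'.d₂)

attribute [instance] HomotopySquares.good₁ HomotopySquares.good₂ HomotopySquares.good₂'

namespace HomotopySquares

variable {K K' : CoherentComplex 𝒞} (s : HomotopySquares K K')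

/-- The concatenation of `H₁` (restricted along `X₂ ⟶ X₁`) and of `H₂` (composed with
`X'₁ ⟶ X'₀`), a homotopy from `φ₀ ∘ d ∘ d` to `d ∘ d ∘ φ₂`. -/
noncomputable def homotopy : (s.I₂.trans s.I₂').LeftHomotopy
    (K.d₂ ≫ K.d₁ ≫ s.φ₀) (s.φ₂ ≫ K'.d₂ ≫ K'.d₁) :=
  Cylinder.LeftHomotopy.trans
    (P := s.I₂) (f₁ := K.d₂ ≫ s.φ₁ ≫ K'.d₁)
    { h := s.J ≫ s.H₁.h
      h₀ := by rw [← Category.assoc, s.i₀_J, Category.assoc, s.H₁.h₀]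
      h₁ := by rw [← Category.assoc, s.i₁_J, Category.assoc, s.H₁.h₁] }
    (P' := s.I₂')
    { h := s.H₂.h ≫ K'.d₁
      h₀ := by rw [← Category.assoc, s.H₂.h₀, Category.assoc]
      h₁ := by rw [← Category.assoc, s.H₂.h₁, Category.assoc] }

/-- `t : Σ X₂ ⟶ X'₀` is the class given by the two nullhomotopies of the difference of
`φ₀ ∘ d ∘ d` and `d ∘ d ∘ φ₂`: the homotopies in the two squares on the one hand, the
nullhomotopies of both maps induced by those of the two complexes on the other hand. -/
def IsTodaClass (t : (susp 𝒞).obj ((toHo 𝒞).obj K.X₂) ⟶ (toHo 𝒞).obj K'.X₀) : Prop :=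
  IsGluing s.homotopy (K.N ≫ s.φ₀) (coneMap s.φ₂ ≫ K'.N)
    (by rw [← Category.assoc, K.hN, Category.assoc])
    (by rw [coneι_coneMap_assoc, K'.hN]) t

end HomotopySquares

/-- The first-order Toda bracket `T(2, k; f) ⊆ [Σ Cₖ₊₂, Dₖ]` of a map `f : C ⟶ D` of simplicial
objects in the homotopy category, with respect to totalizations of `C` and `D`. It consists of
the classes for all choices of the homotopies in the two squares formed by `fₖ₊₂`, `fₖ₊₁`, `fₖ` and
the differentials. -/
def todaBracket {C D : SimplicialObject (Ho 𝒞)} (S : Totalization C) (T : Totalization D)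
    (f : C ⟶ D) (k : ℕ) : Set ((susp 𝒞).obj (C _⦋k + 2⦌) ⟶ D _⦋k⦌) :=
  { t | ∃ (p : Presentation S k) (q : Presentation T k) (s : HomotopySquares p.K q.K),
    (toHo 𝒞).map s.φ₀ ≫ q.e₀.hom = p.e₀.hom ≫ (suspIter 𝒞 k).map (f.app (op ⦋k⦌)) ∧
    (toHo 𝒞).map s.φ₁ ≫ q.e₁.hom = p.e₁.hom ≫ (suspIter 𝒞 k).map (f.app (op ⦋k + 1⦌)) ∧
    (toHo 𝒞).map s.φ₂ ≫ q.e₂.hom = p.e₂.hom ≫ (suspIter 𝒞 k).map (f.app (op ⦋k + 2⦌)) ∧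
    s.IsTodaClass ((susp 𝒞).map p.e₂.hom ≫ (suspIterSusp 𝒞 k).hom.app (C _⦋k + 2⦌) ≫
      (suspIter 𝒞 k).map t ≫ q.e₀.inv) }

end Cone

end StableTot

open StableTot

set_option linter.unusedSectionVars false

/-! In a stable setting, a filtered object `F₀ ⟶ F₁ ⟶ F₂` carries the same information as maps `X₂ ⟶
X₁ ⟶ X₀` together with a nullhomotopy of the composite. The complex gives the filtered object as an
iterated mapping cone (`CoherentComplex.tot`), and the filtered object gives the complex by iterated
homotopy fibers (`FiberData`). A filtered map with prescribed effect on the subquotients thus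
amounts to maps `φᵢ`, homotopies in the two squares, and a compatibility of these homotopies with
the two given nullhomotopies. The obstruction to that compatibility is the glued map `ΣX₂ ⟶ X'₀`, an
element of the Toda bracket.

If the bracket contains `0`, the map is built stage by stage (`HomotopySquares.exists_homMap`). The
homotopy in the lower square extends `φ₀` to mapping cones. The vanishing class makes the two ways
around the square of attaching maps `ΣX₂ ⟶ mappingCone` homotopic, and such a homotopy fills in the
third stage. Composing with the presentations of the two totalizations gives a map of the `Gr³`.

Conversely, a filtered map is represented by a strict map of stagewise fibrant models. The iterated
homotopy fibers are chosen so that the composite `X₂ ⟶ X₁ ⟶ X₀` is strictly zero, and so that a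
strict filtered map induces strictly commuting squares (`FiberData.Hom.nonempty`). With zero
nullhomotopies and constant homotopies the glued class is zero
(`Totalization.zero_mem_todaBracket_of_homMap`).

The substantial input is that the total object of these fibers is equivalent to the original
filtered object. It rests on `weakEquivalence_mappingCone_homotopyFiber`: the mapping cone of the
homotopy fiber of `A ⟶ B` is `B`. This is derived from `Σ` being an equivalence, by rotating cofiber
sequences and desuspending.

Part (b) follows from (a) by the five lemma for cofiber sequences, `weakEquivalence_of_cokernelMap`.
-/

namespace StableTot

/-! ### Saturation of weak equivalences and homotopy extension -/

section Saturation

variable {𝒞 : Type u} [Category.{v} 𝒞] [ModelCategory 𝒞]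

/-- A fibration between bifibrant objects which is invertible in the homotopy category is a weak
equivalence. -/
lemma weakEquivalence_of_fibration_of_isIso_toHo {X Y : 𝒞} [IsCofibrant X] [IsFibrant X]
    [IsCofibrant Y] [IsFibrant Y] (p : X ⟶ Y) [Fibration p] [IsIso ((toHo 𝒞).map p)] :
    WeakEquivalence p := by
  obtain ⟨g, hg⟩ := map_surjective_of_isLocalization (toHo 𝒞) _ _ (inv ((toHo 𝒞).map p))
  have h₁ : LeftHomotopyRel (g ≫ p) (𝟙 Y) := by
    rw [LeftHomotopyRel.iff_map_eq (toHo 𝒞)]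
    simp [hg]
  obtain ⟨P, _, ⟨h⟩⟩ := h₁.exists_good_cylinder
  -- Covering the homotopy `g ≫ p ≃ 𝟙` turns the homotopy inverse into a strict section `q`. Then
  -- `p` is a retract of `p ≫ q`, which is homotopic to the identity.
  obtain ⟨q, h', hq⟩ := Cylinder.LeftHomotopy.covering_homotopy h p g rfl
  have hqp : q ≫ p = 𝟙 Y := by rw [← h.h₁, ← hq, ← Category.assoc, h'.h₁]
  have h₂ : LeftHomotopyRel (p ≫ q) (𝟙 X) := by
    rw [LeftHomotopyRel.iff_map_eq (toHo 𝒞), ← cancel_mono ((toHo 𝒞).map p),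
      ← Functor.map_comp, ← Functor.map_comp, Category.assoc, hqp]
    simp
  obtain ⟨P', _, ⟨h''⟩⟩ := h₂.exists_good_cylinder
  have hpq : WeakEquivalence (p ≫ q) :=
    (Cylinder.LeftHomotopy.weakEquivalence_iff P' h'').2 inferInstance
  rw [weakEquivalence_iff] at hpq ⊢
  refine MorphismProperty.of_retract (P := weakEquivalences 𝒞) (f := p) (g := p ≫ q) ?_ hpq
  exact
    { i := Arrow.homMk (𝟙 X) q (by simp)
      r := Arrow.homMk (𝟙 X) p (by simp [hqp])
      retract := by ext <;> simp [hqp] }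

/-- The weak equivalences of a model category are saturated. -/
lemma weakEquivalence_of_isIso_toHo {X Y : 𝒞} (f : X ⟶ Y) [IsIso ((toHo 𝒞).map f)] :
    WeakEquivalence f := by
  wlog h₁ : IsFibrant Y generalizing Y with H
  · let w := FibrantObject.HoCat.iResolutionObj Y
    have := toHo_isIso w
    have : IsIso ((toHo 𝒞).map (f ≫ w)) := by rw [Functor.map_comp]; infer_instance
    have := H (f ≫ w) inferInstance
    exact weakEquivalence_of_postcomp f w
  wlog h₂ : IsCofibrant X generalizing X with H
  · let w := CofibrantObject.HoCat.pResolutionObj X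
    have := toHo_isIso w
    have : IsIso ((toHo 𝒞).map (w ≫ f)) := by rw [Functor.map_comp]; infer_instance
    have := H (w ≫ f) inferInstance
    exact weakEquivalence_of_precomp w f
  wlog h₃ : IsCofibrant Y generalizing Y with H
  · let w := CofibrantObject.HoCat.pResolutionObj Y
    have := toHo_isIso w
    have hf := isFibrant_of_fibration w
    have sq : CommSq (initial.to _) (initial.to X) w f := { }
    have : IsIso ((toHo 𝒞).map sq.lift) := by
      have e := congrArg (toHo 𝒞).map sq.fac_right
      rw [Functor.map_comp] at e
      exact (IsIso.eq_comp_inv _ |>.2 e) ▸ inferInstance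
    have := H hf sq.lift inferInstance
    rw [← sq.fac_right]
    infer_instance
  wlog h₄ : IsFibrant X generalizing X with H
  · let w := FibrantObject.HoCat.iResolutionObj X
    have := toHo_isIso w
    have hf := isCofibrant_of_cofibration w
    have sq : CommSq f w (terminal.from Y) (terminal.from _) := { }
    have : IsIso ((toHo 𝒞).map sq.lift) := by
      have e := congrArg (toHo 𝒞).map sq.fac_left
      rw [Functor.map_comp] at e
      exact (IsIso.eq_inv_comp _ |>.2 e) ▸ inferInstance
    have := H hf sq.lift inferInstance
    rw [← sq.fac_left]
    infer_instance
  let d := MorphismProperty.factorizationData (trivialCofibrations 𝒞) (fibrations 𝒞) f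
  have := isCofibrant_of_cofibration d.i
  have := isFibrant_of_fibration d.p
  have := toHo_isIso d.i
  have : IsIso ((toHo 𝒞).map d.p) := by
    have e := congrArg (toHo 𝒞).map d.fac
    rw [Functor.map_comp] at e
    exact (IsIso.eq_inv_comp _ |>.2 e) ▸ inferInstance
  have := weakEquivalence_of_fibration_of_isIso_toHo d.p
  rw [← d.fac]
  infer_instance

lemma toHo_isIso_iff {X Y : 𝒞} (f : X ⟶ Y) : IsIso ((toHo 𝒞).map f) ↔ WeakEquivalence f :=
  ⟨fun _ => weakEquivalence_of_isIso_toHo f, fun _ => toHo_isIso f⟩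

lemma toHo_map_surjective {X Y : 𝒞} [IsCofibrant X] [IsFibrant Y]
    (g : (toHo 𝒞).obj X ⟶ (toHo 𝒞).obj Y) : ∃ f : X ⟶ Y, (toHo 𝒞).map f = g :=
  map_surjective_of_isLocalization (toHo 𝒞) X Y g

/-- The homotopy extension property. -/
lemma exists_extension_of_toHo_eq {A B Y : 𝒞} [IsCofibrant A] [IsFibrant Y] (i : A ⟶ B)
    [Cofibration i] (g : B ⟶ Y) (f : A ⟶ Y) (h : (toHo 𝒞).map (i ≫ g) = (toHo 𝒞).map f) :
    ∃ g' : B ⟶ Y, i ≫ g' = f ∧ (toHo 𝒞).map g' = (toHo 𝒞).map g := by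
  rw [← LeftHomotopyRel.iff_map_eq] at h
  obtain ⟨Q, hQ⟩ := PathObject.exists_very_good Y
  let r := h.rightHomotopy Q
  -- The lift is a homotopy on `B` that starts at `g` and restricts to the given one on `A`; its
  -- other end is the required map.
  have sq : CommSq r.h i Q.p₀ g := ⟨r.h₀⟩
  have e : (toHo 𝒞).map Q.p₀ = (toHo 𝒞).map Q.p₁ := by
    have := toHo_isIso Q.ι
    rw [← cancel_epi ((toHo 𝒞).map Q.ι), ← Functor.map_comp, ← Functor.map_comp, Q.ι_p₀, Q.ι_p₁]
  refine ⟨sq.lift ≫ Q.p₁, by rw [← Category.assoc, sq.fac_left, r.h₁], ?_⟩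
  rw [Functor.map_comp, ← e, ← Functor.map_comp, sq.fac_right]

/-- A homotopy with respect to a given good cylinder. -/
lemma exists_leftHomotopy {X Y : 𝒞} [IsCofibrant X] [IsFibrant Y] (I : Cylinder X) [I.IsGood]
    (f g : X ⟶ Y) (h : (toHo 𝒞).map f = (toHo 𝒞).map g) : Nonempty (I.LeftHomotopy f g) := by
  rw [← LeftHomotopyRel.iff_map_eq] at h
  exact ⟨h.leftHomotopy I⟩

lemma toHo_eq_of_leftHomotopy {X Y : 𝒞} {I : Cylinder X} {f g : X ⟶ Y}
    (h : I.LeftHomotopy f g) : (toHo 𝒞).map f = (toHo 𝒞).map g :=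
  h.leftHomotopyRel.factorsThroughLocalization.map_eq _

/-- A weak equivalence becomes a monomorphism in `Ho`. Typically `a` and `b` are the two ends of a
cylinder-like object and `r` is its collapse, so that no explicit homotopy is needed. -/
lemma toHo_eq_of_retraction {X Y Z : 𝒞} (a b : X ⟶ Y) (r : Y ⟶ Z) [WeakEquivalence r]
    (h : a ≫ r = b ≫ r) : (toHo 𝒞).map a = (toHo 𝒞).map b := by
  have := toHo_isIso r
  rw [← cancel_mono ((toHo 𝒞).map r), ← Functor.map_comp, ← Functor.map_comp, h]

end Saturation

/-! ### Contractible objects in a pointed model category -/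

section Pointed

variable {𝒞 : Type u} [Category.{v} 𝒞] [HasZeroMorphisms 𝒞] [HasZeroObject 𝒞] [ModelCategory 𝒞]

@[simp]
lemma toHo_map_zero (X Y : 𝒞) : (toHo 𝒞).map (0 : X ⟶ Y) = 0 := by
  have e : (0 : X ⟶ Y) = (0 : X ⟶ (0 : 𝒞)) ≫ 0 := by simp
  rw [e, Functor.map_comp, isZero_toHo_zero.eq_of_tgt ((toHo 𝒞).map _) 0, zero_comp]

lemma isZero_toHo_iff (P : 𝒞) :
    IsZero ((toHo 𝒞).obj P) ↔ WeakEquivalence (0 : P ⟶ (0 : 𝒞)) := by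
  rw [← toHo_isIso_iff]
  refine ⟨fun h => ?_, fun h => ?_⟩
  · exact ⟨0, h.eq_of_src _ _, isZero_toHo_zero.eq_of_src _ _⟩
  · exact isZero_toHo_zero.of_iso (asIso ((toHo 𝒞).map (0 : P ⟶ (0 : 𝒞))))

lemma isZero_toHo_of_trivialFibration {P : 𝒞} (h : trivialFibrations 𝒞 (0 : P ⟶ (0 : 𝒞))) :
    IsZero ((toHo 𝒞).obj P) :=
  (isZero_toHo_iff P).2 ((mem_trivialFibrations_iff _).1 h).2

lemma isZero_toHo_cone (X : 𝒞) : IsZero ((toHo 𝒞).obj (cone X)) :=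
  isZero_toHo_of_trivialFibration (cone_trivialFibration X)

instance isCofibrant_zero : IsCofibrant (0 : 𝒞) := isCofibrant_of_isZero (isZero_zero 𝒞)

instance isFibrant_zero : IsFibrant (0 : 𝒞) := by
  have : IsIso (terminal.from (0 : 𝒞)) :=
    ⟨0, (isZero_zero 𝒞).eq_of_src _ _, terminalIsTerminal.hom_ext _ _⟩
  infer_instance

instance (X : 𝒞) [IsCofibrant X] : IsCofibrant (cone X) := isCofibrant_of_cofibration (coneι X)

instance cofibration_zero_from (X : 𝒞) [IsCofibrant X] : Cofibration (0 : (0 : 𝒞) ⟶ X) := by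
  have e : (0 : (0 : 𝒞) ⟶ X) = (0 : (0 : 𝒞) ⟶ ⊥_ 𝒞) ≫ initial.to X :=
    (isZero_zero 𝒞).eq_of_src _ _
  have : IsIso (0 : (0 : 𝒞) ⟶ ⊥_ 𝒞) :=
    ⟨initial.to _, (isZero_zero 𝒞).eq_of_src _ _, initialIsInitial.hom_ext _ _⟩
  rw [e]
  infer_instance

instance fibration_zero_to (X : 𝒞) [IsFibrant X] : Fibration (0 : X ⟶ (0 : 𝒞)) := by
  have e : (0 : X ⟶ (0 : 𝒞)) = terminal.from X ≫ (0 : ⊤_ 𝒞 ⟶ (0 : 𝒞)) :=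
    (isZero_zero 𝒞).eq_of_tgt _ _
  have : IsIso (0 : ⊤_ 𝒞 ⟶ (0 : 𝒞)) :=
    ⟨terminal.from _, terminalIsTerminal.hom_ext _ _, (isZero_zero 𝒞).eq_of_tgt _ _⟩
  rw [e]
  infer_instance

lemma trivialFibration_of_isZero_toHo {P : 𝒞} [IsFibrant P] (h : IsZero ((toHo 𝒞).obj P)) :
    trivialFibrations 𝒞 (0 : P ⟶ (0 : 𝒞)) := by
  have := (isZero_toHo_iff P).1 h
  exact mem_trivialFibrations _

/-- A map between contractible objects is a weak equivalence. -/
lemma weakEquivalence_of_isZero {P Q : 𝒞} (f : P ⟶ Q) (hP : IsZero ((toHo 𝒞).obj P))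
    (hQ : IsZero ((toHo 𝒞).obj Q)) : WeakEquivalence f := by
  rw [← toHo_isIso_iff]
  exact ⟨0, hP.eq_of_src _ _, hQ.eq_of_src _ _⟩

lemma isZero_toHo_of_weakEquivalence {P Q : 𝒞} (f : P ⟶ Q) [WeakEquivalence f]
    (hP : IsZero ((toHo 𝒞).obj P)) : IsZero ((toHo 𝒞).obj Q) := by
  have := toHo_isIso f
  exact hP.of_iso (asIso ((toHo 𝒞).map f)).symm

lemma isZero_toHo_of_weakEquivalence' {P Q : 𝒞} (f : P ⟶ Q) [WeakEquivalence f]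
    (hQ : IsZero ((toHo 𝒞).obj Q)) : IsZero ((toHo 𝒞).obj P) := by
  have := toHo_isIso f
  exact hQ.of_iso (asIso ((toHo 𝒞).map f))

lemma toHo_map_eq_zero_of_factor {X P Y : 𝒞} (hP : IsZero ((toHo 𝒞).obj P)) (a : X ⟶ P)
    (b : P ⟶ Y) : (toHo 𝒞).map (a ≫ b) = 0 := by
  rw [Functor.map_comp, hP.eq_of_tgt ((toHo 𝒞).map a) 0, zero_comp]

/-- A null map from a cofibrant object to a fibrant one extends over every cofibration. -/
lemma exists_extension_of_toHo_eq_zero {A B Y : 𝒞} [IsCofibrant A] [IsFibrant Y] (i : A ⟶ B)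
    [Cofibration i] (f : A ⟶ Y) (h : (toHo 𝒞).map f = 0) : ∃ g : B ⟶ Y, i ≫ g = f := by
  obtain ⟨g, hg, -⟩ := exists_extension_of_toHo_eq i (0 : B ⟶ Y) f (by simp [h])
  exact ⟨g, hg⟩

end Pointed

end StableTot

namespace StableTot

/-! ### Mapping cylinders of maps of pairs -/

section Pairs

variable {𝒞 : Type u} [Category.{v} 𝒞] [ModelCategory 𝒞]

/-- Factorization of a map `(A ⟶ B) ⟶ (A' ⟶ B')` of cofibrations through a mapping cylinder
`Z₀ ⟶ Z₁`. -/
structure PairFactorization {A B A' B' : 𝒞} (i : A ⟶ B) (i' : A' ⟶ B') (a : A ⟶ A')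
    (b : B ⟶ B') where
  Z₀ : 𝒞
  Z₁ : 𝒞
  k : Z₀ ⟶ Z₁
  s : A ⟶ Z₀
  s' : A' ⟶ Z₀
  r : Z₀ ⟶ A'
  t : pushout i s ⟶ Z₁
  t' : pushout i' s' ⟶ Z₁
  q : Z₁ ⟶ B'
  inr_t : pushout.inr i s ≫ t = k
  inr_t' : pushout.inr i' s' ≫ t' = k
  s_r : s ≫ r = a
  s'_r : s' ≫ r = 𝟙 A'
  k_q : k ≫ q = r ≫ i'
  inl_t_q : pushout.inl i s ≫ t ≫ q = b
  inl_t'_q : pushout.inl i' s' ≫ t' ≫ q = 𝟙 B'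
  cofibration_s : Cofibration s
  cofibration_s' : Cofibration s'
  cofibration_t : Cofibration t
  cofibration_t' : Cofibration t'
  weakEquivalence_r : WeakEquivalence r
  weakEquivalence_q : WeakEquivalence q

attribute [instance] PairFactorization.cofibration_s PairFactorization.cofibration_s'
  PairFactorization.cofibration_t PairFactorization.cofibration_t'
  PairFactorization.weakEquivalence_r PairFactorization.weakEquivalence_q

/-- This is a mapping cylinder in the Reedy sense. `Z₀` factors `A ⨿ A' ⟶ A'`, and `Z₁` factors the
map to `B'` from the union of `B`, `B'` and `Z₀`, so that the relative maps `t` and `t'` are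
cofibrations along with `s` and `s'`. -/
lemma nonempty_pairFactorization {A B A' B' : 𝒞} [IsCofibrant A] [IsCofibrant A']
    (i : A ⟶ B) (i' : A' ⟶ B') [Cofibration i] [Cofibration i'] (a : A ⟶ A') (b : B ⟶ B')
    (h : i ≫ b = a ≫ i') : Nonempty (PairFactorization i i' a b) := by
  let d := MorphismProperty.factorizationData (cofibrations 𝒞) (trivialFibrations 𝒞)
    (coprod.desc a (𝟙 A'))
  let s : A ⟶ d.Z := coprod.inl ≫ d.i
  let s' : A' ⟶ d.Z := coprod.inr ≫ d.i
  have hs : s ≫ d.p = a := by simp [s, coprod.inl_desc]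
  have hs' : s' ≫ d.p = 𝟙 A' := by simp [s', coprod.inr_desc]
  let u : pushout i s ⟶ B' := pushout.desc b (d.p ≫ i') (by rw [h, reassoc_of% hs])
  let u' : pushout i' s' ⟶ B' := pushout.desc (𝟙 B') (d.p ≫ i') (by
    rw [reassoc_of% hs', Category.comp_id])
  let e := MorphismProperty.factorizationData (cofibrations 𝒞) (trivialFibrations 𝒞)
    (pushout.desc u u' (by simp only [u, u', pushout.inr_desc]) :
      pushout (pushout.inr i s) (pushout.inr i' s') ⟶ B')
  exact ⟨{
    Z₀ := d.Z
    Z₁ := e.Z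
    k := pushout.inr i s ≫ pushout.inl _ _ ≫ e.i
    s := s
    s' := s'
    r := d.p
    t := pushout.inl _ _ ≫ e.i
    t' := pushout.inr _ _ ≫ e.i
    q := e.p
    inr_t := rfl
    inr_t' := (pushout.condition_assoc _).symm
    s_r := hs
    s'_r := hs'
    k_q := by simp only [Category.assoc, e.fac, pushout.inl_desc, u, pushout.inr_desc]
    inl_t_q := by simp only [Category.assoc, e.fac, pushout.inl_desc, u]
    inl_t'_q := by simp only [Category.assoc, e.fac, pushout.inl_desc, pushout.inr_desc, u']
    cofibration_s := inferInstance
    cofibration_s' := inferInstance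
    cofibration_t := inferInstance
    cofibration_t' := inferInstance
    weakEquivalence_r := inferInstance
    weakEquivalence_q := inferInstance }⟩

end Pairs

/-! ### Homotopy invariance of quotients by cofibrations -/

section Cokernels

variable {𝒞 : Type u} [Category.{v} 𝒞] [HasZeroMorphisms 𝒞] [ModelCategory 𝒞]

/-- A cobase change does not change the cokernel. -/
lemma isIso_cokernelMap_of_isPushout {A B A' B' : 𝒞} {i : A ⟶ B} {a : A ⟶ A'} {b : B ⟶ B'}
    {i' : A' ⟶ B'} (h : IsPushout i a b i') : IsIso (cokernel.map i i' a b h.w) := by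
  refine ⟨cokernel.desc i' (h.desc (cokernel.π i) 0 (by simp)) (h.inr_desc _ _ _), ?_, ?_⟩
  · apply cokernel_hom_ext
    simp
  · apply cokernel_hom_ext
    apply h.hom_ext <;> simp

instance isIso_cokernelMap_pushout_inl {A B A' : 𝒞} (i : A ⟶ B) (a : A ⟶ A') :
    IsIso (cokernel.map i (pushout.inr i a) a (pushout.inl i a) pushout.condition) :=
  isIso_cokernelMap_of_isPushout (IsPushout.of_hasPushout i a)

instance isIso_cokernelMap_pushout_inr {A B A' : 𝒞} (i : A ⟶ B) (a : A ⟶ A') :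
    IsIso (cokernel.map i (pushout.inl a i) a (pushout.inr a i) pushout.condition.symm) :=
  isIso_cokernelMap_of_isPushout (IsPushout.of_hasPushout a i).flip

lemma cokernelMap_comp {A B A' B' A'' B'' : 𝒞} {i : A ⟶ B} {i' : A' ⟶ B'} {i'' : A'' ⟶ B''}
    (a : A ⟶ A') (b : B ⟶ B') (a' : A' ⟶ A'') (b' : B' ⟶ B'') (h : i ≫ b = a ≫ i')
    (h' : i' ≫ b' = a' ≫ i'') :
    cokernel.map i i' a b h ≫ cokernel.map i' i'' a' b' h' =
      cokernel.map i i'' (a ≫ a') (b ≫ b') (by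
        rw [← Category.assoc, h, Category.assoc, h', Category.assoc]) := by
  apply cokernel_hom_ext
  simp

lemma cokernelMap_congr {A B A' B' : 𝒞} {i : A ⟶ B} {i' : A' ⟶ B'} {a₁ a₂ : A ⟶ A'}
    {b₁ b₂ : B ⟶ B'} (h₁ : i ≫ b₁ = a₁ ≫ i') (h₂ : i ≫ b₂ = a₂ ≫ i') (hb : b₁ = b₂) :
    cokernel.map i i' a₁ b₁ h₁ = cokernel.map i i' a₂ b₂ h₂ := by
  subst hb
  apply cokernel_hom_ext
  simp

/-- Weak equivalences between cofibrations of cofibrant objects induce weak equivalences on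
cokernels. -/
lemma weakEquivalence_cokernelMap_of_weakEquivalence {A B A' B' : 𝒞} [IsCofibrant A]
    [IsCofibrant A'] (i : A ⟶ B) (i' : A' ⟶ B') [Cofibration i] [Cofibration i'] (a : A ⟶ A')
    (b : B ⟶ B') (h : i ≫ b = a ≫ i') [WeakEquivalence a] [WeakEquivalence b] :
    WeakEquivalence (cokernel.map i i' a b h) := by
  obtain ⟨d⟩ := nonempty_pairFactorization i i' a b h
  -- As in Ken Brown's lemma, two out of three makes `s`, `s'`, `t`, `t'` trivial cofibrations,
  -- whose effect on cokernels is controlled by cobase change. The retraction `(r, q)` is then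
  -- handled because it splits the second leg.
  have : WeakEquivalence d.s := weakEquivalence_of_postcomp_of_fac d.s_r
  have : WeakEquivalence d.s' := weakEquivalence_of_postcomp_of_fac d.s'_r
  have : WeakEquivalence (d.t ≫ d.q) := weakEquivalence_of_precomp_of_fac d.inl_t_q
  have : WeakEquivalence (d.t' ≫ d.q) := weakEquivalence_of_precomp_of_fac d.inl_t'_q
  have : WeakEquivalence d.t := weakEquivalence_of_postcomp d.t d.q
  have : WeakEquivalence d.t' := weakEquivalence_of_postcomp d.t' d.q
  have h₁ := weakEquivalence_cokernelMap (pushout.inr i d.s) d.t d.k d.inr_t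
  have h₂ := weakEquivalence_cokernelMap (pushout.inr i' d.s') d.t' d.k d.inr_t'
  have e₁ : i ≫ pushout.inl i d.s ≫ d.t = d.s ≫ d.k := by
    rw [pushout.condition_assoc, d.inr_t]
  have e₂ : i' ≫ pushout.inl i' d.s' ≫ d.t' = d.s' ≫ d.k := by
    rw [pushout.condition_assoc, d.inr_t']
  have w₁ : WeakEquivalence (cokernel.map i d.k d.s _ e₁) := by
    rw [cokernelMap_congr (a₂ := d.s ≫ 𝟙 _) e₁ (by rw [Category.comp_id, e₁]) rfl,
      ← cokernelMap_comp d.s (pushout.inl i d.s) (𝟙 _) d.t pushout.condition (by simp [d.inr_t])]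
    infer_instance
  have w₂ : WeakEquivalence (cokernel.map i' d.k d.s' _ e₂) := by
    rw [cokernelMap_congr (a₂ := d.s' ≫ 𝟙 _) e₂ (by rw [Category.comp_id, e₂]) rfl,
      ← cokernelMap_comp d.s' (pushout.inl i' d.s') (𝟙 _) d.t' pushout.condition
        (by simp [d.inr_t'])]
    infer_instance
  have w₃ : WeakEquivalence (cokernel.map d.k i' d.r d.q d.k_q) := by
    apply weakEquivalence_of_precomp_of_fac (f := cokernel.map i' d.k d.s' _ e₂) (fg := 𝟙 _)
    apply cokernel_hom_ext
    simpa using d.inl_t'_q =≫ cokernel.π i'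
  have e : cokernel.map i i' a b h =
      cokernel.map i d.k d.s _ e₁ ≫ cokernel.map d.k i' d.r d.q d.k_q := by
    apply cokernel_hom_ext
    simpa using d.inl_t_q.symm =≫ cokernel.π i'
  rw [e]
  infer_instance

variable [HasZeroObject 𝒞]

lemma isIso_cokernelπ_of_isZero {A B : 𝒞} (hA : IsZero A) (i : A ⟶ B) :
    IsIso (cokernel.π i) :=
  ⟨cokernel.desc i (𝟙 B) (hA.eq_of_src _ _), by simp, cokernel_hom_ext (by simp)⟩

/-- Collapsing a contractible subobject is a weak equivalence. -/
lemma weakEquivalence_cokernelπ {A B : 𝒞} [IsCofibrant A] (i : A ⟶ B) [Cofibration i]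
    (hA : IsZero ((toHo 𝒞).obj A)) : WeakEquivalence (cokernel.π i) := by
  have : IsCofibrant B := isCofibrant_of_cofibration i
  -- The pair `0 ⟶ B`, whose quotient is `B` itself, is compared with the pair `A ⟶ B`.
  have : WeakEquivalence (0 : (0 : 𝒞) ⟶ A) := weakEquivalence_of_isZero _ isZero_toHo_zero hA
  have := weakEquivalence_cokernelMap_of_weakEquivalence (0 : (0 : 𝒞) ⟶ B) i 0 (𝟙 B) (by simp)
  have := isIso_cokernelπ_of_isZero (isZero_zero 𝒞) (0 : (0 : 𝒞) ⟶ B)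
  have e : cokernel.π i = cokernel.π (0 : (0 : 𝒞) ⟶ B) ≫
    cokernel.map (0 : (0 : 𝒞) ⟶ B) i 0 (𝟙 B) (by simp) := by simp
  rw [e]
  infer_instance

/-- The map `A / A ⟶ B / A` is a cobase change of the trivial cofibration `i`, and `A / A` is zero.
-/
lemma isZero_toHo_cokernel_of_weakEquivalence {A B : 𝒞} [IsCofibrant A] (i : A ⟶ B)
    [Cofibration i] [WeakEquivalence i] : IsZero ((toHo 𝒞).obj (cokernel i)) := by
  have := weakEquivalence_cokernelMap (𝟙 A) i i (Category.id_comp i)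
  have h : IsZero (cokernel (𝟙 A)) :=
    (IsZero.iff_id_eq_zero _).2 (cokernel_hom_ext (by
      rw [Category.comp_id, comp_zero, ← Category.id_comp (cokernel.π (𝟙 A)),
        cokernel.condition]))
  refine isZero_toHo_of_weakEquivalence (cokernel.map (𝟙 A) i (𝟙 A) i rfl) ?_
  exact isZero_toHo_zero.of_iso ((toHo 𝒞).mapIso (h.iso (isZero_zero 𝒞)))

/-- A cofibrant object is contractible if it becomes so after collapsing a contractible
subobject. -/
lemma isZero_toHo_of_isZero_cokernel {A B : 𝒞} [IsCofibrant A] (i : A ⟶ B) [Cofibration i]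
    (hA : IsZero ((toHo 𝒞).obj A)) (h : IsZero ((toHo 𝒞).obj (cokernel i))) :
    IsZero ((toHo 𝒞).obj B) := by
  have := weakEquivalence_cokernelπ i hA
  exact isZero_toHo_of_weakEquivalence' (cokernel.π i) h

end Cokernels

end StableTot

namespace StableTot

/-! ### Naturality of the suspension and of its model as a double cone -/

section Suspension

variable {𝒞 : Type u} [Category.{v} 𝒞] [HasZeroMorphisms 𝒞] [HasZeroObject 𝒞] [ModelCategory 𝒞]

@[simp]
lemma π_suspMap {X Y : 𝒞} (f : X ⟶ Y) :
    cokernel.π (coneι X) ≫ suspMap f = coneMap f ≫ cokernel.π (coneι Y) := by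
  simp [suspMap]

@[simp]
lemma π_suspMap_assoc {X Y Z : 𝒞} (f : X ⟶ Y) (g : suspObj Y ⟶ Z) :
    cokernel.π (coneι X) ≫ suspMap f ≫ g = coneMap f ≫ cokernel.π (coneι Y) ≫ g := by
  rw [← Category.assoc, π_suspMap, Category.assoc]

instance (X : 𝒞) [IsCofibrant X] : IsCofibrant (suspObj X) := isCofibrant_cokernel _

lemma suspIso_hom_naturality {X Y : 𝒞} [IsCofibrant X] [IsCofibrant Y] (f : X ⟶ Y) :
    (susp 𝒞).map ((toHo 𝒞).map f) ≫ (suspIso Y).hom =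
      (suspIso X).hom ≫ (toHo 𝒞).map (suspMap f) :=
  (Localization.fac (suspCofibrant 𝒞) suspCofibrant_inverts
    (CofibrantObject.ι ⋙ toHo 𝒞)).hom.naturality (CofibrantObject.homMk f)

lemma suspIso_hom_naturality_assoc {X Y : 𝒞} [IsCofibrant X] [IsCofibrant Y] (f : X ⟶ Y)
    {Z : Ho 𝒞} (g : (toHo 𝒞).obj (suspObj Y) ⟶ Z) :
    (susp 𝒞).map ((toHo 𝒞).map f) ≫ (suspIso Y).hom ≫ g =
      (suspIso X).hom ≫ (toHo 𝒞).map (suspMap f) ≫ g := by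
  rw [← Category.assoc, suspIso_hom_naturality, Category.assoc]

lemma suspIso_inv_naturality {X Y : 𝒞} [IsCofibrant X] [IsCofibrant Y] (f : X ⟶ Y) :
    (suspIso X).inv ≫ (susp 𝒞).map ((toHo 𝒞).map f) =
      (toHo 𝒞).map (suspMap f) ≫ (suspIso Y).inv := by
  rw [Iso.inv_comp_eq, ← suspIso_hom_naturality_assoc, Iso.hom_inv_id, Category.comp_id]

lemma suspIso_inv_naturality_assoc {X Y : 𝒞} [IsCofibrant X] [IsCofibrant Y] (f : X ⟶ Y)
    {Z : Ho 𝒞} (g : (susp 𝒞).obj ((toHo 𝒞).obj Y) ⟶ Z) :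
    (suspIso X).inv ≫ (susp 𝒞).map ((toHo 𝒞).map f) ≫ g =
      (toHo 𝒞).map (suspMap f) ≫ (suspIso Y).inv ≫ g := by
  rw [← Category.assoc, suspIso_inv_naturality, Category.assoc]

lemma toHo_suspMap {X Y : 𝒞} [IsCofibrant X] [IsCofibrant Y] (f : X ⟶ Y) :
    (toHo 𝒞).map (suspMap f) =
      (suspIso X).inv ≫ (susp 𝒞).map ((toHo 𝒞).map f) ≫ (suspIso Y).hom := by
  rw [suspIso_hom_naturality, Iso.inv_hom_id_assoc]

lemma toHo_suspMap_congr {X Y : 𝒞} [IsCofibrant X] [IsCofibrant Y] {f g : X ⟶ Y}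
    (h : (toHo 𝒞).map f = (toHo 𝒞).map g) :
    (toHo 𝒞).map (suspMap f) = (toHo 𝒞).map (suspMap g) := by
  rw [toHo_suspMap, h, ← toHo_suspMap]

lemma toHo_suspMap_comp {X Y Z : 𝒞} [IsCofibrant X] [IsCofibrant Y] [IsCofibrant Z] (f : X ⟶ Y)
    (g : Y ⟶ Z) : (toHo 𝒞).map (suspMap (f ≫ g)) =
      (toHo 𝒞).map (suspMap f) ≫ (toHo 𝒞).map (suspMap g) := by
  simp [toHo_suspMap]

lemma weakEquivalence_suspMap {X Y : 𝒞} [IsCofibrant X] [IsCofibrant Y] (f : X ⟶ Y)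
    [WeakEquivalence f] : WeakEquivalence (suspMap f) := by
  have := toHo_isIso f
  rw [← toHo_isIso_iff, toHo_suspMap]
  infer_instance

/-- Gluing a contractible object along `f` does not change the cokernel. -/
lemma weakEquivalence_pushoutDesc_zero_π {A B P : 𝒞} [IsCofibrant P] (f : A ⟶ P) (i : A ⟶ B)
    [Cofibration i] (hP : IsZero ((toHo 𝒞).obj P)) :
    WeakEquivalence (pushout.desc 0 (cokernel.π i) (by simp) : pushout f i ⟶ cokernel i) := by
  have := weakEquivalence_cokernelπ (pushout.inl f i) hP
  have e : (pushout.desc 0 (cokernel.π i) (by simp) : pushout f i ⟶ cokernel i) =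
      cokernel.π (pushout.inl f i) ≫
        inv (cokernel.map i (pushout.inl f i) f (pushout.inr f i) pushout.condition.symm) := by
    rw [IsIso.eq_comp_inv]
    apply pushout.hom_ext
    · rw [pushout.inl_desc_assoc, zero_comp, cokernel.condition]
    · rw [pushout.inr_desc_assoc, cokernel.π_desc]
  rw [e]
  infer_instance

lemma weakEquivalence_pushoutDesc_π_zero {A B P : 𝒞} [IsCofibrant P] (f : A ⟶ P) (i : A ⟶ B)
    [Cofibration i] (hP : IsZero ((toHo 𝒞).obj P)) :
    WeakEquivalence (pushout.desc (cokernel.π i) 0 (by simp) : pushout i f ⟶ cokernel i) := by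
  have := weakEquivalence_cokernelπ (pushout.inr i f) hP
  have e : (pushout.desc (cokernel.π i) 0 (by simp) : pushout i f ⟶ cokernel i) =
      cokernel.π (pushout.inr i f) ≫
        inv (cokernel.map i (pushout.inr i f) f (pushout.inl i f) pushout.condition) := by
    rw [IsIso.eq_comp_inv]
    apply pushout.hom_ext
    · rw [pushout.inl_desc_assoc, cokernel.π_desc]
    · rw [pushout.inr_desc_assoc, zero_comp, cokernel.condition]
  rw [e]
  infer_instance

/-- The union of two cones on `X`. -/
noncomputable abbrev dblCone (X : 𝒞) : 𝒞 := pushout (coneι X) (coneι X)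

/-- The map from the union of two cones to the suspension which collapses the first cone. -/
noncomputable abbrev dblConeπ (X : 𝒞) : dblCone X ⟶ suspObj X :=
  pushout.desc 0 (cokernel.π (coneι X)) (by simp)

instance (X : 𝒞) [IsCofibrant X] : WeakEquivalence (dblConeπ X) :=
  weakEquivalence_pushoutDesc_zero_π _ _ (isZero_toHo_cone X)

instance (X : 𝒞) [IsCofibrant X] : IsCofibrant (dblCone X) :=
  isCofibrant_of_cofibration (pushout.inl (coneι X) (coneι X))

/-- The map induced on unions of two cones. -/
noncomputable def dblConeMap {X Y : 𝒞} (f : X ⟶ Y) : dblCone X ⟶ dblCone Y :=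
  pushout.desc (coneMap f ≫ pushout.inl _ _) (coneMap f ≫ pushout.inr _ _) (by
    rw [coneι_coneMap_assoc, coneι_coneMap_assoc, pushout.condition])

@[simp]
lemma inl_dblConeMap {X Y : 𝒞} (f : X ⟶ Y) :
    pushout.inl _ _ ≫ dblConeMap f = coneMap f ≫ pushout.inl _ _ := pushout.inl_desc _ _ _

@[simp]
lemma inl_dblConeMap_assoc {X Y Z : 𝒞} (f : X ⟶ Y) (g : dblCone Y ⟶ Z) :
    pushout.inl _ _ ≫ dblConeMap f ≫ g = coneMap f ≫ pushout.inl _ _ ≫ g := by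
  rw [← Category.assoc, inl_dblConeMap, Category.assoc]

@[simp]
lemma inr_dblConeMap {X Y : 𝒞} (f : X ⟶ Y) :
    pushout.inr _ _ ≫ dblConeMap f = coneMap f ≫ pushout.inr _ _ := pushout.inr_desc _ _ _

@[simp]
lemma inr_dblConeMap_assoc {X Y Z : 𝒞} (f : X ⟶ Y) (g : dblCone Y ⟶ Z) :
    pushout.inr _ _ ≫ dblConeMap f ≫ g = coneMap f ≫ pushout.inr _ _ ≫ g := by
  rw [← Category.assoc, inr_dblConeMap, Category.assoc]

lemma dblConeMap_dblConeπ {X Y : 𝒞} (f : X ⟶ Y) :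
    dblConeMap f ≫ dblConeπ Y = dblConeπ X ≫ suspMap f := by
  apply pushout.hom_ext
  · rw [inl_dblConeMap_assoc, pushout.inl_desc, pushout.inl_desc_assoc, zero_comp, comp_zero]
  · rw [inr_dblConeMap_assoc, pushout.inr_desc, pushout.inr_desc_assoc, π_suspMap]

end Suspension

/-! ### Consequences of stability: desuspension and the five lemma -/

section Stable

variable {𝒞 : Type u} [Category.{v} 𝒞] [HasZeroMorphisms 𝒞] [HasZeroObject 𝒞] [ModelCategory 𝒞]
  [StableModelCategory 𝒞]

instance : (susp 𝒞).IsEquivalence := StableModelCategory.isEquivalence_susp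

/-- Stability enters here as faithfulness of `Σ`: equations in `Ho` may be checked after one
suspension. -/
lemma toHo_eq_of_suspMap_eq {X Y : 𝒞} [IsCofibrant X] [IsCofibrant Y] {f g : X ⟶ Y}
    (h : (toHo 𝒞).map (suspMap f) = (toHo 𝒞).map (suspMap g)) :
    (toHo 𝒞).map f = (toHo 𝒞).map g := by
  rw [toHo_suspMap, toHo_suspMap, cancel_epi, cancel_mono] at h
  exact (susp 𝒞).map_injective h

/-- Fullness of `Σ` desuspends the class; `X` cofibrant and `Y` fibrant make the result
representable by a map in `𝒞`. -/
lemma exists_toHo_suspMap_eq {X Y : 𝒞} [IsCofibrant X] [IsCofibrant Y] [IsFibrant Y]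
    (g : (toHo 𝒞).obj (suspObj X) ⟶ (toHo 𝒞).obj (suspObj Y)) :
    ∃ f : X ⟶ Y, (toHo 𝒞).map (suspMap f) = g := by
  obtain ⟨f', hf'⟩ := (susp 𝒞).map_surjective ((suspIso X).hom ≫ g ≫ (suspIso Y).inv)
  obtain ⟨f, rfl⟩ := toHo_map_surjective f'
  exact ⟨f, by simp [toHo_suspMap, hf']⟩

/-- An equivalence of categories reflects isomorphisms, and saturation returns from isomorphisms in
`Ho` to weak equivalences. -/
lemma weakEquivalence_of_suspMap {X Y : 𝒞} [IsCofibrant X] [IsCofibrant Y] (f : X ⟶ Y)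
    [WeakEquivalence (suspMap f)] : WeakEquivalence f := by
  have h := toHo_isIso (suspMap f)
  rw [toHo_suspMap, isIso_comp_left_iff, isIso_comp_right_iff] at h
  have := isIso_of_reflects_iso ((toHo 𝒞).map f) (susp 𝒞)
  exact weakEquivalence_of_isIso_toHo f

lemma exists_bifibrant_iso (Z : Ho 𝒞) :
    ∃ (X : 𝒞) (_ : IsCofibrant X) (_ : IsFibrant X), Nonempty ((toHo 𝒞).obj X ≅ Z) := by
  have := Localization.essSurj (toHo 𝒞) (weakEquivalences 𝒞)
  let X := (toHo 𝒞).objPreimage Z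
  let p := CofibrantObject.HoCat.pResolutionObj X
  let i := FibrantObject.HoCat.iResolutionObj (CofibrantObject.HoCat.resolutionObj X)
  have := toHo_isIso p
  have := toHo_isIso i
  exact ⟨_, isCofibrant_of_cofibration i, inferInstance,
    ⟨(asIso ((toHo 𝒞).map i)).symm ≪≫ asIso ((toHo 𝒞).map p) ≪≫ (toHo 𝒞).objObjPreimageIso Z⟩⟩

lemma exists_desuspension (Z : Ho 𝒞) : ∃ (X : 𝒞) (_ : IsCofibrant X) (_ : IsFibrant X),
    Nonempty ((toHo 𝒞).obj (suspObj X) ≅ Z) := by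
  obtain ⟨X, hX, hX', ⟨e⟩⟩ := exists_bifibrant_iso ((susp 𝒞).objPreimage Z)
  exact ⟨X, hX, hX',
    ⟨(suspIso X).symm ≪≫ (susp 𝒞).mapIso e ≪≫ (susp 𝒞).objObjPreimageIso Z⟩⟩

/-- In a stable model category, a cofibration with contractible cokernel is a weak equivalence. -/
lemma weakEquivalence_of_isZero_cokernel {X Y : 𝒞} [IsCofibrant X] (j : X ⟶ Y) [Cofibration j]
    (h : IsZero ((toHo 𝒞).obj (cokernel j))) : WeakEquivalence j := by
  have : IsCofibrant Y := isCofibrant_of_cofibration j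
  -- `P` is the mapping cone of `j`. It is contractible because `P / CX ≅ Y / X`. Comparing it with
  -- `CY` under `Y` identifies `P / Y ≅ ΣX` with `ΣY`, and this comparison is `Σj`.
  let P := pushout j (coneι X)
  have hP : IsZero ((toHo 𝒞).obj P) := by
    refine isZero_toHo_of_isZero_cokernel (pushout.inr j (coneι X)) (isZero_toHo_cone X) ?_
    exact h.of_iso ((toHo 𝒞).mapIso (asIso (cokernel.map j (pushout.inr j (coneι X)) (coneι X)
      (pushout.inl j (coneι X)) pushout.condition)).symm)
  let c : P ⟶ cone Y := pushout.desc (coneι Y) (coneMap j) (by simp)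
  have hc : WeakEquivalence c := weakEquivalence_of_isZero c hP (isZero_toHo_cone Y)
  have := weakEquivalence_cokernelMap_of_weakEquivalence (pushout.inl j (coneι X)) (coneι Y) (𝟙 Y)
    c (by simp [c, pushout.inl_desc])
  have e : suspMap j = cokernel.map (coneι X) (pushout.inl j (coneι X)) j
      (pushout.inr j (coneι X)) pushout.condition.symm ≫
      cokernel.map (pushout.inl j (coneι X)) (coneι Y) (𝟙 Y) c
        (by simp [c, pushout.inl_desc]) := by
    apply cokernel_hom_ext
    simp [c, pushout.inr_desc_assoc]
  have : WeakEquivalence (suspMap j) := by rw [e]; infer_instance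
  exact weakEquivalence_of_suspMap j

/-- The cofiber of `j` is `(R / X) / (P / X)`, which is contractible as the cofiber of a trivial
cofibration; stability then recovers `j`. -/
lemma weakEquivalence_of_weakEquivalence_cokernelMap {X P R : 𝒞} [IsCofibrant X] (i : X ⟶ P)
    (j : P ⟶ R) (k : X ⟶ R) (h : i ≫ j = k) [Cofibration i] [Cofibration j]
    (hw : WeakEquivalence (cokernel.map i k (𝟙 X) j (by simp [h]))) : WeakEquivalence j := by
  subst h
  have : IsCofibrant P := isCofibrant_of_cofibration i
  have := isCofibrant_cokernel i
  have := cofibration_cokernelMap i j _ rfl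
  exact weakEquivalence_of_isZero_cokernel j
    ((isZero_toHo_cokernel_of_weakEquivalence (cokernel.map i (i ≫ j) (𝟙 X) j _)).of_iso
      ((toHo 𝒞).mapIso (quotientIso i j).symm))

/-- The five lemma for cofiber sequences. -/
lemma weakEquivalence_of_cokernelMap {A B A' B' : 𝒞} [IsCofibrant A]
    [IsCofibrant A'] (i : A ⟶ B) (i' : A' ⟶ B') [Cofibration i] [Cofibration i'] (a : A ⟶ A')
    (b : B ⟶ B') (h : i ≫ b = a ≫ i') [WeakEquivalence a]
    (hw : WeakEquivalence (cokernel.map i i' a b h)) : WeakEquivalence b := by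
  obtain ⟨d⟩ := nonempty_pairFactorization i i' a b h
  have : WeakEquivalence d.s := weakEquivalence_of_postcomp_of_fac d.s_r
  have : IsCofibrant d.Z₀ := isCofibrant_of_cofibration d.s
  have : Cofibration d.k := by rw [← d.inr_t]; infer_instance
  have w₁ := weakEquivalence_cokernelMap_of_weakEquivalence d.k i' d.r d.q d.k_q
  have e₁ : pushout.inr i d.s ≫ d.t = 𝟙 d.Z₀ ≫ d.k := by simp [d.inr_t]
  have e : cokernel.map i i' a b h =
      (cokernel.map i (pushout.inr i d.s) d.s (pushout.inl i d.s) pushout.condition ≫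
        cokernel.map (pushout.inr i d.s) d.k (𝟙 _) d.t e₁) ≫
        cokernel.map d.k i' d.r d.q d.k_q := by
    apply cokernel_hom_ext
    simpa using d.inl_t_q.symm =≫ cokernel.π i'
  -- Cancelling the isomorphism and the comparison induced by `(r, q)` leaves the cofibration `t`
  -- under `Z₀`.
  rw [e, weakEquivalence_postcomp_iff, weakEquivalence_precomp_iff] at hw
  have := weakEquivalence_of_weakEquivalence_cokernelMap (pushout.inr i d.s) d.t d.k d.inr_t hw
  rw [← d.inl_t_q]
  infer_instance

end Stable

end StableTot

namespace StableTot

/-! ### Rotation and exactness of cofiber sequences -/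

section Rotation

variable {𝒞 : Type u} [Category.{v} 𝒞] [HasZeroMorphisms 𝒞] [HasZeroObject 𝒞] [ModelCategory 𝒞]

/-- A commuting square of cofibrations in the homotopy category induces maps of cokernels. -/
lemma exists_cokernel_iso {A B A' B' : 𝒞} [IsCofibrant A] [IsCofibrant A'] [IsFibrant A']
    (i : A ⟶ B) (i' : A' ⟶ B') [Cofibration i] [Cofibration i']
    (a : (toHo 𝒞).obj A ⟶ (toHo 𝒞).obj A') (b : (toHo 𝒞).obj B ⟶ (toHo 𝒞).obj B') [IsIso a]
    [IsIso b] (h : (toHo 𝒞).map i ≫ b = a ≫ (toHo 𝒞).map i') :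
    ∃ β : (toHo 𝒞).obj (cokernel i) ⟶ (toHo 𝒞).obj (cokernel i'),
      IsIso β ∧ (toHo 𝒞).map (cokernel.π i) ≫ β = b ≫ (toHo 𝒞).map (cokernel.π i') := by
  have : IsCofibrant B := isCofibrant_of_cofibration i
  let ι := FibrantObject.HoCat.iResolutionObj B'
  have := toHo_isIso ι
  obtain ⟨f, rfl⟩ := toHo_map_surjective a
  obtain ⟨g₀, hg₀⟩ := toHo_map_surjective (b ≫ (toHo 𝒞).map ι)
  -- The square commutes only in `Ho`; homotopy extension along `i` makes it strict, so that it acts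
  -- on quotients.
  obtain ⟨g, hg, hg'⟩ := exists_extension_of_toHo_eq i g₀ (f ≫ i' ≫ ι) (by
    rw [Functor.map_comp, hg₀, reassoc_of% h, Functor.map_comp, Functor.map_comp])
  have : WeakEquivalence f := weakEquivalence_of_isIso_toHo f
  have : WeakEquivalence g := by
    have : IsIso ((toHo 𝒞).map g) := by rw [hg', hg₀]; infer_instance
    exact weakEquivalence_of_isIso_toHo g
  have w₁ := weakEquivalence_cokernelMap_of_weakEquivalence i (i' ≫ ι) f g hg
  have w₂ := weakEquivalence_cokernelMap i' ι _ rfl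
  have h₁ := toHo_isIso (cokernel.map i (i' ≫ ι) f g hg)
  have h₂ := toHo_isIso (cokernel.map i' (i' ≫ ι) (𝟙 A') ι _)
  refine ⟨(toHo 𝒞).map (cokernel.map i (i' ≫ ι) f g hg) ≫
    inv ((toHo 𝒞).map (cokernel.map i' (i' ≫ ι) (𝟙 A') ι _)), inferInstance, ?_⟩
  rw [← Category.assoc, IsIso.comp_inv_eq, Category.assoc, ← Functor.map_comp, ← Functor.map_comp,
    cokernel.π_desc, cokernel.π_desc, Functor.map_comp, hg', hg₀, Functor.map_comp, Category.assoc]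

/-- A fibrant model `R` of the mapping cone of the cofibration `i`. -/
structure Rotation {A B : 𝒞} (i : A ⟶ B) where
  R : 𝒞
  l : B ⟶ R
  c : cone A ⟶ R
  comm : i ≫ l = coneι A ≫ c
  fibrant : IsFibrant R
  cofibration : Cofibration l
  weakEquivalence : WeakEquivalence (cokernel.map (coneι A) l i c comm.symm)

attribute [instance] Rotation.fibrant Rotation.cofibration Rotation.weakEquivalence

namespace Rotation

variable {A B : 𝒞} {i : A ⟶ B}

lemma nonempty (i : A ⟶ B) [Cofibration i] [IsCofibrant A] : Nonempty (Rotation i) := by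
  have : IsCofibrant B := isCofibrant_of_cofibration i
  let ι := FibrantObject.HoCat.iResolutionObj (pushout i (coneι A))
  have h : i ≫ pushout.inl i (coneι A) ≫ ι = coneι A ≫ pushout.inr i (coneι A) ≫ ι := by
    rw [pushout.condition_assoc]
  refine ⟨⟨_, pushout.inl _ _ ≫ ι, pushout.inr _ _ ≫ ι, h, inferInstance, inferInstance, ?_⟩⟩
  have := weakEquivalence_cokernelMap (pushout.inl i (coneι A)) ι _ rfl
  have e : cokernel.map (coneι A) (pushout.inl i (coneι A) ≫ ι) i
      (pushout.inr i (coneι A) ≫ ι) h.symm =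
      cokernel.map (coneι A) (pushout.inl i (coneι A)) i (pushout.inr i (coneι A))
        pushout.condition.symm ≫ cokernel.map (pushout.inl i (coneι A)) _ (𝟙 B) ι (by simp) := by
    apply cokernel_hom_ext
    simp
  rw [e]
  infer_instance

variable (r : Rotation i)

instance [IsCofibrant B] : IsCofibrant r.R := isCofibrant_of_cofibration r.l

/-- The mapping cone of `B ⟶ R`. -/
noncomputable abbrev P : 𝒞 := pushout r.l (coneι B)

noncomputable abbrev γ : r.R ⟶ r.P := pushout.inl _ _

/-- The comparison of the suspension of `A` with `P`. -/
noncomputable def inc : dblCone A ⟶ r.P :=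
  pushout.desc (r.c ≫ pushout.inl _ _) (coneMap i ≫ pushout.inr _ _) (by
    rw [← Category.assoc, ← r.comm, Category.assoc, coneι_coneMap_assoc, pushout.condition])

/-- The map `P ⟶ P / R ≅ ΣB`. -/
noncomputable abbrev q : r.P ⟶ suspObj B := pushout.desc 0 (cokernel.π _) (by simp)

/-- The map `P ⟶ P / CB ≅ R / B`. -/
noncomputable abbrev q' : r.P ⟶ cokernel r.l := pushout.desc (cokernel.π _) 0 (by simp)

/-- This is the rotation of the cofiber sequence: under `inc`, which identifies `ΣA` with `P`, the
map `P ⟶ ΣB` is `Σi`. The first cone of `dblCone A` maps into `R`, which `q` collapses, so no sign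
appears. -/
lemma inc_q : r.inc ≫ r.q = dblConeπ A ≫ suspMap i := by
  apply pushout.hom_ext
  · simp [inc, pushout.inl_desc, pushout.inl_desc_assoc]
  · simp [inc, pushout.inr_desc, pushout.inr_desc_assoc]

instance [IsCofibrant B] : WeakEquivalence r.q' :=
  weakEquivalence_pushoutDesc_π_zero _ _ (isZero_toHo_cone B)

/-- Collapsing the second cone of `dblCone A` and the cone `CB` in `P` turns `inc` into the
comparison `ΣA ⟶ R / B`, an equivalence by the choice of `R`. -/
instance [IsCofibrant A] [IsCofibrant B] : WeakEquivalence r.inc := by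
  have h := weakEquivalence_pushoutDesc_π_zero (coneι A) (coneι A) (isZero_toHo_cone A)
  have e : r.inc ≫ r.q' = (pushout.desc (cokernel.π _) 0 (by simp) : dblCone A ⟶ _) ≫
      cokernel.map (coneι A) r.l i r.c r.comm.symm := by
    apply pushout.hom_ext
    · simp [inc, pushout.inl_desc, pushout.inl_desc_assoc]
    · simp [inc, pushout.inr_desc, pushout.inr_desc_assoc]
  exact weakEquivalence_of_postcomp_of_fac e

/-- The comparison of the mapping cone with its fibrant model. -/
noncomputable def ofCone : pushout i (coneι A) ⟶ r.R := pushout.desc r.l r.c r.comm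

lemma weakEquivalence_ofCone [StableModelCategory 𝒞] [IsCofibrant B] : WeakEquivalence r.ofCone := by
  refine weakEquivalence_of_cokernelMap (pushout.inl i (coneι A)) r.l (𝟙 B) r.ofCone
    (by simp [ofCone, pushout.inl_desc]) ?_
  refine weakEquivalence_of_precomp_of_fac (f := cokernel.map (coneι A) (pushout.inl i (coneι A)) i
    (pushout.inr i (coneι A)) pushout.condition.symm)
    (fg := cokernel.map (coneι A) r.l i r.c r.comm.symm) ?_
  apply cokernel_hom_ext
  simp [ofCone, pushout.inr_desc_assoc]

/-- The identification of `P / R` with `ΣB`. -/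
noncomputable def cokernelIso : cokernel r.γ ≅ suspObj B :=
  (asIso (cokernel.map (coneι B) r.γ r.l (pushout.inr _ _) pushout.condition.symm)).symm

lemma π_cokernelIso : cokernel.π r.γ ≫ r.cokernelIso.hom = r.q := by
  dsimp [cokernelIso]
  rw [IsIso.comp_inv_eq]
  apply pushout.hom_ext
  · simp [pushout.inl_desc_assoc]
  · simp [pushout.inr_desc_assoc]

end Rotation

section

variable [StableModelCategory 𝒞]

/-- Exactness of cofiber sequences, for maps into them. -/
lemma exists_lift_of_toHo_comp_cokernelπ_eq_zero {A B S : 𝒞} [IsCofibrant A] [IsFibrant A]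
    [IsCofibrant S] (i : A ⟶ B) [Cofibration i] (u : S ⟶ B)
    (hu : (toHo 𝒞).map (u ≫ cokernel.π i) = 0) :
    ∃ v : S ⟶ A, (toHo 𝒞).map (v ≫ i) = (toHo 𝒞).map u := by
  have : IsCofibrant B := isCofibrant_of_cofibration i
  obtain ⟨r⟩ := Rotation.nonempty i
  have hul : (toHo 𝒞).map (u ≫ r.l) = 0 := by
    have w := weakEquivalence_pushoutDesc_π_zero (coneι A) i (isZero_toHo_cone A)
    have h : (toHo 𝒞).map (u ≫ pushout.inl i (coneι A)) = (toHo 𝒞).map 0 := by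
      have := toHo_isIso (pushout.desc (cokernel.π i) 0 _ :
        pushout i (coneι A) ⟶ cokernel i)
      rw [← cancel_mono ((toHo 𝒞).map (pushout.desc (cokernel.π i) 0 (by simp) :
        pushout i (coneι A) ⟶ cokernel i)), ← Functor.map_comp, Category.assoc,
        pushout.inl_desc, hu]
      simp
    have e : u ≫ r.l = (u ≫ pushout.inl i (coneι A)) ≫ r.ofCone := by
      simp [Rotation.ofCone, pushout.inl_desc]
    rw [e, Functor.map_comp, h]
    simp
  obtain ⟨e, he⟩ := exists_extension_of_toHo_eq_zero (coneι S) (u ≫ r.l) hul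
  -- The nullhomotopy `e` of `u ≫ l` and the cone on `u` glue to a map `ΣS ⟶ P ≃ ΣA`; its
  -- desuspension is the lift.
  let k : dblCone S ⟶ r.P := pushout.desc (e ≫ pushout.inl _ _) (coneMap u ≫ pushout.inr _ _) (by
    rw [reassoc_of% he, coneι_coneMap_assoc, pushout.condition])
  have hk : k ≫ r.q = dblConeπ S ≫ suspMap u := by
    apply pushout.hom_ext
    · simp [k, pushout.inl_desc, pushout.inl_desc_assoc]
    · simp [k, pushout.inr_desc, pushout.inr_desc_assoc]
  have := toHo_isIso r.inc
  have := toHo_isIso (dblConeπ A)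
  have := toHo_isIso (dblConeπ S)
  obtain ⟨v, hv⟩ := exists_toHo_suspMap_eq (inv ((toHo 𝒞).map (dblConeπ S)) ≫ (toHo 𝒞).map k ≫
    inv ((toHo 𝒞).map r.inc) ≫ (toHo 𝒞).map (dblConeπ A))
  refine ⟨v, toHo_eq_of_suspMap_eq ?_⟩
  rw [toHo_suspMap_comp, hv, Category.assoc, Category.assoc, Category.assoc, IsIso.inv_comp_eq,
    ← Functor.map_comp, ← r.inc_q, Functor.map_comp _ r.inc, IsIso.inv_hom_id_assoc,
    ← Functor.map_comp, ← Functor.map_comp, hk]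

/-- Every cofibration is the inclusion into a mapping cone. -/
lemma exists_mappingCone_weakEquivalence {A B : 𝒞} [IsCofibrant A] [IsFibrant A] [IsFibrant B]
    (i : A ⟶ B) [Cofibration i] :
    ∃ (X : 𝒞) (_ : IsCofibrant X) (d : X ⟶ A) (n : cone X ⟶ B) (h : d ≫ i = coneι X ≫ n),
      WeakEquivalence (pushout.desc i n h) := by
  have : IsCofibrant B := isCofibrant_of_cofibration i
  obtain ⟨r⟩ := Rotation.nonempty i
  -- The cofiber `R` of `i` desuspends to `X`, and the connecting map `R ⟶ P ≃ ΣA` desuspends to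
  -- `d`. It remains to compare `B` with the mapping cone of `d`.
  obtain ⟨X, hX, hX', ⟨θ⟩⟩ := exists_desuspension ((toHo 𝒞).obj r.R)
  have := toHo_isIso r.inc
  have := toHo_isIso (dblConeπ A)
  have := toHo_isIso (dblConeπ X)
  obtain ⟨d, hd⟩ := exists_toHo_suspMap_eq (θ.hom ≫ (toHo 𝒞).map r.γ ≫
    inv ((toHo 𝒞).map r.inc) ≫ (toHo 𝒞).map (dblConeπ A))
  let j : A ⟶ pushout d (coneι X) := pushout.inl _ _
  obtain ⟨r'⟩ := Rotation.nonempty j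
  have : IsCofibrant (pushout d (coneι X)) := isCofibrant_of_cofibration j
  -- The mapping cone of `j` is `ΣX`. The first cone goes to `CA`, so that collapsing `CA`
  -- corresponds to `dblConeπ`.
  let w' : dblCone X ⟶ pushout j (coneι A) :=
    pushout.desc (coneMap d ≫ pushout.inr _ _) (pushout.inr _ _ ≫ pushout.inl _ _) (by
      rw [coneι_coneMap_assoc, ← pushout.condition, ← pushout.condition_assoc])
  have hw' : WeakEquivalence w' := by
    have h₁ := weakEquivalence_pushoutDesc_π_zero (coneι A) j (isZero_toHo_cone A)
    refine weakEquivalence_of_postcomp_of_fac (f := w')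
      (g := (pushout.desc (cokernel.π j) 0 _ : pushout j (coneι A) ⟶ cokernel j))
      (fg := dblConeπ X ≫ cokernel.map (coneι X) j d (pushout.inr _ _)
        pushout.condition.symm) ?_
    apply pushout.hom_ext
    · simp [w', pushout.inl_desc_assoc, pushout.inr_desc]
    · simp [w', pushout.inl_desc, pushout.inr_desc_assoc]
  have hr' := r'.weakEquivalence_ofCone
  let w := w' ≫ r'.ofCone
  -- In the cofiber sequence of `d`, the connecting map out of `ΣX` is `Σd`.
  have hwγ : (toHo 𝒞).map (w ≫ r'.γ) = (toHo 𝒞).map (dblConeMap d ≫ r'.inc) := by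
    apply toHo_eq_of_retraction _ _ r'.q'
    apply pushout.hom_ext
    · simp [w, w', Rotation.inc, Rotation.ofCone, pushout.inl_desc, pushout.inl_desc_assoc,
        pushout.inr_desc_assoc]
    · simp [w, w', Rotation.inc, Rotation.ofCone, pushout.inl_desc, pushout.inl_desc_assoc,
        pushout.inr_desc, pushout.inr_desc_assoc]
  have := toHo_isIso w
  have := toHo_isIso r'.inc
  -- The rotated sequences of `j` and of `i` have matching first two terms, hence isomorphic third
  -- terms: the suspension of the mapping cone of `d`, and `ΣB`. This isomorphism desuspends to
  -- `m₀`.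
  obtain ⟨β, hβ, hβ'⟩ := exists_cokernel_iso r'.γ r.γ
    (inv ((toHo 𝒞).map w) ≫ (toHo 𝒞).map (dblConeπ X) ≫ θ.hom)
    (inv ((toHo 𝒞).map r'.inc) ≫ (toHo 𝒞).map r.inc) (by
      have h₁ : (toHo 𝒞).map (dblConeπ X) ≫ θ.hom ≫ (toHo 𝒞).map r.γ =
          (toHo 𝒞).map (dblConeMap d) ≫ (toHo 𝒞).map r.inc := by
        have := (toHo 𝒞).congr_map (dblConeMap_dblConeπ d)
        rw [Functor.map_comp, Functor.map_comp, hd] at this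
        simp only [← Category.assoc, cancel_mono] at this
        rw [IsIso.eq_comp_inv] at this
        simpa using this.symm
      rw [Category.assoc, Category.assoc, h₁, IsIso.eq_inv_comp, ← Functor.map_comp_assoc, hwγ]
      simp)
  obtain ⟨m₀, hm₀⟩ := exists_toHo_suspMap_eq ((toHo 𝒞).map r'.cokernelIso.inv ≫ β ≫
    (toHo 𝒞).map r.cokernelIso.hom)
  have hq : (toHo 𝒞).map r'.q ≫ (toHo 𝒞).map (suspMap m₀) =
      inv ((toHo 𝒞).map r'.inc) ≫ (toHo 𝒞).map r.inc ≫ (toHo 𝒞).map r.q := by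
    rw [hm₀, ← r'.π_cokernelIso, ← r.π_cokernelIso, Functor.map_comp, Functor.map_comp]
    have e : (toHo 𝒞).map r'.cokernelIso.hom ≫ (toHo 𝒞).map r'.cokernelIso.inv = 𝟙 _ := by
      rw [← Functor.map_comp, Iso.hom_inv_id, CategoryTheory.Functor.map_id]
    rw [Category.assoc, reassoc_of% e, reassoc_of% hβ']
  have hjm : (toHo 𝒞).map (j ≫ m₀) = (toHo 𝒞).map i := by
    apply toHo_eq_of_suspMap_eq
    rw [toHo_suspMap_comp, ← cancel_epi ((toHo 𝒞).map (dblConeπ A)), ← Functor.map_comp_assoc,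
      ← r'.inc_q, Functor.map_comp, Category.assoc, hq, IsIso.hom_inv_id_assoc,
      ← Functor.map_comp, r.inc_q, Functor.map_comp]
  -- `m₀` restricts to `i` only up to homotopy; homotopy extension replaces it by `m`, which
  -- restricts to `i` exactly.
  obtain ⟨m, hm, hm'⟩ := exists_extension_of_toHo_eq j m₀ i hjm
  have : WeakEquivalence (suspMap m₀) := by
    rw [← toHo_isIso_iff, hm₀]
    infer_instance
  have : WeakEquivalence m₀ := weakEquivalence_of_suspMap m₀
  have : WeakEquivalence m := by
    rw [← toHo_isIso_iff, hm']
    exact toHo_isIso m₀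
  refine ⟨X, hX, d, pushout.inr _ _ ≫ m, ?_, ?_⟩
  · rw [← pushout.condition_assoc]
    exact congrArg (d ≫ ·) hm.symm
  · have e : pushout.desc i (pushout.inr _ _ ≫ m) (by
        rw [← pushout.condition_assoc]
        exact congrArg (d ≫ ·) hm.symm) = m := by
      apply pushout.hom_ext
      · rw [pushout.inl_desc, ← hm]
      · rw [pushout.inr_desc]
    rw [e]
    infer_instance

end

end Rotation

end StableTot

namespace StableTot

/-! ### Cylinders on cones, relative to the cylinder on the base -/

section CylinderOfCone

variable {𝒞 : Type u} [Category.{v} 𝒞] [HasZeroMorphisms 𝒞] [HasZeroObject 𝒞] [ModelCategory 𝒞]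

lemma π_cokernelMap {A B A' B' : 𝒞} (i : A ⟶ B) (i' : A' ⟶ B') (a : A ⟶ A') (b : B ⟶ B')
    (h : i ≫ b = a ≫ i') :
    cokernel.π i ≫ cokernel.map i i' a b h = b ≫ cokernel.π i' :=
  cokernel.π_desc _ _ _

lemma π_cokernelMap_assoc {A B A' B' Z : 𝒞} (i : A ⟶ B) (i' : A' ⟶ B') (a : A ⟶ A') (b : B ⟶ B')
    (h : i ≫ b = a ≫ i') (g : cokernel i' ⟶ Z) :
    cokernel.π i ≫ cokernel.map i i' a b h ≫ g = b ≫ cokernel.π i' ≫ g := by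
  rw [← Category.assoc, π_cokernelMap, Category.assoc]

lemma weakEquivalence_coprodMap {U V U' V' : 𝒞} (f : U ⟶ U') (g : V ⟶ V') [Cofibration f]
    [WeakEquivalence f] [Cofibration g] [WeakEquivalence g] :
    WeakEquivalence (coprod.map f g) := by
  rw [weakEquivalence_iff]
  refine (MorphismProperty.colimMap (W := trivialCofibrations 𝒞) _ ?_).2
  rintro (_ | _)
  · exact mem_trivialCofibrations f
  · exact mem_trivialCofibrations g

/-- The homotopy class of a map out of a coproduct of cofibrant objects depends only on the
homotopy classes of its components. -/
lemma toHo_coprodDesc_congr {U V Y : 𝒞} [IsCofibrant U] [IsCofibrant V] {f f' : U ⟶ Y}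
    {g g' : V ⟶ Y} (hf : (toHo 𝒞).map f = (toHo 𝒞).map f')
    (hg : (toHo 𝒞).map g = (toHo 𝒞).map g') :
    (toHo 𝒞).map (coprod.desc f g) = (toHo 𝒞).map (coprod.desc f' g') := by
  wlog hY : IsFibrant Y generalizing Y with H
  · let ι := FibrantObject.HoCat.iResolutionObj Y
    have := toHo_isIso ι
    have h := @H _ (f ≫ ι) (f' ≫ ι) (g ≫ ι) (g' ≫ ι) (by simp [hf]) (by simp [hg]) inferInstance
    rw [← coprod.desc_comp, ← coprod.desc_comp, Functor.map_comp, Functor.map_comp,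
      cancel_mono] at h
    exact h
  obtain ⟨I, _⟩ := Cylinder.exists_very_good U
  obtain ⟨J, _⟩ := Cylinder.exists_very_good V
  obtain ⟨h⟩ := exists_leftHomotopy I _ _ hf
  obtain ⟨k⟩ := exists_leftHomotopy J _ _ hg
  have e₀ : coprod.map I.i₀ J.i₀ ≫ coprod.map I.π J.π = 𝟙 _ := by simp [coprod.map_map]
  have e₁ : coprod.map I.i₁ J.i₁ ≫ coprod.map I.π J.π = 𝟙 _ := by simp [coprod.map_map]
  have := weakEquivalence_coprodMap I.i₀ J.i₀
  have : WeakEquivalence (coprod.map I.π J.π) :=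
    weakEquivalence_of_precomp_of_fac e₀
  have := toHo_eq_of_retraction (coprod.map I.i₀ J.i₀) (coprod.map I.i₁ J.i₁)
    (coprod.map I.π J.π) (e₀.trans e₁.symm)
  have e₂ : coprod.desc f g = coprod.map I.i₀ J.i₀ ≫ coprod.desc h.h k.h := by simp [coprod.map_desc]
  have e₃ : coprod.desc f' g' = coprod.map I.i₁ J.i₁ ≫ coprod.desc h.h k.h := by
    simp [coprod.map_desc]
  rw [e₂, e₃, Functor.map_comp, this, Functor.map_comp]

section

variable {X : 𝒞} (I : Cylinder X)

/-- A cylinder on `X` with a cone on each end. -/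
noncomputable abbrev cappedCyl : 𝒞 := pushout I.i (coprod.map (coneι X) (coneι X))

/-- A contractible object containing a cylinder on `X` and a cone on each end. -/
noncomputable abbrev coneCyl : 𝒞 := cone (cappedCyl I)

noncomputable def coneCylMid : I.I ⟶ coneCyl I := pushout.inl _ _ ≫ coneι _

noncomputable def coneCyl₀ : cone X ⟶ coneCyl I := coprod.inl ≫ pushout.inr _ _ ≫ coneι _

noncomputable def coneCyl₁ : cone X ⟶ coneCyl I := coprod.inr ≫ pushout.inr _ _ ≫ coneι _

lemma coneι_coneCyl₀ : coneι X ≫ coneCyl₀ I = I.i₀ ≫ coneCylMid I := by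
  rw [coneCyl₀, coneCylMid, ← I.inl_i, Category.assoc, pushout.condition_assoc,
    coprod.inl_map_assoc]

lemma coneι_coneCyl₀_assoc {Y : 𝒞} (g : coneCyl I ⟶ Y) :
    coneι X ≫ coneCyl₀ I ≫ g = I.i₀ ≫ coneCylMid I ≫ g := by
  rw [← Category.assoc, coneι_coneCyl₀, Category.assoc]

lemma coneι_coneCyl₁ : coneι X ≫ coneCyl₁ I = I.i₁ ≫ coneCylMid I := by
  rw [coneCyl₁, coneCylMid, ← I.inr_i, Category.assoc, pushout.condition_assoc,
    coprod.inr_map_assoc]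

lemma coneι_coneCyl₁_assoc {Y : 𝒞} (g : coneCyl I ⟶ Y) :
    coneι X ≫ coneCyl₁ I ≫ g = I.i₁ ≫ coneCylMid I ≫ g := by
  rw [← Category.assoc, coneι_coneCyl₁, Category.assoc]

/-- A map out of a cylinder with two capped ends. -/
noncomputable abbrev cappedCylDesc {Y : 𝒞} (h : I.I ⟶ Y) (a b : cone X ⟶ Y)
    (h₀ : I.i₀ ≫ h = coneι X ≫ a) (h₁ : I.i₁ ≫ h = coneι X ≫ b) : cappedCyl I ⟶ Y :=
  pushout.desc h (coprod.desc a b) (by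
    apply coprod.hom_ext
    · rw [I.inl_i_assoc, coprod.map_desc, coprod.inl_desc, h₀]
    · rw [I.inr_i_assoc, coprod.map_desc, coprod.inr_desc, h₁])

lemma coneCyl_desc {Y : 𝒞} {h : I.I ⟶ Y} {a b : cone X ⟶ Y}
    {h₀ : I.i₀ ≫ h = coneι X ≫ a} {h₁ : I.i₁ ≫ h = coneι X ≫ b} (K : coneCyl I ⟶ Y)
    (hK : coneι _ ≫ K = cappedCylDesc I h a b h₀ h₁) :
    coneCylMid I ≫ K = h ∧ coneCyl₀ I ≫ K = a ∧ coneCyl₁ I ≫ K = b := by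
  refine ⟨?_, ?_, ?_⟩
  · rw [coneCylMid, Category.assoc, hK, pushout.inl_desc]
  · rw [coneCyl₀, Category.assoc, Category.assoc, hK, pushout.inr_desc, coprod.inl_desc]
  · rw [coneCyl₁, Category.assoc, Category.assoc, hK, pushout.inr_desc, coprod.inr_desc]

/-- The retraction onto the cone. -/
lemma exists_coneCyl_retraction : ∃ r : coneCyl I ⟶ cone X, coneCylMid I ≫ r = I.π ≫ coneι X ∧
    coneCyl₀ I ≫ r = 𝟙 _ ∧ coneCyl₁ I ≫ r = 𝟙 _ := by
  obtain ⟨r, hr⟩ := exists_extension (coneι (cappedCyl I)) (cone_trivialFibration X)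
    (cappedCylDesc I (I.π ≫ coneι X) (𝟙 _) (𝟙 _) (by simp) (by simp))
  exact ⟨r, coneCyl_desc I r hr⟩

variable [IsCofibrant X] [I.IsGood]

instance : IsCofibrant (cappedCyl I) := isCofibrant_of_cofibration (pushout.inl _ _)

instance cofibration_coneCylMid : Cofibration (coneCylMid I) := by
  unfold coneCylMid
  infer_instance

instance isCofibrant_coprod (U V : 𝒞) [IsCofibrant U] [IsCofibrant V] : IsCofibrant (U ⨿ V) :=
  isCofibrant_of_cofibration (coprod.inl : U ⟶ U ⨿ V)

instance cofibration_coneCyl₁ : Cofibration (coneCyl₁ I) := by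
  unfold coneCyl₁
  infer_instance

instance weakEquivalence_coneCyl₀ : WeakEquivalence (coneCyl₀ I) :=
  weakEquivalence_of_isZero _ (isZero_toHo_cone _) (isZero_toHo_cone _)

instance weakEquivalence_coneCyl₁ : WeakEquivalence (coneCyl₁ I) :=
  weakEquivalence_of_isZero _ (isZero_toHo_cone _) (isZero_toHo_cone _)

/-- The inclusion of the cones on the two ends. -/
noncomputable def coneCylEnds : cone X ⨿ cone X ⟶ coneCyl I := pushout.inr _ _ ≫ coneι _

instance cofibration_coneCylEnds : Cofibration (coneCylEnds I) := by
  unfold coneCylEnds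
  infer_instance

lemma inl_coneCylEnds : coprod.inl ≫ coneCylEnds I = coneCyl₀ I := rfl

lemma inl_coneCylEnds_assoc {Y : 𝒞} (g : coneCyl I ⟶ Y) :
    coprod.inl ≫ coneCylEnds I ≫ g = coneCyl₀ I ≫ g := by
  rw [← Category.assoc, inl_coneCylEnds]

lemma inr_coneCylEnds : coprod.inr ≫ coneCylEnds I = coneCyl₁ I := rfl

lemma inr_coneCylEnds_assoc {Y : 𝒞} (g : coneCyl I ⟶ Y) :
    coprod.inr ≫ coneCylEnds I ≫ g = coneCyl₁ I ≫ g := by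
  rw [← Category.assoc, inr_coneCylEnds]

/-- A coproduct of two cones is contractible. Together with `cofibration_coneCylEnds` this allows
maps out of `coneCyl` to be lifted through fibrations with both ends prescribed. -/
lemma weakEquivalence_coneCylEnds : WeakEquivalence (coneCylEnds I) := by
  have : WeakEquivalence (0 : (0 : 𝒞) ⟶ cone X) :=
    weakEquivalence_of_isZero _ isZero_toHo_zero (isZero_toHo_cone X)
  have : WeakEquivalence (coprod.map (0 : (0 : 𝒞) ⟶ cone X) (0 : (0 : 𝒞) ⟶ cone X)) :=
    weakEquivalence_coprodMap _ _
  refine weakEquivalence_of_isZero _ ?_ (isZero_toHo_cone _)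
  refine isZero_toHo_of_weakEquivalence
    (coprod.map (0 : (0 : 𝒞) ⟶ cone X) (0 : (0 : 𝒞) ⟶ cone X)) ?_
  refine isZero_toHo_zero.of_iso ((toHo 𝒞).mapIso (IsZero.iso ?_ (isZero_zero 𝒞)))
  rw [IsZero.iff_id_eq_zero]
  apply coprod.hom_ext <;> exact (isZero_zero 𝒞).eq_of_src _ _

/-- The cylinder and the cone on one of its ends. -/
noncomputable abbrev coneCylHalf : pushout I.i₁ (coneι X) ⟶ coneCyl I :=
  pushout.desc (coneCylMid I) (coneCyl₁ I) (coneι_coneCyl₁ I).symm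

/-- The caps are attached one at a time: the cylinder with a cone at `i₁` receives the cone at `i₀`.
This is what makes `coneCylHalf` a cofibration. -/
lemma isPushout_cappedCyl : IsPushout (coneι X) (I.i₀ ≫ pushout.inl I.i₁ (coneι X))
    (coprod.inl ≫ pushout.inr I.i (coprod.map (coneι X) (coneι X)))
    (pushout.desc (pushout.inl I.i (coprod.map (coneι X) (coneι X))) (coprod.inr ≫ pushout.inr _ _)
      (by rw [← I.inr_i, Category.assoc, pushout.condition, coprod.inr_map_assoc])) := by
  refine ⟨⟨?_⟩, ⟨PushoutCocone.IsColimit.mk _ (fun s => cappedCylDesc I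
    (pushout.inl I.i₁ (coneι X) ≫ s.inr) s.inl (pushout.inr I.i₁ (coneι X) ≫ s.inr)
    ?_ ?_) (fun s => ?_) (fun s => ?_) (fun s m h₁ h₂ => ?_)⟩⟩
  · rw [Category.assoc, pushout.inl_desc, ← I.inl_i, Category.assoc, pushout.condition,
      coprod.inl_map_assoc]
  · simpa using s.condition.symm
  · rw [pushout.condition_assoc]
  · rw [Category.assoc, pushout.inr_desc, coprod.inl_desc]
  · apply pushout.hom_ext
    · rw [pushout.inl_desc_assoc, pushout.inl_desc]
    · rw [pushout.inr_desc_assoc, Category.assoc, pushout.inr_desc, coprod.inr_desc]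
  · apply pushout.hom_ext
    · rw [pushout.inl_desc, ← h₂, pushout.inl_desc_assoc]
    · apply coprod.hom_ext
      · rw [pushout.inr_desc, coprod.inl_desc, ← h₁, Category.assoc]
      · rw [pushout.inr_desc, coprod.inr_desc, ← h₂, pushout.inr_desc_assoc, Category.assoc]

instance cofibration_coneCylHalf : Cofibration (coneCylHalf I) := by
  have h : Cofibration (pushout.desc (pushout.inl I.i (coprod.map (coneι X) (coneι X)))
      (coprod.inr ≫ pushout.inr _ _)
      (by rw [← I.inr_i, Category.assoc, pushout.condition, coprod.inr_map_assoc]) :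
      pushout I.i₁ (coneι X) ⟶ cappedCyl I) := by
    rw [cofibration_iff]
    exact MorphismProperty.of_isPushout (isPushout_cappedCyl I).flip (mem_cofibrations (coneι X))
  have e : coneCylHalf I = pushout.desc (pushout.inl I.i (coprod.map (coneι X) (coneι X)))
      (coprod.inr ≫ pushout.inr _ _)
      (by rw [← I.inr_i, Category.assoc, pushout.condition, coprod.inr_map_assoc]) ≫
      coneι (cappedCyl I) := by
    apply pushout.hom_ext
    · rw [pushout.inl_desc, pushout.inl_desc_assoc, coneCylMid]
    · rw [pushout.inr_desc, pushout.inr_desc_assoc, Category.assoc, coneCyl₁]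
  rw [e]
  infer_instance

/-- The cone at `i₁` includes into the half-capped cylinder by a cobase change of a trivial
cofibration. Maps given on the cylinder and on one cone therefore extend over `coneCyl` into a
fibrant object, which transports nullhomotopies along homotopies. -/
instance weakEquivalence_coneCylHalf : WeakEquivalence (coneCylHalf I) :=
  weakEquivalence_of_precomp_of_fac (f := pushout.inr I.i₁ (coneι X)) (fg := coneCyl₁ I)
    (pushout.inr_desc _ _ _)

/-- The two ends of the cylinder of a cone are homotopic relative to the cylinder on the base. -/
lemma toHo_cokernelMap_coneCyl : (toHo 𝒞).map (cokernel.map (coneι X) (coneCylMid I) I.i₀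
      (coneCyl₀ I) (coneι_coneCyl₀ I)) =
    (toHo 𝒞).map (cokernel.map (coneι X) (coneCylMid I) I.i₁ (coneCyl₁ I) (coneι_coneCyl₁ I)) := by
  obtain ⟨r, hr, hr₀, hr₁⟩ := exists_coneCyl_retraction I
  have w := weakEquivalence_cokernelMap_of_weakEquivalence (coneι X) (coneCylMid I) I.i₀
      (coneCyl₀ I) (coneι_coneCyl₀ I)
  have e₀ : cokernel.map (coneι X) (coneCylMid I) I.i₀ (coneCyl₀ I) (coneι_coneCyl₀ I) ≫
      cokernel.map (coneCylMid I) (coneι X) I.π r hr = 𝟙 _ := by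
    apply cokernel_hom_ext
    simpa using hr₀ =≫ cokernel.π _
  have e₁ : cokernel.map (coneι X) (coneCylMid I) I.i₁ (coneCyl₁ I) (coneι_coneCyl₁ I) ≫
      cokernel.map (coneCylMid I) (coneι X) I.π r hr = 𝟙 _ := by
    apply cokernel_hom_ext
    simpa using hr₁ =≫ cokernel.π _
  have := weakEquivalence_of_precomp_of_fac e₀
  exact toHo_eq_of_retraction _ _ _ (e₀.trans e₁.symm)

/-- Homotopic maps out of the suspension are joined by a map out of the cylinder of the cone. -/
lemma exists_coneCyl_map {Y : 𝒞} [IsFibrant Y] (f g : suspObj X ⟶ Y)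
    (h : (toHo 𝒞).map f = (toHo 𝒞).map g) : ∃ K : coneCyl I ⟶ Y, coneCylMid I ≫ K = 0 ∧
      coneCyl₀ I ≫ K = cokernel.π _ ≫ f ∧ coneCyl₁ I ≫ K = cokernel.π _ ≫ g := by
  -- A map that vanishes on the cylinder factors through `ΣX ⨿ ΣX`. There `g` may be replaced by
  -- `f`, and with both caps equal to `f` the map factors through the contractible `cone X`.
  have key : (toHo 𝒞).map (cappedCylDesc I 0 (cokernel.π (coneι X) ≫ f)
      (cokernel.π (coneι X) ≫ g) (by simp) (by simp)) = 0 := by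
    let s : cappedCyl I ⟶ suspObj X ⨿ suspObj X :=
      cappedCylDesc I 0 (cokernel.π _ ≫ coprod.inl) (cokernel.π _ ≫ coprod.inr) (by simp) (by simp)
    have e : ∀ g' : suspObj X ⟶ Y, cappedCylDesc I 0 (cokernel.π (coneι X) ≫ f)
        (cokernel.π (coneι X) ≫ g') (by simp) (by simp) = s ≫ coprod.desc f g' := by
      intro g'
      apply pushout.hom_ext
      · rw [pushout.inl_desc, pushout.inl_desc_assoc, zero_comp]
      · apply coprod.hom_ext
        · rw [pushout.inr_desc, pushout.inr_desc_assoc, coprod.inl_desc, coprod.inl_desc_assoc,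
            Category.assoc, coprod.inl_desc]
        · rw [pushout.inr_desc, pushout.inr_desc_assoc, coprod.inr_desc, coprod.inr_desc_assoc,
            Category.assoc, coprod.inr_desc]
    rw [e, Functor.map_comp, toHo_coprodDesc_congr (f' := f) (g' := f) rfl h.symm,
      ← Functor.map_comp, ← e]
    have e' : cappedCylDesc I 0 (cokernel.π (coneι X) ≫ f) (cokernel.π (coneι X) ≫ f)
        (by simp) (by simp) = cappedCylDesc I (I.π ≫ coneι X) (𝟙 _) (𝟙 _) (by simp) (by simp) ≫
          cokernel.π _ ≫ f := by
      apply pushout.hom_ext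
      · rw [pushout.inl_desc, pushout.inl_desc_assoc, Category.assoc, cokernel.condition_assoc,
          zero_comp, comp_zero]
      · apply coprod.hom_ext
        · rw [pushout.inr_desc, pushout.inr_desc_assoc, coprod.inl_desc, coprod.inl_desc_assoc,
            Category.id_comp]
        · rw [pushout.inr_desc, pushout.inr_desc_assoc, coprod.inr_desc, coprod.inr_desc_assoc,
            Category.id_comp]
    rw [e']
    exact toHo_map_eq_zero_of_factor (isZero_toHo_cone X) _ _
  obtain ⟨K, hK⟩ := exists_extension_of_toHo_eq_zero (coneι _) _ key
  exact ⟨K, coneCyl_desc I K hK⟩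

end

end CylinderOfCone

end StableTot

namespace StableTot

/-! ### The mapping cone of a homotopy fiber -/

section HomotopyFiber

variable {𝒞 : Type u} [Category.{v} 𝒞] [HasZeroMorphisms 𝒞] [HasZeroObject 𝒞] [ModelCategory 𝒞]

@[simp]
lemma toHo_suspMap_zero (X Y : 𝒞) : (toHo 𝒞).map (suspMap (0 : X ⟶ Y)) = 0 := by
  rw [toHo_suspMap_eq _ 0 (by simp), ← toHo_map_zero]
  congr 1
  apply cokernel_hom_ext
  simp

/-- Two maps from a cone that agree on the base and factor through the same contractible fibrant
object induce the same map on cokernels in the homotopy category. -/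
lemma toHo_cokernelMap_eq_of_factor {X Q A B : 𝒞} [IsCofibrant X] [IsFibrant Q]
    (hQ : IsZero ((toHo 𝒞).obj Q)) (i : A ⟶ B) (d : X ⟶ A) (s t : cone X ⟶ Q) (p : Q ⟶ B)
    (hst : coneι X ≫ s = coneι X ≫ t) (hs : coneι X ≫ s ≫ p = d ≫ i)
    (ht : coneι X ≫ t ≫ p = d ≫ i) :
    (toHo 𝒞).map (cokernel.map (coneι X) i d (s ≫ p) hs) =
      (toHo 𝒞).map (cokernel.map (coneι X) i d (t ≫ p) ht) := by
  have h := toHo_cokernelMap_eq (coneι X) (coneι X ≫ s) (trivialFibration_of_isZero_toHo hQ) (𝟙 X)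
    s t (by simp) (by simp [hst])
  have e : ∀ u : cone X ⟶ Q, ∀ (hu : coneι X ≫ u = coneι X ≫ s) (hu' : coneι X ≫ u ≫ p = d ≫ i),
      cokernel.map (coneι X) i d (u ≫ p) hu' =
      cokernel.map (coneι X) (coneι X ≫ s) (𝟙 X) u (by simp [hu]) ≫
        cokernel.map (coneι X ≫ s) i d p (by simp [hs]) := by
    intro u hu hu'
    apply cokernel_hom_ext
    simp
  rw [e s rfl, e t hst.symm, Functor.map_comp, Functor.map_comp, h]

/-- A map out of a suspension is determined by its difference with another one. -/
lemma toHo_eq_of_dblConeDesc_eq_zero {T X : 𝒞} [IsCofibrant T] [IsFibrant X]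
    (f g : suspObj T ⟶ X)
    (h : (toHo 𝒞).map (pushout.desc (cokernel.π _ ≫ f) (cokernel.π _ ≫ g) (by simp) :
      dblCone T ⟶ X) = 0) : (toHo 𝒞).map f = (toHo 𝒞).map g := by
  obtain ⟨K, hK⟩ := exists_extension_of_toHo_eq_zero (coneι (dblCone T)) _ h
  have h₁ : (pushout.inl _ _ ≫ coneι (dblCone T)) ≫ K = cokernel.π _ ≫ f := by
    rw [Category.assoc, hK, pushout.inl_desc]
  have h₂ : (pushout.inr _ _ ≫ coneι (dblCone T)) ≫ K = cokernel.π _ ≫ g := by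
    rw [Category.assoc, hK, pushout.inr_desc]
  -- The two inclusions of `CT` into the cone on `dblCone T` extend the same map on `T` to a
  -- contractible object, so they agree in `Ho` modulo the base; `K` carries this to `f` and `g`.
  have e := toHo_cokernelMap_eq (coneι T) (coneι T ≫ pushout.inl _ _ ≫ coneι (dblCone T))
    (cone_trivialFibration _) (𝟙 T) (pushout.inl _ _ ≫ coneι (dblCone T))
    (pushout.inr _ _ ≫ coneι (dblCone T)) (by simp) (by simp [pushout.condition_assoc])
  have hj : (coneι T ≫ pushout.inl _ _ ≫ coneι (dblCone T)) ≫ K = 0 := by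
    rw [Category.assoc, h₁, cokernel.condition_assoc, zero_comp]
  have e₁ : f = cokernel.map (coneι T) (coneι T ≫ pushout.inl _ _ ≫ coneι (dblCone T)) (𝟙 T)
      (pushout.inl _ _ ≫ coneι (dblCone T)) (by simp) ≫ cokernel.desc _ K hj := by
    apply cokernel_hom_ext
    rw [← h₁]
    simp
  have e₂ : g = cokernel.map (coneι T) (coneι T ≫ pushout.inl _ _ ≫ coneι (dblCone T)) (𝟙 T)
      (pushout.inr _ _ ≫ coneι (dblCone T)) (by simp [pushout.condition_assoc]) ≫
        cokernel.desc _ K hj := by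
    apply cokernel_hom_ext
    rw [← h₂]
    simp
  rw [e₁, e₂, Functor.map_comp, Functor.map_comp, e]

lemma exists_lift_of_isZero {X P B : 𝒞} [IsCofibrant X] (hX : IsZero ((toHo 𝒞).obj X)) (p : P ⟶ B)
    [Fibration p] (f : X ⟶ B) : ∃ g : X ⟶ P, g ≫ p = f := by
  have : WeakEquivalence (0 : (0 : 𝒞) ⟶ X) := weakEquivalence_of_isZero _ isZero_toHo_zero hX
  have sq : CommSq (0 : (0 : 𝒞) ⟶ P) (0 : (0 : 𝒞) ⟶ X) p f := ⟨by simp⟩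
  exact ⟨sq.lift, sq.fac_right⟩

variable [StableModelCategory 𝒞]

/-- After the target is written as a suspension, both maps desuspend to maps out of `U ⨿ V`, whose
classes are detected on the two summands. -/
lemma toHo_hom_ext_suspObj_coprod {U V : 𝒞} [IsCofibrant U] [IsCofibrant V] {Z : Ho 𝒞}
    {a b : (toHo 𝒞).obj (suspObj (U ⨿ V)) ⟶ Z}
    (hl : (toHo 𝒞).map (suspMap coprod.inl) ≫ a = (toHo 𝒞).map (suspMap coprod.inl) ≫ b)
    (hr : (toHo 𝒞).map (suspMap coprod.inr) ≫ a = (toHo 𝒞).map (suspMap coprod.inr) ≫ b) :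
    a = b := by
  obtain ⟨W, _, _, ⟨e⟩⟩ := exists_desuspension Z
  obtain ⟨f, hf⟩ := exists_toHo_suspMap_eq (a ≫ e.inv)
  obtain ⟨g, hg⟩ := exists_toHo_suspMap_eq (b ≫ e.inv)
  rw [← cancel_mono e.inv, ← hf, ← hg]
  apply toHo_suspMap_congr
  have h₁ : (toHo 𝒞).map (coprod.inl ≫ f) = (toHo 𝒞).map (coprod.inl ≫ g) := by
    apply toHo_eq_of_suspMap_eq
    rw [toHo_suspMap_comp, toHo_suspMap_comp, hf, hg, reassoc_of% hl]
  have h₂ : (toHo 𝒞).map (coprod.inr ≫ f) = (toHo 𝒞).map (coprod.inr ≫ g) := by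
    apply toHo_eq_of_suspMap_eq
    rw [toHo_suspMap_comp, toHo_suspMap_comp, hf, hg, reassoc_of% hr]
  have h := toHo_coprodDesc_congr h₁ h₂
  rwa [← coprod.desc_comp, ← coprod.desc_comp, coprod.desc_inl_inr, Category.id_comp,
    Category.id_comp] at h

/-- A map out of a suspension with trivial kernel is a monomorphism in the homotopy category. -/
lemma mono_of_trivial_kernel {X C : 𝒞} [IsCofibrant X] [IsFibrant X] (ρ : suspObj X ⟶ C)
    (hρ : ∀ (T : 𝒞) [IsCofibrant T] (q : T ⟶ X), (toHo 𝒞).map (suspMap q ≫ ρ) = 0 →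
      (toHo 𝒞).map q = 0) : Mono ((toHo 𝒞).map ρ) := by
  refine ⟨fun {V} a b hab => ?_⟩
  -- `V` is written as a double suspension of `T`, so that `a` and `b` desuspend to maps `f`, `g`
  -- out of `ΣT`. Their difference is the map out of `dblCone T` given by the two cones, which
  -- stands in for subtraction.
  obtain ⟨T', _, _, ⟨e'⟩⟩ := exists_desuspension V
  obtain ⟨T, _, _, ⟨e⟩⟩ := exists_desuspension ((toHo 𝒞).obj T')
  let ε : (toHo 𝒞).obj (suspObj (suspObj T)) ≅ V :=
    (suspIso (suspObj T)).symm ≪≫ (susp 𝒞).mapIso e ≪≫ suspIso T' ≪≫ e'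
  obtain ⟨f, hf⟩ := exists_toHo_suspMap_eq (ε.hom ≫ a)
  obtain ⟨g, hg⟩ := exists_toHo_suspMap_eq (ε.hom ≫ b)
  let p : dblCone T ⟶ suspObj T ⨿ suspObj T :=
    pushout.desc (cokernel.π _ ≫ coprod.inl) (cokernel.π _ ≫ coprod.inr) (by simp)
  have hp : ∀ g' : suspObj T ⟶ X, (pushout.desc (cokernel.π _ ≫ f) (cokernel.π _ ≫ g') (by simp) :
      dblCone T ⟶ X) = p ≫ coprod.desc f g' := by
    intro g'
    apply pushout.hom_ext
    · rw [pushout.inl_desc, pushout.inl_desc_assoc, Category.assoc, coprod.inl_desc]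
    · rw [pushout.inr_desc, pushout.inr_desc_assoc, Category.assoc, coprod.inr_desc]
  have hff : (toHo 𝒞).map (p ≫ coprod.desc f f) = 0 := by
    have e : p ≫ coprod.desc f f = (pushout.desc (𝟙 _) (𝟙 _) rfl : dblCone T ⟶ cone T) ≫
        cokernel.π _ ≫ f := by
      rw [← hp]
      apply pushout.hom_ext
      · rw [pushout.inl_desc, pushout.inl_desc_assoc, Category.id_comp]
      · rw [pushout.inr_desc, pushout.inr_desc_assoc, Category.id_comp]
    rw [e]
    exact toHo_map_eq_zero_of_factor (isZero_toHo_cone T) _ _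
  -- After `ρ`, the pair `(f, g)` cannot be told from `(f, f)`, whose difference is null. So the
  -- difference of `f` and `g` lies in the kernel of `ρ`.
  have hfg : (toHo 𝒞).map (suspMap (coprod.desc f g)) ≫ (toHo 𝒞).map ρ =
      (toHo 𝒞).map (suspMap (coprod.desc f f)) ≫ (toHo 𝒞).map ρ := by
    apply toHo_hom_ext_suspObj_coprod
    · rw [← Category.assoc, ← Category.assoc, ← toHo_suspMap_comp, ← toHo_suspMap_comp,
        coprod.inl_desc, coprod.inl_desc]
    · rw [← Category.assoc, ← Category.assoc, ← toHo_suspMap_comp, ← toHo_suspMap_comp,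
        coprod.inr_desc, coprod.inr_desc, hf, hg, Category.assoc, Category.assoc, hab]
  have h0 : (toHo 𝒞).map (p ≫ coprod.desc f g) = 0 := by
    apply hρ
    rw [Functor.map_comp, toHo_suspMap_comp, Category.assoc, hfg, ← Category.assoc,
      ← toHo_suspMap_comp, toHo_suspMap_congr (g := 0) (by rw [hff, toHo_map_zero])]
    simp
  have h1 : (toHo 𝒞).map f = (toHo 𝒞).map g :=
    toHo_eq_of_dblConeDesc_eq_zero f g (by rw [hp, h0])
  rw [← cancel_epi ε.hom, ← hf, ← hg, toHo_suspMap_congr h1]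

section

variable {A B P X : 𝒞} [IsCofibrant A] [IsFibrant A] [IsFibrant B] (i : A ⟶ B) [Cofibration i]
  (p : P ⟶ B) [Fibration p] (hP : IsZero ((toHo 𝒞).obj P)) [IsCofibrant X]
  (d : X ⟶ A) (y : X ⟶ P) (sq : d ≫ i = y ≫ p) (n : cone X ⟶ P) (hn : coneι X ≫ n = y)

include hP hn

/-- A diagram chase on representatives. The map `q` into the homotopy fiber is null in `A`, so it
deforms to a loop in `B`. That loop is null in `B / A` by hypothesis, so it comes from `A`, and a
loop coming from `A` is null in the homotopy fiber. -/
lemma suspMap_comp_cokernelMap_trivial_kernel [WeakEquivalence (pullback.lift d y sq)]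
    (T : 𝒞) [IsCofibrant T] (q : T ⟶ X)
    (hq : (toHo 𝒞).map (suspMap q ≫ cokernel.map (coneι X) i d (n ≫ p)
      (by rw [reassoc_of% hn, sq])) = 0) :
    (toHo 𝒞).map q = 0 := by
  have : IsCofibrant B := isCofibrant_of_cofibration i
  have : IsFibrant P := isFibrant_of_fibration p
  -- The composite of `ΣT ⟶ ΣX ⟶ B / A` with the connecting map to `ΣA`, formed through the mapping
  -- cone of `i`, is `Σ(q ≫ d)`.
  have hqd : (toHo 𝒞).map (q ≫ d) = 0 := by
    rw [← toHo_map_zero]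
    apply toHo_eq_of_suspMap_eq
    rw [toHo_suspMap_zero]
    let z : dblCone T ⟶ pushout i (coneι A) := pushout.desc
      (coneMap q ≫ n ≫ p ≫ pushout.inl _ _) (coneMap (q ≫ d) ≫ pushout.inr _ _) (by
        rw [coneι_coneMap_assoc, coneι_coneMap_assoc, reassoc_of% hn, ← reassoc_of% sq,
          pushout.condition, Category.assoc])
    have w := weakEquivalence_pushoutDesc_π_zero (coneι A) i (isZero_toHo_cone A)
    have hz : (toHo 𝒞).map z = 0 := by
      have := toHo_isIso (pushout.desc (cokernel.π i) 0 _ : pushout i (coneι A) ⟶ cokernel i)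
      rw [← cancel_mono ((toHo 𝒞).map (pushout.desc (cokernel.π i) 0 _ :
        pushout i (coneι A) ⟶ cokernel i)), ← Functor.map_comp, zero_comp]
      have e : z ≫ (pushout.desc (cokernel.π i) 0 (by simp) : pushout i (coneι A) ⟶ cokernel i) =
          (pushout.desc (cokernel.π _) 0 (by simp) : dblCone T ⟶ suspObj T) ≫ suspMap q ≫
            cokernel.map (coneι X) i d (n ≫ p) (by rw [reassoc_of% hn, sq]) := by
        apply pushout.hom_ext
        · simp [z, pushout.inl_desc, pushout.inl_desc_assoc]
        · simp [z, pushout.inr_desc, pushout.inr_desc_assoc]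
      rw [e, Functor.map_comp, hq, comp_zero]
    have e : z ≫ (pushout.desc 0 (cokernel.π _) (by simp) : pushout i (coneι A) ⟶ suspObj A) =
        dblConeπ T ≫ suspMap (q ≫ d) := by
      apply pushout.hom_ext
      · simp [z, pushout.inl_desc, pushout.inl_desc_assoc]
      · simp [z, pushout.inr_desc, pushout.inr_desc_assoc]
    have := toHo_isIso (dblConeπ T)
    rw [← cancel_epi ((toHo 𝒞).map (dblConeπ T)), ← Functor.map_comp, ← e, Functor.map_comp, hz,
      zero_comp, comp_zero]
  let w := pullback.lift d y sq
  have hw := toHo_isIso w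
  obtain ⟨I, _⟩ := Cylinder.exists_very_good T
  obtain ⟨h⟩ := exists_leftHomotopy I (q ≫ d) 0 (by rw [hqd, toHo_map_zero])
  -- Covering the nullhomotopy of `q ≫ d` deforms `q` to a map `l` with zero component in `A`. Its
  -- component in `P` lies in the fiber of `p`; extending it to the cone gives the loop `ν : ΣT ⟶
  -- B`.
  obtain ⟨l, h', hl⟩ := Cylinder.LeftHomotopy.covering_homotopy h (pullback.fst i p) (q ≫ w)
    (by simp [w, pullback.lift_fst])
  have hl0 : l ≫ pullback.fst i p = 0 := by rw [← h'.h₁, Category.assoc, hl, h.h₁]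
  have hl1 : (l ≫ pullback.snd i p) ≫ p = 0 := by
    rw [Category.assoc, ← pullback.condition, reassoc_of% hl0, zero_comp]
  obtain ⟨n', hn'⟩ := exists_extension (coneι T) (trivialFibration_of_isZero_toHo hP)
    (l ≫ pullback.snd i p)
  let ν : suspObj T ⟶ B := cokernel.desc _ (n' ≫ p) (by rw [reassoc_of% hn', ← hl1, Category.assoc])
  -- The deformation from `q` to `l`, capped by the two nullhomotopies, fills in inside the
  -- contractible `P`; this compares `ν` with the given map in `B / A`.
  have hν : (toHo 𝒞).map (ν ≫ cokernel.π i) = 0 := by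
    obtain ⟨K, hK⟩ := exists_extension (coneι _) (trivialFibration_of_isZero_toHo hP)
      (cappedCylDesc I (h'.h ≫ pullback.snd i p) (coneMap q ≫ n) n'
        (by rw [← Category.assoc, h'.h₀, coneι_coneMap_assoc, hn]; simp [w, pullback.lift_snd])
        (by rw [← Category.assoc, h'.h₁, hn']))
    obtain ⟨k₁, k₂, k₃⟩ := coneCyl_desc I K hK
    have hc : coneCylMid I ≫ K ≫ p = (h'.h ≫ pullback.fst i p) ≫ i := by
      rw [reassoc_of% k₁, Category.assoc, pullback.condition]
    have e₁ : ν ≫ cokernel.π i = cokernel.map (coneι T) (coneCylMid I) I.i₁ (coneCyl₁ I)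
        (coneι_coneCyl₁ I) ≫ cokernel.map (coneCylMid I) i _ (K ≫ p) hc := by
      apply cokernel_hom_ext
      rw [cokernel.π_desc_assoc, π_cokernelMap_assoc, π_cokernelMap, Category.assoc,
        Category.assoc, reassoc_of% k₃]
    have e₂ : suspMap q ≫ cokernel.map (coneι X) i d (n ≫ p) (by rw [reassoc_of% hn, sq]) =
        cokernel.map (coneι T) (coneCylMid I) I.i₀ (coneCyl₀ I)
        (coneι_coneCyl₀ I) ≫ cokernel.map (coneCylMid I) i _ (K ≫ p) hc := by
      apply cokernel_hom_ext
      rw [π_suspMap_assoc, π_cokernelMap, π_cokernelMap_assoc, π_cokernelMap, Category.assoc,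
        Category.assoc, reassoc_of% k₂]
    rw [e₁, Functor.map_comp, ← toHo_cokernelMap_coneCyl, ← Functor.map_comp, ← e₂, hq]
  -- By exactness `ν` comes from `v : ΣT ⟶ A`. The homotopy from `ν` to `v ≫ i`, trivial on the
  -- cylinder of `T`, is lifted to `P` with ends `n'` and `n''`.
  obtain ⟨v, hv⟩ := exists_lift_of_toHo_comp_cokernelπ_eq_zero i ν hν
  obtain ⟨k, k₁, k₂, k₃⟩ := exists_coneCyl_map I ν (v ≫ i) hv.symm
  obtain ⟨n'', hn''⟩ := exists_lift_of_isZero (isZero_toHo_cone T) p (cokernel.π _ ≫ v ≫ i)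
  have := weakEquivalence_coneCylEnds I
  have hsq : CommSq (coprod.desc n' n'') (coneCylEnds I) p k := ⟨by
    apply coprod.hom_ext
    · rw [coprod.inl_desc_assoc, inl_coneCylEnds_assoc, k₂, cokernel.π_desc]
    · rw [coprod.inr_desc_assoc, inr_coneCylEnds_assoc, k₃, hn'']⟩
  have f₀ : coneCyl₀ I ≫ hsq.lift = n' := by
    rw [← inl_coneCylEnds, Category.assoc, hsq.fac_left, coprod.inl_desc]
  have f₁ : coneCyl₁ I ≫ hsq.lift = n'' := by
    rw [← inr_coneCylEnds, Category.assoc, hsq.fac_left, coprod.inr_desc]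
  have hH : (0 : I.I ⟶ A) ≫ i = (coneCylMid I ≫ hsq.lift) ≫ p := by
    rw [Category.assoc, hsq.fac_right, k₁, zero_comp]
  -- Restricted to the cylinder of `T`, the lift covers the zero map to `B`, so it pairs with zero
  -- in `A`. It deforms `l` into a map that factors through `cone T`.
  let H : I.I ⟶ pullback i p := pullback.lift 0 (coneCylMid I ≫ hsq.lift) hH
  have hH₀ : I.i₀ ≫ H = l := by
    apply pullback.hom_ext
    · simp [H, hl0, pullback.lift_fst]
    · simp only [H, Category.assoc, pullback.lift_snd]
      rw [← coneι_coneCyl₀_assoc, f₀, hn']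
  have hH₁ : I.i₁ ≫ H = coneι T ≫ pullback.lift (cokernel.π _ ≫ v) n'' (by
      rw [hn'', Category.assoc]) := by
    apply pullback.hom_ext
    · simp [H, pullback.lift_fst]
    · simp only [H, Category.assoc, pullback.lift_snd]
      rw [← coneι_coneCyl₁_assoc, f₁]
  have h0 : (toHo 𝒞).map l = 0 := by
    rw [toHo_eq_of_leftHomotopy ({ h := H, h₀ := hH₀, h₁ := hH₁ } : I.LeftHomotopy _ _)]
    exact toHo_map_eq_zero_of_factor (isZero_toHo_cone T) _ _
  rw [← cancel_mono ((toHo 𝒞).map w), ← Functor.map_comp, toHo_eq_of_leftHomotopy h', h0, zero_comp]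

/-- The map is a monomorphism in `Ho` because its kernel is trivial. It is a split epimorphism
because `i` is also the inclusion into the mapping cone of some `d' : X' ⟶ A`, and such an `X'` maps
to the homotopy fiber. The trivial fibration hypothesis supplies the lift `X' ⟶ X`. -/
lemma weakEquivalence_suspObj_homotopyFiber [Fibration (pullback.lift d y sq)]
    [WeakEquivalence (pullback.lift d y sq)] :
    WeakEquivalence (cokernel.map (coneι X) i d (n ≫ p) (by rw [reassoc_of% hn, sq])) := by
  have : IsFibrant P := isFibrant_of_fibration p
  have : IsFibrant (pullback i p) := isFibrant_of_fibration (pullback.fst i p)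
  have : IsFibrant X := isFibrant_of_fibration (pullback.lift d y sq)
  let ρ := cokernel.map (coneι X) i d (n ≫ p) (by rw [reassoc_of% hn, sq])
  have hρ : Mono ((toHo 𝒞).map ρ) := mono_of_trivial_kernel ρ (fun T _ q hq =>
    suspMap_comp_cokernelMap_trivial_kernel i p hP d y sq n hn T q hq)
  obtain ⟨X', _, d', n', h', hw⟩ := exists_mappingCone_weakEquivalence i
  obtain ⟨m, hm⟩ := exists_lift_of_isZero (isZero_toHo_cone X') p n'
  have sq' : CommSq (initial.to X) (initial.to X') (pullback.lift d y sq)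
    (pullback.lift d' (coneι X' ≫ m) (by rw [h', Category.assoc, hm])) := { }
  let s := sq'.lift
  have hs₁ : s ≫ d = d' := by
    simpa only [Category.assoc, pullback.lift_fst] using sq'.fac_right =≫ pullback.fst i p
  have hs₂ : s ≫ y = coneι X' ≫ m := by
    simpa only [Category.assoc, pullback.lift_snd] using sq'.fac_right =≫ pullback.snd i p
  have e : (toHo 𝒞).map (suspMap s ≫ ρ) =
      (toHo 𝒞).map (cokernel.map (coneι X') i d' n' h'.symm) := by
    have := toHo_cokernelMap_eq_of_factor hP i d' (coneMap s ≫ n) m p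
      (by rw [coneι_coneMap_assoc, hn, hs₂])
      (by rw [Category.assoc, coneι_coneMap_assoc, reassoc_of% hn, ← sq, reassoc_of% hs₁])
      (by rw [hm, h'])
    refine Eq.trans ?_ (this.trans ?_)
    · congr 1
      apply cokernel_hom_ext
      simp [ρ]
    · congr 1
      apply cokernel_hom_ext
      simp [hm]
  have w := weakEquivalence_cokernelMap_of_weakEquivalence (pushout.inl d' (coneι X')) i (𝟙 A)
    (pushout.desc i n' h') (by simp [pushout.inl_desc])
  have w' : WeakEquivalence (cokernel.map (coneι X') i d' n' h'.symm) := by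
    have e' : cokernel.map (coneι X') i d' n' h'.symm = cokernel.map (coneι X')
        (pushout.inl d' (coneι X')) d' (pushout.inr d' (coneι X')) pushout.condition.symm ≫
        cokernel.map (pushout.inl d' (coneι X')) i (𝟙 A) (pushout.desc i n' h')
          (by simp [pushout.inl_desc]) := by
      apply cokernel_hom_ext
      simp [pushout.inr_desc_assoc]
    rw [e']
    infer_instance
  have := toHo_isIso (cokernel.map (coneι X') i d' n' h'.symm)
  rw [← e, Functor.map_comp] at this
  have : IsSplitEpi ((toHo 𝒞).map ρ) := ⟨⟨⟨inv ((toHo 𝒞).map (suspMap s) ≫ (toHo 𝒞).map ρ) ≫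
    (toHo 𝒞).map (suspMap s), by simp⟩⟩⟩
  have : IsIso ((toHo 𝒞).map ρ) := isIso_of_mono_of_isSplitEpi _
  exact weakEquivalence_of_isIso_toHo ρ

/-- A cofibrant resolution of the pullback reduces to the case of a trivial fibration onto it. The
five lemma then passes from `ΣX ⟶ B / A` to the mapping cone. -/
lemma weakEquivalence_mappingCone_homotopyFiber_of_cofibration
    [WeakEquivalence (pullback.lift d y sq)] :
    WeakEquivalence (pushout.desc i (n ≫ p) (by rw [reassoc_of% hn, sq]) :
      pushout d (coneι X) ⟶ B) := by
  have : IsFibrant P := isFibrant_of_fibration p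
  let E := pullback i p
  let Q := CofibrantObject.HoCat.resolutionObj E
  let r : Q ⟶ E := CofibrantObject.HoCat.pResolutionObj E
  have sq' : CommSq (initial.to Q) (initial.to X) r (pullback.lift d y sq) := { }
  let x : X ⟶ Q := sq'.lift
  have hx : x ≫ r = pullback.lift d y sq := sq'.fac_right
  have hx₁ : x ≫ r ≫ pullback.fst i p = d := by rw [reassoc_of% hx, pullback.lift_fst]
  have hx₂ : x ≫ r ≫ pullback.snd i p = y := by rw [reassoc_of% hx, pullback.lift_snd]
  have : WeakEquivalence x := weakEquivalence_of_postcomp_of_fac hx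
  obtain ⟨m, hm⟩ := exists_extension (coneι Q) (trivialFibration_of_isZero_toHo hP)
    (r ≫ pullback.snd i p)
  have sqQ : (r ≫ pullback.fst i p) ≫ i = (r ≫ pullback.snd i p) ≫ p := by
    simp [pullback.condition]
  have hr : pullback.lift (r ≫ pullback.fst i p) (r ≫ pullback.snd i p) sqQ = r := by
    apply pullback.hom_ext <;> simp [pullback.lift_fst, pullback.lift_snd]
  have : Fibration (pullback.lift (r ≫ pullback.fst i p) (r ≫ pullback.snd i p) sqQ) := by
    rw [hr]; infer_instance
  have : WeakEquivalence (pullback.lift (r ≫ pullback.fst i p) (r ≫ pullback.snd i p) sqQ) := by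
    rw [hr]; infer_instance
  have w := weakEquivalence_suspObj_homotopyFiber i p hP _ _ sqQ m hm
  have w' := weakEquivalence_suspMap x
  have hX : WeakEquivalence (cokernel.map (coneι X) i d (n ≫ p) (by rw [reassoc_of% hn, sq])) := by
    rw [← toHo_isIso_iff, toHo_cokernelMap_eq_of_factor hP i d n (coneMap x ≫ m) p
      (by rw [hn, coneι_coneMap_assoc, hm, hx₂]) (by rw [reassoc_of% hn, sq])
      (by rw [Category.assoc, coneι_coneMap_assoc, reassoc_of% hm, reassoc_of% hx₂, sq]),
      toHo_isIso_iff]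
    have e : cokernel.map (coneι X) i d ((coneMap x ≫ m) ≫ p)
        (by rw [Category.assoc, coneι_coneMap_assoc, reassoc_of% hm, reassoc_of% hx₂, sq]) =
        suspMap x ≫ cokernel.map (coneι Q) i (r ≫ pullback.fst i p) (m ≫ p)
          (by rw [reassoc_of% hm, sqQ, Category.assoc]) := by
      apply cokernel_hom_ext
      simp
    rw [e]
    infer_instance
  refine weakEquivalence_of_cokernelMap (pushout.inl d (coneι X)) i (𝟙 A) _
    (by simp [pushout.inl_desc]) ?_
  refine weakEquivalence_of_precomp_of_fac (f := cokernel.map (coneι X)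
    (pushout.inl d (coneι X)) d (pushout.inr d (coneι X)) pushout.condition.symm)
    (fg := cokernel.map (coneι X) i d (n ≫ p) _) ?_
  apply cokernel_hom_ext
  simp [pushout.inr_desc_assoc]

end

/-- If `X` is the homotopy fiber of a map `i : A ⟶ B` of fibrant objects, then the mapping cone of
`X ⟶ A` is `B`. -/
lemma weakEquivalence_mappingCone_homotopyFiber {A B P X : 𝒞} [IsCofibrant A] [IsFibrant A]
    [IsFibrant B] (i : A ⟶ B) (p : P ⟶ B) [Fibration p] (hP : IsZero ((toHo 𝒞).obj P))
    [IsCofibrant X] (d : X ⟶ A) (y : X ⟶ P) (sq : d ≫ i = y ≫ p) (n : cone X ⟶ P)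
    (hn : coneι X ≫ n = y) [WeakEquivalence (pullback.lift d y sq)] :
    WeakEquivalence (pushout.desc i (n ≫ p) (by rw [reassoc_of% hn, sq]) :
      pushout d (coneι X) ⟶ B) := by
  -- Replacing `i` by a cofibration into `F.Z` and `p` by its pullback along `F.p` leaves the
  -- homotopy fiber unchanged; `c` is this identification.
  obtain ⟨F⟩ : Nonempty (MorphismProperty.MapFactorizationData (cofibrations 𝒞)
    (trivialFibrations 𝒞) i) := ⟨MorphismProperty.factorizationData _ _ _⟩
  have : IsFibrant F.Z := isFibrant_of_fibration F.p
  have sqP : CommSq (pullback.lift y (d ≫ F.i) (by simp [sq])) (coneι X)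
    (pullback.fst p F.p) n := ⟨by rw [pullback.lift_fst, hn]⟩
  have h₁ : (coneι X ≫ sqP.lift) ≫ pullback.fst p F.p = y := by
    rw [Category.assoc, sqP.fac_right, hn]
  have h₂ : (coneι X ≫ sqP.lift) ≫ pullback.snd p F.p = d ≫ F.i := by
    rw [sqP.fac_left, pullback.lift_snd]
  let c : pullback F.i (pullback.snd p F.p) ⟶ pullback i p :=
    pullback.lift (pullback.fst _ _) (pullback.snd _ _ ≫ pullback.fst _ _) (by
      rw [Category.assoc, pullback.condition, ← pullback.condition_assoc, F.fac])
  have : IsIso c := by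
    refine ⟨pullback.lift (pullback.fst _ _) (pullback.lift (pullback.snd _ _)
      (pullback.fst _ _ ≫ F.i) (by rw [Category.assoc, F.fac, pullback.condition]))
      (by rw [pullback.lift_snd]), ?_, ?_⟩
    · apply pullback.hom_ext
      · simp [c, pullback.lift_fst]
      · apply pullback.hom_ext
        · simp [c, pullback.lift_fst, pullback.lift_snd]
        · simp [c, pullback.lift_fst_assoc, pullback.lift_snd, pullback.condition]
    · apply pullback.hom_ext
      · simp [c, pullback.lift_fst]
      · simp [c, pullback.lift_fst, pullback.lift_snd, pullback.lift_snd_assoc]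
  have e : pullback.lift d (coneι X ≫ sqP.lift) h₂.symm ≫ c = pullback.lift d y sq := by
    apply pullback.hom_ext
    · simp [c, pullback.lift_fst]
    · rw [Category.assoc, pullback.lift_snd, pullback.lift_snd_assoc, h₁, pullback.lift_snd]
  have := weakEquivalence_of_postcomp_of_fac e
  have := weakEquivalence_mappingCone_homotopyFiber_of_cofibration F.i (pullback.snd p F.p)
    (isZero_toHo_of_weakEquivalence' (pullback.fst p F.p) hP) d (coneι X ≫ sqP.lift) h₂.symm
    sqP.lift rfl
  have e' : pushout.desc i (n ≫ p) (by rw [reassoc_of% hn, sq]) =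
      pushout.desc F.i (sqP.lift ≫ pullback.snd p F.p) (by rw [← Category.assoc, h₂]) ≫ F.p := by
    apply pushout.hom_ext
    · rw [pushout.inl_desc, pushout.inl_desc_assoc, F.fac]
    · rw [pushout.inr_desc, pushout.inr_desc_assoc, Category.assoc, ← pullback.condition,
        reassoc_of% sqP.fac_right]
  rw [e']
  infer_instance

end HomotopyFiber

end StableTot

namespace StableTot

/-! ### Homotopy theory of filtered objects -/

namespace ThreeStage

section

variable {𝒞 : Type u} [Category.{v} 𝒞] [HasZeroMorphisms 𝒞] [HasZeroObject 𝒞] [ModelCategory 𝒞]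

instance (X : ThreeStage 𝒞) : IsCofibrant X.X₁ := isCofibrant_of_cofibration X.i₁

/-- All stages are fibrant. -/
class IsStagewiseFibrant (X : ThreeStage 𝒞) : Prop where
  fibrant₀ : IsFibrant X.X₀
  fibrant₁ : IsFibrant X.X₁
  fibrant₂ : IsFibrant X.X₂

attribute [instance] IsStagewiseFibrant.fibrant₀ IsStagewiseFibrant.fibrant₁
  IsStagewiseFibrant.fibrant₂

namespace Hom

variable {X Y Z : ThreeStage 𝒞}

/-- Composition of strict maps of filtered objects. -/
@[simps]
def comp (f : Hom X Y) (g : Hom Y Z) : Hom X Z where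
  f₀ := f.f₀ ≫ g.f₀
  f₁ := f.f₁ ≫ g.f₁
  f₂ := f.f₂ ≫ g.f₂
  comm₁ := by rw [← Category.assoc, f.comm₁, Category.assoc, g.comm₁, Category.assoc]
  comm₂ := by rw [← Category.assoc, f.comm₂, Category.assoc, g.comm₂, Category.assoc]

@[simp]
lemma comp_gr₁ (f : Hom X Y) (g : Hom Y Z) : (f.comp g).gr₁ = f.gr₁ ≫ g.gr₁ :=
  (cokernelMap_comp _ _ _ _ _ _).symm

@[simp]
lemma comp_gr₂ (f : Hom X Y) (g : Hom Y Z) : (f.comp g).gr₂ = f.gr₂ ≫ g.gr₂ :=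
  (cokernelMap_comp _ _ _ _ _ _).symm

lemma IsWeakEquivalence.comp {f : Hom X Y} {g : Hom Y Z} (hf : f.IsWeakEquivalence)
    (hg : g.IsWeakEquivalence) : (f.comp g).IsWeakEquivalence := by
  obtain ⟨_, _, _⟩ := hf
  obtain ⟨_, _, _⟩ := hg
  refine ⟨?_, ?_, ?_⟩ <;> dsimp only [Hom.comp] <;> infer_instance

lemma IsWeakEquivalence.of_comp_left {f : Hom X Y} {g : Hom Y Z} (hf : f.IsWeakEquivalence)
    (hfg : (f.comp g).IsWeakEquivalence) : g.IsWeakEquivalence := by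
  obtain ⟨_, _, _⟩ := hf
  obtain ⟨h₀, h₁, h₂⟩ := hfg
  exact ⟨weakEquivalence_of_precomp_of_fac (fg := (f.comp g).f₀) rfl,
    weakEquivalence_of_precomp_of_fac (fg := (f.comp g).f₁) rfl,
    weakEquivalence_of_precomp_of_fac (fg := (f.comp g).f₂) rfl⟩

lemma IsWeakEquivalence.of_comp_right {f : Hom X Y} {g : Hom Y Z} (hg : g.IsWeakEquivalence)
    (hfg : (f.comp g).IsWeakEquivalence) : f.IsWeakEquivalence := by
  obtain ⟨_, _, _⟩ := hg
  obtain ⟨h₀, h₁, h₂⟩ := hfg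
  exact ⟨weakEquivalence_of_postcomp_of_fac (fg := (f.comp g).f₀) rfl,
    weakEquivalence_of_postcomp_of_fac (fg := (f.comp g).f₁) rfl,
    weakEquivalence_of_postcomp_of_fac (fg := (f.comp g).f₂) rfl⟩

lemma IsWeakEquivalence.gr₁ {f : Hom X Y} (hf : f.IsWeakEquivalence) : WeakEquivalence f.gr₁ :=
  have := hf.1
  have := hf.2.1
  weakEquivalence_cokernelMap_of_weakEquivalence _ _ _ _ _

lemma IsWeakEquivalence.gr₂ {f : Hom X Y} (hf : f.IsWeakEquivalence) : WeakEquivalence f.gr₂ :=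
  have := hf.2.1
  have := hf.2.2
  weakEquivalence_cokernelMap_of_weakEquivalence _ _ _ _ _

/-- A strict map which is an equivalence on all subquotients is a stagewise weak equivalence. -/
lemma isWeakEquivalence_of_gr [StableModelCategory 𝒞] (f : Hom X Y) (h₀ : WeakEquivalence f.f₀)
    (h₁ : WeakEquivalence f.gr₁) (h₂ : WeakEquivalence f.gr₂) : f.IsWeakEquivalence := by
  have := weakEquivalence_of_cokernelMap X.i₁ Y.i₁ f.f₀ f.f₁ f.comm₁ h₁
  exact ⟨h₀, this, weakEquivalence_of_cokernelMap X.i₂ Y.i₂ f.f₁ f.f₂ f.comm₂ h₂⟩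

end Hom

lemma exists_extension_of_isFibrant {A B W : 𝒞} (i : A ⟶ B) [Cofibration i] [WeakEquivalence i]
    [IsFibrant W] (f : A ⟶ W) : ∃ g : B ⟶ W, i ≫ g = f := by
  have sq : CommSq f i (terminal.from W) (terminal.from B) := { }
  exact ⟨sq.lift, sq.fac_left⟩

/-- Factorization of a strict map of filtered objects into a weak equivalence along which maps to
stagewise fibrant objects extend, followed by a stagewise fibration. -/
lemma Hom.exists_factorization {X Y : ThreeStage 𝒞} (f : Hom X Y) :
    ∃ (Z : ThreeStage 𝒞) (j : Hom X Z) (p : Hom Z Y), j.comp p = f ∧ j.IsWeakEquivalence ∧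
      (Fibration p.f₀ ∧ Fibration p.f₁ ∧ Fibration p.f₂) ∧
      ∀ (W : ThreeStage 𝒞) [W.IsStagewiseFibrant] (a : Hom X W), ∃ e : Hom Z W, j.comp e = a := by
  obtain ⟨F₀⟩ : Nonempty (MorphismProperty.MapFactorizationData (trivialCofibrations 𝒞)
    (fibrations 𝒞) f.f₀) := ⟨MorphismProperty.factorizationData _ _ _⟩
  -- As in the Reedy construction, the map that is factored starts from the union of the new stage
  -- of `X` with the previous stage of `Z`.
  obtain ⟨F₁⟩ : Nonempty (MorphismProperty.MapFactorizationData (trivialCofibrations 𝒞)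
    (fibrations 𝒞) (pushout.desc f.f₁ (F₀.p ≫ Y.i₁) (by rw [F₀.fac_assoc, f.comm₁]) :
      pushout X.i₁ F₀.i ⟶ _)) := ⟨MorphismProperty.factorizationData _ _ _⟩
  obtain ⟨F₂⟩ : Nonempty (MorphismProperty.MapFactorizationData (trivialCofibrations 𝒞)
    (fibrations 𝒞) (pushout.desc f.f₂ (F₁.p ≫ Y.i₂) (by
      rw [Category.assoc, F₁.fac_assoc, pushout.inl_desc_assoc, f.comm₂]) :
      pushout X.i₂ (pushout.inl _ _ ≫ F₁.i) ⟶ _)) := ⟨MorphismProperty.factorizationData _ _ _⟩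
  have : IsCofibrant F₀.Z := isCofibrant_of_cofibration F₀.i
  let Z : ThreeStage 𝒞 :=
    { X₀ := F₀.Z
      X₁ := F₁.Z
      X₂ := F₂.Z
      i₁ := pushout.inr _ _ ≫ F₁.i
      i₂ := pushout.inr _ _ ≫ F₂.i
      cofibrant := inferInstance
      cofibration₁ := inferInstance
      cofibration₂ := inferInstance }
  let j : Hom X Z :=
    { f₀ := F₀.i
      f₁ := pushout.inl _ _ ≫ F₁.i
      f₂ := pushout.inl _ _ ≫ F₂.i
      comm₁ := pushout.condition_assoc _
      comm₂ := pushout.condition_assoc _ }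
  let p : Hom Z Y :=
    { f₀ := F₀.p
      f₁ := F₁.p
      f₂ := F₂.p
      comm₁ := by
        dsimp only [Z]
        rw [Category.assoc, F₁.fac, pushout.inr_desc]
      comm₂ := by
        dsimp only [Z]
        rw [Category.assoc, F₂.fac, pushout.inr_desc] }
  refine ⟨Z, j, p, ?_, ⟨?_, ?_, ?_⟩, ⟨?_, ?_, ?_⟩, fun W _ a => ?_⟩
  · cases f
    simp only [Hom.comp, j, p, Hom.mk.injEq]
    refine ⟨F₀.fac, ?_, ?_⟩
    · rw [Category.assoc, F₁.fac, pushout.inl_desc]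
    · rw [Category.assoc, F₂.fac, pushout.inl_desc]
  · dsimp only [j]
    infer_instance
  · dsimp only [j]
    infer_instance
  · dsimp only [j]
    infer_instance
  · dsimp only [p]
    infer_instance
  · dsimp only [p]
    infer_instance
  · dsimp only [p]
    infer_instance
  · obtain ⟨e₀, h₀⟩ := exists_extension_of_isFibrant F₀.i a.f₀
    obtain ⟨e₁, h₁⟩ := exists_extension_of_isFibrant F₁.i
      (pushout.desc a.f₁ (e₀ ≫ W.i₁) (by rw [reassoc_of% h₀, a.comm₁]))
    have h₁' : (pushout.inl _ _ ≫ F₁.i) ≫ e₁ = a.f₁ := by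
      rw [Category.assoc, h₁, pushout.inl_desc]
    obtain ⟨e₂, h₂⟩ := exists_extension_of_isFibrant F₂.i
      (pushout.desc a.f₂ (e₁ ≫ W.i₂) (by rw [← Category.assoc, h₁', a.comm₂]))
    refine ⟨⟨e₀, e₁, e₂, ?_, ?_⟩, ?_⟩
    · dsimp only [Z]
      rw [Category.assoc, h₁, pushout.inr_desc]
    · dsimp only [Z]
      rw [Category.assoc, h₂, pushout.inr_desc]
    · cases a
      simp only [Hom.comp, j, Hom.mk.injEq]
      refine ⟨h₀, h₁', ?_⟩
      rw [Category.assoc, h₂, pushout.inl_desc]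

/-- Lifting of strict maps through stagewise trivial fibrations. -/
lemma Hom.exists_lift {X Y Z : ThreeStage 𝒞} (p : Hom Y Z) (hp : p.IsWeakEquivalence)
    (hp' : Fibration p.f₀ ∧ Fibration p.f₁ ∧ Fibration p.f₂) (f : Hom X Z) :
    ∃ g : Hom X Y, g.comp p = f := by
  obtain ⟨_, _, _⟩ := hp
  obtain ⟨_, _, _⟩ := hp'
  have sq₀ : CommSq (initial.to _) (initial.to _) p.f₀ f.f₀ := { }
  have sq₁ : CommSq (sq₀.lift ≫ Y.i₁) X.i₁ p.f₁ f.f₁ :=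
    ⟨by rw [Category.assoc, p.comm₁, ← Category.assoc, sq₀.fac_right, f.comm₁]⟩
  have sq₂ : CommSq (sq₁.lift ≫ Y.i₂) X.i₂ p.f₂ f.f₂ :=
    ⟨by rw [Category.assoc, p.comm₂, ← Category.assoc, sq₁.fac_right, f.comm₂]⟩
  refine ⟨⟨sq₀.lift, sq₁.lift, sq₂.lift, sq₁.fac_left, sq₂.fac_left⟩, ?_⟩
  cases f
  simp only [Hom.comp, Hom.mk.injEq]
  exact ⟨sq₀.fac_right, sq₁.fac_right, sq₂.fac_right⟩

/-- A stagewise fibrant replacement. -/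
lemma exists_fibrantReplacement (X : ThreeStage 𝒞) :
    ∃ (Z : ThreeStage 𝒞) (j : Hom X Z), Z.IsStagewiseFibrant ∧ j.IsWeakEquivalence ∧
      ∀ (W : ThreeStage 𝒞) [W.IsStagewiseFibrant] (a : Hom X W), ∃ e : Hom Z W, j.comp e = a := by
  have c : IsCofibrant (0 : 𝒞) := isCofibrant_of_isZero (isZero_zero 𝒞)
  let O : ThreeStage 𝒞 := ⟨0, 0, 0, 𝟙 _, 𝟙 _, c, inferInstance, inferInstance⟩
  let f : Hom X O := ⟨0, 0, 0, by simp, by simp⟩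
  obtain ⟨Z, j, p, _, hj, ⟨_, _, _⟩, h⟩ := f.exists_factorization
  have : IsFibrant (0 : 𝒞) := inferInstance
  exact ⟨Z, j, ⟨isFibrant_of_fibration (Y := (0 : 𝒞)) p.f₀,
    isFibrant_of_fibration (Y := (0 : 𝒞)) p.f₁, isFibrant_of_fibration (Y := (0 : 𝒞)) p.f₂⟩, hj, h⟩

namespace HoMap

variable {X Y W : ThreeStage 𝒞}

/-- Filtration-preserving maps compose. -/
lemma exists_comp (g : HoMap X Y) (g' : HoMap Y W) {φ₀ φ₁ φ₂ ψ₀ ψ₁ ψ₂}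
    (hg : g.AgreesWith φ₀ φ₁ φ₂) (hg' : g'.AgreesWith ψ₀ ψ₁ ψ₂) :
    ∃ g'' : HoMap X W, g''.AgreesWith (φ₀ ≫ ψ₀) (φ₁ ≫ ψ₁) (φ₂ ≫ ψ₂) ∧
      (g.IsWeakEquivalence → g'.IsWeakEquivalence → g''.IsWeakEquivalence) := by
  -- The backward map `g.b` is split as `j` followed by the trivial fibration `p`: `g.a` lifts
  -- through `p`, and `g'.a` extends along `j` once its target is stagewise fibrant.
  obtain ⟨Z', j, p, hjp, hj, hp', hext⟩ := g.b.exists_factorization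
  have hp : p.IsWeakEquivalence := hj.of_comp_left (hjp ▸ g.hb)
  obtain ⟨a, ha⟩ := p.exists_lift hp hp' g.a
  obtain ⟨V, k, _, hk, -⟩ := g'.Z.exists_fibrantReplacement
  obtain ⟨e, he⟩ := hext V (g'.a.comp k)
  obtain ⟨h₀, h₁, h₂⟩ := hg
  obtain ⟨h₀', h₁', h₂'⟩ := hg'
  have := hp.1
  have := toHo_isIso p.f₀
  have := hp.gr₁
  have := toHo_isIso p.gr₁
  have := hp.gr₂
  have := toHo_isIso p.gr₂
  refine ⟨⟨V, a.comp e, g'.b.comp k, g'.hb.comp hk⟩, ⟨?_, ?_, ?_⟩, fun hg hg' => ?_⟩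
  · have h : (toHo 𝒞).map a.f₀ = φ₀ ≫ (toHo 𝒞).map j.f₀ := by
      rw [← cancel_mono ((toHo 𝒞).map p.f₀), Category.assoc, ← Functor.map_comp,
        ← Functor.map_comp, ← Hom.comp_f₀, ← Hom.comp_f₀, hjp, ha, h₀]
    rw [Hom.comp_f₀, Hom.comp_f₀, Functor.map_comp, h, Category.assoc, ← Functor.map_comp, ← Hom.comp_f₀, he,
      Hom.comp_f₀, Functor.map_comp, h₀', Functor.map_comp, Category.assoc, Category.assoc]
  · have h : (toHo 𝒞).map a.gr₁ = φ₁ ≫ (toHo 𝒞).map j.gr₁ := by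
      rw [← cancel_mono ((toHo 𝒞).map p.gr₁), Category.assoc, ← Functor.map_comp,
        ← Functor.map_comp, ← Hom.comp_gr₁, ← Hom.comp_gr₁, hjp, ha, h₁]
    rw [Hom.comp_gr₁, Hom.comp_gr₁, Functor.map_comp, h, Category.assoc, ← Functor.map_comp, ← Hom.comp_gr₁, he,
      Hom.comp_gr₁, Functor.map_comp, h₁', Functor.map_comp, Category.assoc, Category.assoc]
  · have h : (toHo 𝒞).map a.gr₂ = φ₂ ≫ (toHo 𝒞).map j.gr₂ := by
      rw [← cancel_mono ((toHo 𝒞).map p.gr₂), Category.assoc, ← Functor.map_comp,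
        ← Functor.map_comp, ← Hom.comp_gr₂, ← Hom.comp_gr₂, hjp, ha, h₂]
    rw [Hom.comp_gr₂, Hom.comp_gr₂, Functor.map_comp, h, Category.assoc, ← Functor.map_comp, ← Hom.comp_gr₂, he,
      Hom.comp_gr₂, Functor.map_comp, h₂', Functor.map_comp, Category.assoc, Category.assoc]
  · have ha' : a.IsWeakEquivalence := hp.of_comp_right (ha ▸ hg)
    exact ha'.comp (hj.of_comp_left (he ▸ Hom.IsWeakEquivalence.comp hg' hk))

/-- The inverse of a filtration-preserving weak equivalence. -/
def symm (g : HoMap X Y) (hg : g.IsWeakEquivalence) : HoMap Y X := ⟨g.Z, g.b, g.a, hg⟩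

lemma AgreesWith.symm {g : HoMap X Y} (hg : g.IsWeakEquivalence) {φ₀ φ₁ φ₂ ψ₀ ψ₁ ψ₂}
    (h : g.AgreesWith φ₀ φ₁ φ₂) (h₀ : ψ₀ ≫ φ₀ = 𝟙 _) (h₁ : ψ₁ ≫ φ₁ = 𝟙 _)
    (h₂ : ψ₂ ≫ φ₂ = 𝟙 _) : (g.symm hg).AgreesWith ψ₀ ψ₁ ψ₂ := by
  obtain ⟨e₀, e₁, e₂⟩ := h
  refine ⟨?_, ?_, ?_⟩
  · change (toHo 𝒞).map g.b.f₀ = ψ₀ ≫ (toHo 𝒞).map g.a.f₀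
    rw [e₀, reassoc_of% h₀]
  · change (toHo 𝒞).map g.b.gr₁ = ψ₁ ≫ (toHo 𝒞).map g.a.gr₁
    rw [e₁, reassoc_of% h₁]
  · change (toHo 𝒞).map g.b.gr₂ = ψ₂ ≫ (toHo 𝒞).map g.a.gr₂
    rw [e₂, reassoc_of% h₂]

/-- A filtration-preserving map inducing isomorphisms on the subquotients is a weak equivalence. -/
lemma AgreesWith.isWeakEquivalence [StableModelCategory 𝒞] {g : HoMap X Y} {φ₀ φ₁ φ₂}
    (h : g.AgreesWith φ₀ φ₁ φ₂) [IsIso φ₀] [IsIso φ₁] [IsIso φ₂] : g.IsWeakEquivalence := by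
  obtain ⟨e₀, e₁, e₂⟩ := h
  have := g.hb.1
  have := toHo_isIso g.b.f₀
  have := g.hb.gr₁
  have := toHo_isIso g.b.gr₁
  have := g.hb.gr₂
  have := toHo_isIso g.b.gr₂
  refine g.a.isWeakEquivalence_of_gr ?_ ?_ ?_
  · rw [← toHo_isIso_iff, e₀]
    infer_instance
  · rw [← toHo_isIso_iff, e₁]
    infer_instance
  · rw [← toHo_isIso_iff, e₂]
    infer_instance

end HoMap

end

end ThreeStage

end StableTot

namespace StableTot

/-! ### Subquotients of the total object of a complex -/

section

variable {𝒞 : Type u} [Category.{v} 𝒞] [HasZeroMorphisms 𝒞] [HasZeroObject 𝒞] [ModelCategory 𝒞]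

/-- If `B` is the mapping cone of `X ⟶ A`, then `B / A` is the suspension of `X`. -/
lemma weakEquivalence_suspObj_cokernel_of_mappingCone {X A B : 𝒞} [IsCofibrant A]
    (d : X ⟶ A) (i : A ⟶ B) [Cofibration i] (n : cone X ⟶ B) (h : coneι X ≫ n = d ≫ i)
    [WeakEquivalence (pushout.desc i n h.symm : pushout d (coneι X) ⟶ B)] :
    WeakEquivalence (cokernel.map (coneι X) i d n h) := by
  have w := weakEquivalence_cokernelMap_of_weakEquivalence (pushout.inl d (coneι X)) i (𝟙 A)
    (pushout.desc i n h.symm) (by simp [pushout.inl_desc])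
  have e : cokernel.map (coneι X) i d n h = cokernel.map (coneι X)
      (pushout.inl d (coneι X)) d (pushout.inr d (coneι X)) pushout.condition.symm ≫
      cokernel.map (pushout.inl d (coneι X)) i (𝟙 A) (pushout.desc i n h.symm)
        (by simp [pushout.inl_desc]) := by
    apply cokernel_hom_ext
    simp [pushout.inr_desc_assoc]
  rw [e]
  infer_instance

namespace CoherentComplex

variable (K K' : CoherentComplex 𝒞)

/-- The isomorphism of `Σ X₁` with the middle subquotient of the total object. -/
noncomputable def suspToGr₁ : suspObj K.X₁ ⟶ K.tot.gr₁ :=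
  cokernel.map (coneι K.X₁) K.tot.i₁ K.d₁ (pushout.inr K.d₁ (coneι K.X₁)) pushout.condition.symm

instance : IsIso K.suspToGr₁ := isIso_cokernelMap_pushout_inr _ _

/-- The isomorphism of the suspension of the double cone with the top subquotient of the total
object. -/
noncomputable def suspToGr₂ : suspObj K.doubleCone ⟶ K.tot.gr₂ :=
  cokernel.map (coneι K.doubleCone) K.tot.i₂ K.attach (pushout.inr K.attach (coneι K.doubleCone))
    pushout.condition.symm

instance : IsIso K.suspToGr₂ := isIso_cokernelMap_pushout_inr _ _

lemma π_suspToGr₁_gr₁ {Z : ThreeStage 𝒞} (a : ThreeStage.Hom K.tot Z) :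
    cokernel.π (coneι K.X₁) ≫ K.suspToGr₁ ≫ a.gr₁ =
      (pushout.inr K.d₁ (coneι K.X₁) ≫ (a.f₁ : K.mappingCone ⟶ Z.X₁)) ≫ cokernel.π Z.i₁ := by
  refine (π_cokernelMap_assoc (coneι K.X₁) K.tot.i₁ K.d₁ (pushout.inr K.d₁ (coneι K.X₁))
    pushout.condition.symm _).trans ?_
  exact (congrArg (pushout.inr K.d₁ (coneι K.X₁) ≫ ·) (π_cokernelMap _ _ _ _ a.comm₁)).trans
    (Category.assoc _ _ _).symm

lemma π_suspToGr₂_gr₂ {Z : ThreeStage 𝒞} (a : ThreeStage.Hom K.tot Z) :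
    cokernel.π (coneι K.doubleCone) ≫ K.suspToGr₂ ≫ a.gr₂ =
      (pushout.inr K.attach (coneι K.doubleCone) ≫
        (a.f₂ : pushout K.attach (coneι K.doubleCone) ⟶ Z.X₂)) ≫ cokernel.π Z.i₂ := by
  refine (π_cokernelMap_assoc (coneι K.doubleCone) K.tot.i₂ K.attach
    (pushout.inr K.attach (coneι K.doubleCone)) pushout.condition.symm _).trans ?_
  exact (congrArg (pushout.inr K.attach (coneι K.doubleCone) ≫ ·)
    (π_cokernelMap _ _ _ _ a.comm₂)).trans (Category.assoc _ _ _).symm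

lemma suspToGr₁_totGr₁ : (toHo 𝒞).map K.suspToGr₁ ≫ K.totGr₁ = (suspIso K.X₁).inv := by
  rw [totGr₁, ← Category.assoc, ← Functor.map_comp]
  convert Category.id_comp _
  rw [← CategoryTheory.Functor.map_id]
  congr 1
  apply cokernel_hom_ext
  refine (π_cokernelMap_assoc (coneι K.X₁) K.tot.i₁ K.d₁ (pushout.inr K.d₁ (coneι K.X₁))
    pushout.condition.symm _).trans ?_
  refine (congrArg (pushout.inr _ _ ≫ ·) (cokernel.π_desc _ _ _)).trans ?_
  exact (pushout.inr_desc _ _ _).trans (Category.comp_id _).symm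

lemma suspToGr₂_totGr₂ : (toHo 𝒞).map K.suspToGr₂ ≫ K.totGr₂ = (suspIso K.doubleCone).inv ≫
    (susp 𝒞).map ((toHo 𝒞).map (dblConeπ K.X₂) ≫ (suspIso K.X₂).inv) := by
  rw [totGr₂, ← Category.assoc, ← Functor.map_comp]
  convert Category.id_comp _
  rw [← CategoryTheory.Functor.map_id]
  congr 1
  apply cokernel_hom_ext
  refine (π_cokernelMap_assoc (coneι K.doubleCone) K.tot.i₂ K.attach
    (pushout.inr K.attach (coneι K.doubleCone)) pushout.condition.symm _).trans ?_
  refine (congrArg (pushout.inr _ _ ≫ ·) (cokernel.π_desc _ _ _)).trans ?_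
  exact (pushout.inr_desc _ _ _).trans (Category.comp_id _).symm

instance : IsIso K.totGr₁ := by
  have := K.suspToGr₁_totGr₁
  rw [← IsIso.eq_inv_comp] at this
  rw [this]
  infer_instance

instance : IsIso K.totGr₂ := by
  have h := K.suspToGr₂_totGr₂
  rw [← IsIso.eq_inv_comp] at h
  have := toHo_isIso (dblConeπ K.X₂)
  rw [h]
  infer_instance

variable {K K'}

lemma suspMap_suspToGr₁ (φ : K.X₁ ⟶ K'.X₁) : (toHo 𝒞).map K.suspToGr₁ ≫
    K.totGr₁ ≫ (susp 𝒞).map ((toHo 𝒞).map φ) ≫ inv K'.totGr₁ =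
      (toHo 𝒞).map (suspMap φ) ≫ (toHo 𝒞).map K'.suspToGr₁ := by
  rw [← cancel_mono K'.totGr₁]
  simp only [Category.assoc, IsIso.inv_hom_id, Category.comp_id]
  rw [suspToGr₁_totGr₁, reassoc_of% suspToGr₁_totGr₁, suspIso_inv_naturality]

lemma suspMap_suspToGr₂ (φ : K.X₂ ⟶ K'.X₂) : (toHo 𝒞).map K.suspToGr₂ ≫
    K.totGr₂ ≫ (susp 𝒞).map ((susp 𝒞).map ((toHo 𝒞).map φ)) ≫ inv K'.totGr₂ =
      (toHo 𝒞).map (suspMap (dblConeMap φ)) ≫ (toHo 𝒞).map K'.suspToGr₂ := by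
  rw [← cancel_mono K'.totGr₂]
  simp only [Category.assoc, IsIso.inv_hom_id, Category.comp_id]
  rw [suspToGr₂_totGr₂, reassoc_of% suspToGr₂_totGr₂, ← suspIso_inv_naturality_assoc,
    ← Functor.map_comp, ← Functor.map_comp, Category.assoc, suspIso_inv_naturality,
    ← Functor.map_comp_assoc, ← Functor.map_comp_assoc, dblConeMap_dblConeπ]

/-- Agreement on subquotients is tested after the isomorphisms from `ΣX₁` and from the suspension of
the double cone, where the required maps become suspensions of strict maps. -/
lemma agreesWith_tot (g : ThreeStage.HoMap K.tot K'.tot) (φ₀ : K.X₀ ⟶ K'.X₀) (φ₁ : K.X₁ ⟶ K'.X₁)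
    (φ₂ : K.X₂ ⟶ K'.X₂)
    (h₀ : (toHo 𝒞).map g.a.f₀ = (toHo 𝒞).map φ₀ ≫ (toHo 𝒞).map g.b.f₀)
    (h₁ : (toHo 𝒞).map (K.suspToGr₁ ≫ g.a.gr₁) =
      (toHo 𝒞).map (suspMap φ₁ ≫ K'.suspToGr₁ ≫ g.b.gr₁))
    (h₂ : (toHo 𝒞).map (K.suspToGr₂ ≫ g.a.gr₂) =
      (toHo 𝒞).map (suspMap (dblConeMap φ₂) ≫ K'.suspToGr₂ ≫ g.b.gr₂)) :
    g.AgreesWith ((toHo 𝒞).map φ₀) (K.totGr₁ ≫ (susp 𝒞).map ((toHo 𝒞).map φ₁) ≫ inv K'.totGr₁)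
      (K.totGr₂ ≫ (susp 𝒞).map ((susp 𝒞).map ((toHo 𝒞).map φ₂)) ≫ inv K'.totGr₂) := by
  refine ⟨h₀, ?_, ?_⟩
  · rw [← cancel_epi ((toHo 𝒞).map K.suspToGr₁), ← Functor.map_comp, h₁, Functor.map_comp,
      Functor.map_comp, ← Category.assoc, ← suspMap_suspToGr₁, Category.assoc]
  · rw [← cancel_epi ((toHo 𝒞).map K.suspToGr₂), ← Functor.map_comp, h₂, Functor.map_comp,
      Functor.map_comp, ← Category.assoc, ← suspMap_suspToGr₂, Category.assoc]

end CoherentComplex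

end

end StableTot

namespace StableTot

/-! ### A strict complex from iterated homotopy fibers -/

section

variable {𝒞 : Type u} [Category.{v} 𝒞] [HasZeroMorphisms 𝒞] [HasZeroObject 𝒞] [ModelCategory 𝒞]

/-- Iterated homotopy fibers of a filtered object with three stages. -/
structure FiberData (F : ThreeStage 𝒞) where
  P₂ : 𝒞
  p₂ : P₂ ⟶ F.X₂
  E : 𝒞
  e : E ⟶ pullback F.i₂ p₂
  P₁ : 𝒞
  p₁ : P₁ ⟶ E
  X₁ : 𝒞
  x₁ : X₁ ⟶ pullback F.i₁ (p₁ ≫ e ≫ pullback.fst F.i₂ p₂)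
  X₂ : 𝒞
  x₂ : X₂ ⟶ pullback (0 : (0 : 𝒞) ⟶ E) p₁
  d₂ : X₂ ⟶ X₁
  comp_fst : d₂ ≫ x₁ ≫ pullback.fst _ _ = 0
  comp_snd : d₂ ≫ x₁ ≫ pullback.snd _ _ = x₂ ≫ pullback.snd _ _
  fibration_p₂ : Fibration p₂
  cofibration_P₂ : Cofibration (0 : (0 : 𝒞) ⟶ P₂)
  weakEquivalence_P₂ : WeakEquivalence (0 : (0 : 𝒞) ⟶ P₂)
  fibration_e : Fibration e
  weakEquivalence_e : WeakEquivalence e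
  cofibrant_E : IsCofibrant E
  fibration_p₁ : Fibration p₁
  cofibration_P₁ : Cofibration (0 : (0 : 𝒞) ⟶ P₁)
  weakEquivalence_P₁ : WeakEquivalence (0 : (0 : 𝒞) ⟶ P₁)
  fibration_x₁ : Fibration x₁
  weakEquivalence_x₁ : WeakEquivalence x₁
  fibration_x₂ : Fibration x₂
  weakEquivalence_x₂ : WeakEquivalence x₂
  cofibrant_X₂ : IsCofibrant X₂
  cofibration_d₂ : Cofibration d₂

namespace FiberData

attribute [instance] fibration_p₂ cofibration_P₂ weakEquivalence_P₂ fibration_e weakEquivalence_e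
  cofibrant_E fibration_p₁ cofibration_P₁ weakEquivalence_P₁ fibration_x₁ weakEquivalence_x₁
  fibration_x₂ weakEquivalence_x₂ cofibrant_X₂ cofibration_d₂

/-- `P₂` and `P₁` play the role of path objects, `E` resolves the homotopy fiber of `F₁ ⟶ F₂`, `X₁`
that of `F₀ ⟶ F₁`, and `X₂` the loops on `E`. Using `P₁ ⟶ E` for `X₂` and its composite to `F₁` for
`X₁` gives a map `X₂ ⟶ X₁` whose composite to `F₀` is strictly zero. It is arranged to be a
cofibration so that later lifts can be made relative to it. -/
lemma nonempty (F : ThreeStage 𝒞) : Nonempty (FiberData F) := by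
  obtain ⟨A₂⟩ : Nonempty (MorphismProperty.MapFactorizationData (trivialCofibrations 𝒞)
    (fibrations 𝒞) (0 : (0 : 𝒞) ⟶ F.X₂)) := ⟨MorphismProperty.factorizationData _ _ _⟩
  let e := CofibrantObject.HoCat.pResolutionObj (pullback F.i₂ A₂.p)
  obtain ⟨A₁⟩ : Nonempty (MorphismProperty.MapFactorizationData (trivialCofibrations 𝒞)
    (fibrations 𝒞) (0 : (0 : 𝒞) ⟶ CofibrantObject.HoCat.resolutionObj (pullback F.i₂ A₂.p))) :=
      ⟨MorphismProperty.factorizationData _ _ _⟩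
  let x₂ := CofibrantObject.HoCat.pResolutionObj (pullback (0 : (0 : 𝒞) ⟶ _) A₁.p)
  obtain ⟨B⟩ : Nonempty (MorphismProperty.MapFactorizationData (cofibrations 𝒞)
    (trivialFibrations 𝒞) (pullback.lift 0 (x₂ ≫ pullback.snd _ _) (by
      rw [zero_comp, Category.assoc, ← pullback.condition_assoc, zero_comp, comp_zero, comp_zero]) :
        _ ⟶ pullback F.i₁ (A₁.p ≫ e ≫ pullback.fst F.i₂ A₂.p))) :=
      ⟨MorphismProperty.factorizationData _ _ _⟩
  have h₂ : (0 : (0 : 𝒞) ⟶ A₂.Z) = A₂.i := (isZero_zero 𝒞).eq_of_src _ _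
  have h₁ : (0 : (0 : 𝒞) ⟶ A₁.Z) = A₁.i := (isZero_zero 𝒞).eq_of_src _ _
  exact ⟨{
    P₂ := A₂.Z
    p₂ := A₂.p
    E := _
    e := e
    P₁ := A₁.Z
    p₁ := A₁.p
    X₁ := B.Z
    x₁ := B.p
    X₂ := _
    x₂ := x₂
    d₂ := B.i
    comp_fst := by rw [B.fac_assoc, pullback.lift_fst]
    comp_snd := by rw [B.fac_assoc, pullback.lift_snd]
    fibration_p₂ := inferInstance
    cofibration_P₂ := by rw [h₂]; infer_instance
    weakEquivalence_P₂ := by rw [h₂]; infer_instance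
    fibration_e := inferInstance
    weakEquivalence_e := inferInstance
    cofibrant_E := inferInstance
    fibration_p₁ := inferInstance
    cofibration_P₁ := by rw [h₁]; infer_instance
    weakEquivalence_P₁ := by rw [h₁]; infer_instance
    fibration_x₁ := inferInstance
    weakEquivalence_x₁ := inferInstance
    fibration_x₂ := inferInstance
    weakEquivalence_x₂ := inferInstance
    cofibrant_X₂ := inferInstance
    cofibration_d₂ := inferInstance }⟩

section

variable {F : ThreeStage 𝒞} (D : FiberData F)

instance : IsCofibrant D.X₁ := isCofibrant_of_cofibration D.d₂

lemma isZero_P₁ : IsZero ((toHo 𝒞).obj D.P₁) :=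
  isZero_toHo_of_weakEquivalence (0 : (0 : 𝒞) ⟶ D.P₁) isZero_toHo_zero

lemma isZero_P₂ : IsZero ((toHo 𝒞).obj D.P₂) :=
  isZero_toHo_of_weakEquivalence (0 : (0 : 𝒞) ⟶ D.P₂) isZero_toHo_zero

/-- The map from the homotopy fiber of `F₁ ⟶ F₂` to `F₁`. -/
noncomputable def s : D.E ⟶ F.X₁ := D.e ≫ pullback.fst _ _

/-- The nullhomotopy of the composite of `s` with `F₁ ⟶ F₂`. -/
noncomputable def t : D.E ⟶ D.P₂ := D.e ≫ pullback.snd _ _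

lemma s_i₂ : D.s ≫ F.i₂ = D.t ≫ D.p₂ := by
  rw [s, t, Category.assoc, pullback.condition, Category.assoc]

/-- The map from the homotopy fiber of `F₀ ⟶ F₁` to `F₀`. -/
noncomputable def d₁ : D.X₁ ⟶ F.X₀ := D.x₁ ≫ pullback.fst _ _

/-- The nullhomotopy of the composite of `d₁` with `F₀ ⟶ F₁`. -/
noncomputable def y₁ : D.X₁ ⟶ D.P₁ := D.x₁ ≫ pullback.snd _ _

lemma d₁_i₁ : D.d₁ ≫ F.i₁ = D.y₁ ≫ D.p₁ ≫ D.s := by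
  rw [d₁, y₁, s, Category.assoc, pullback.condition, Category.assoc]

lemma d₂_d₁ : D.d₂ ≫ D.d₁ = 0 := D.comp_fst

lemma d₂_y₁ : D.d₂ ≫ D.y₁ = D.x₂ ≫ pullback.snd _ _ := D.comp_snd

lemma d₂_y₁_p₁ : D.d₂ ≫ D.y₁ ≫ D.p₁ = 0 := by
  rw [← Category.assoc, d₂_y₁, Category.assoc, ← pullback.condition, comp_zero, comp_zero]

variable [F.IsStagewiseFibrant]

instance : Fibration D.s := by
  unfold s
  infer_instance

instance : IsFibrant D.E := isFibrant_of_fibration D.s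

instance : IsFibrant D.P₁ := isFibrant_of_fibration D.p₁

instance : IsFibrant D.P₂ := isFibrant_of_fibration D.p₂

instance : IsFibrant D.X₁ := isFibrant_of_fibration (D.x₁ ≫ pullback.fst _ _)

instance : IsFibrant D.X₂ :=
  have : IsFibrant (0 : 𝒞) := inferInstance
  isFibrant_of_fibration (D.x₂ ≫ pullback.fst _ _)

/-- The strict complex of iterated homotopy fibers. -/
noncomputable abbrev complex : CoherentComplex 𝒞 where
  X₀ := F.X₀
  X₁ := D.X₁
  X₂ := D.X₂
  cofibrant₀ := inferInstance
  cofibrant₁ := inferInstance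
  cofibrant₂ := inferInstance
  fibrant₀ := inferInstance
  fibrant₁ := inferInstance
  fibrant₂ := inferInstance
  d₁ := D.d₁
  d₂ := D.d₂
  N := 0
  hN := by rw [comp_zero, D.d₂_d₁]

/-- An extension of `y₁` to the cone. -/
noncomputable def n₁ : cone D.X₁ ⟶ D.P₁ :=
  (exists_extension (coneι D.X₁) (trivialFibration_of_isZero_toHo D.isZero_P₁) D.y₁).choose

@[simp]
lemma coneι_n₁ : coneι D.X₁ ≫ D.n₁ = D.y₁ :=
  (exists_extension (coneι D.X₁) (trivialFibration_of_isZero_toHo D.isZero_P₁) D.y₁).choose_spec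

@[simp]
lemma coneι_n₁_assoc {Z : 𝒞} (g : D.P₁ ⟶ Z) : coneι D.X₁ ≫ D.n₁ ≫ g = D.y₁ ≫ g := by
  rw [← Category.assoc, coneι_n₁]

/-- The map from the suspension of `X₂` to the homotopy fiber of `F₁ ⟶ F₂`. -/
noncomputable def σ : suspObj D.X₂ ⟶ D.E :=
  cokernel.desc _ ((coneMap D.d₂ ≫ D.n₁) ≫ D.p₁) (by
    rw [Category.assoc, coneι_coneMap_assoc, coneι_n₁_assoc, d₂_y₁_p₁])

/-- The composite of `σ` with the collapse of the double cone. -/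
noncomputable def ε : dblCone D.X₂ ⟶ D.E := dblConeπ D.X₂ ≫ D.σ

lemma inl_ε : pushout.inl _ _ ≫ D.ε = 0 := by
  rw [ε, pushout.inl_desc_assoc, zero_comp]

lemma inr_ε : pushout.inr _ _ ≫ D.ε = (coneMap D.d₂ ≫ D.n₁) ≫ D.p₁ := by
  rw [ε, pushout.inr_desc_assoc, σ, cokernel.π_desc]

/-- An extension of the nullhomotopy `t` to the cone. -/
noncomputable def n₂ : cone (dblCone D.X₂) ⟶ D.P₂ :=
  (exists_extension (coneι _) (trivialFibration_of_isZero_toHo D.isZero_P₂) (D.ε ≫ D.t)).choose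

@[simp]
lemma coneι_n₂ : coneι _ ≫ D.n₂ = D.ε ≫ D.t :=
  (exists_extension (coneι _) (trivialFibration_of_isZero_toHo D.isZero_P₂)
    (D.ε ≫ D.t)).choose_spec

/-- An extension of the nullhomotopy `t` to the cone of the homotopy fiber. -/
noncomputable def q : cone D.E ⟶ D.P₂ :=
  (exists_extension (coneι _) (trivialFibration_of_isZero_toHo D.isZero_P₂) D.t).choose

@[simp]
lemma coneι_q : coneι _ ≫ D.q = D.t :=
  (exists_extension (coneι _) (trivialFibration_of_isZero_toHo D.isZero_P₂) D.t).choose_spec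

/-- The map from the mapping cone of `X₁ ⟶ F₀` to `F₁`. -/
noncomputable def m₁ : D.complex.mappingCone ⟶ F.X₁ :=
  pushout.desc F.i₁ (D.n₁ ≫ D.p₁ ≫ D.s) (by rw [coneι_n₁_assoc, D.d₁_i₁])

/-- As the complex has `N = 0`, the attaching map reaches `F₁` through the homotopy fiber `E`. Its
nullhomotopy in `F₂` is therefore the one provided by `P₂`, which fills in the third stage. -/
lemma attach_m₁ : D.complex.attach ≫ D.m₁ = D.ε ≫ D.s := by
  apply pushout.hom_ext
  · rw [← Category.assoc, ← Category.assoc, inl_ε, zero_comp]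
    refine (congrArg (· ≫ D.m₁) (pushout.inl_desc _ _ _)).trans ?_
    exact (congrArg (· ≫ D.m₁) zero_comp).trans zero_comp
  · rw [← Category.assoc, ← Category.assoc, inr_ε]
    refine (congrArg (· ≫ D.m₁) (pushout.inr_desc _ _ _)).trans ?_
    refine (Category.assoc _ _ _).trans ?_
    refine (congrArg (coneMap D.d₂ ≫ ·) (pushout.inr_desc _ _ _)).trans ?_
    simp only [Category.assoc]

lemma attach_m₁_i₂ : (D.complex.attach ≫ D.m₁) ≫ F.i₂ = (D.ε ≫ D.t) ≫ D.p₂ := by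
  rw [attach_m₁, Category.assoc, s_i₂, Category.assoc]

/-- The comparison of the total object of the complex of homotopy fibers with `F`. -/
noncomputable def totMap : ThreeStage.Hom D.complex.tot F where
  f₀ := 𝟙 _
  f₁ := D.m₁
  f₂ := pushout.desc (D.m₁ ≫ F.i₂) (D.n₂ ≫ D.p₂) (by
    rw [← Category.assoc, attach_m₁_i₂, ← coneι_n₂]
    exact Category.assoc _ _ _)
  comm₁ := (pushout.inl_desc _ _ _).trans (Category.id_comp _).symm
  comm₂ := pushout.inl_desc _ _ _

end

end FiberData

end

end StableTot

namespace StableTot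

/-! ### Comparison of the total object with the filtered object, and its naturality -/

section

variable {𝒞 : Type u} [Category.{v} 𝒞] [HasZeroMorphisms 𝒞] [HasZeroObject 𝒞] [ModelCategory 𝒞]

lemma toHo_cokernelDesc_eq_of_factor {X Q B : 𝒞} [IsFibrant Q]
    (hQ : IsZero ((toHo 𝒞).obj Q)) (s t : cone X ⟶ Q) (p : Q ⟶ B)
    (hst : coneι X ≫ s = coneι X ≫ t) (hs : coneι X ≫ s ≫ p = 0) (ht : coneι X ≫ t ≫ p = 0) :
    (toHo 𝒞).map (cokernel.desc (coneι X) (s ≫ p) hs) =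
      (toHo 𝒞).map (cokernel.desc (coneι X) (t ≫ p) ht) := by
  have h := toHo_cokernelMap_eq (coneι X) (coneι X ≫ s) (trivialFibration_of_isZero_toHo hQ) (𝟙 X)
    s t (by simp) (by simp [hst])
  have e : ∀ u : cone X ⟶ Q, ∀ (hu : coneι X ≫ u = coneι X ≫ s) (hu' : coneι X ≫ u ≫ p = 0),
      cokernel.desc (coneι X) (u ≫ p) hu' =
      cokernel.map (coneι X) (coneι X ≫ s) (𝟙 X) u (by simp [hu]) ≫
        cokernel.desc (coneι X ≫ s) p (by simp [hs]) := by
    intro u hu hu'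
    apply cokernel_hom_ext
    simp
  rw [e s rfl, e t hst.symm, Functor.map_comp, Functor.map_comp, h]

namespace FiberData

section

variable {F : ThreeStage 𝒞} (D : FiberData F) [F.IsStagewiseFibrant]

lemma suspToGr₁_totMap : D.complex.suspToGr₁ ≫ D.totMap.gr₁ =
    cokernel.map (coneι D.X₁) F.i₁ D.d₁ (D.n₁ ≫ D.p₁ ≫ D.s)
      (by rw [coneι_n₁_assoc, D.d₁_i₁]) := by
  apply cokernel_hom_ext
  rw [π_cokernelMap]
  refine (D.complex.π_suspToGr₁_gr₁ _).trans ?_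
  exact congrArg (· ≫ cokernel.π F.i₁) (pushout.inr_desc _ _ _)

lemma coneι_n₂_p₂ : coneι _ ≫ D.n₂ ≫ D.p₂ = (D.ε ≫ D.s) ≫ F.i₂ := by
  rw [← Category.assoc, coneι_n₂, Category.assoc, Category.assoc, s_i₂]

lemma suspToGr₂_totMap : D.complex.suspToGr₂ ≫ D.totMap.gr₂ =
    cokernel.map (coneι (dblCone D.X₂)) F.i₂ (D.ε ≫ D.s) (D.n₂ ≫ D.p₂) D.coneι_n₂_p₂ := by
  apply cokernel_hom_ext
  rw [π_cokernelMap]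
  refine (D.complex.π_suspToGr₂_gr₂ _).trans ?_
  exact congrArg (· ≫ cokernel.π F.i₂) (pushout.inr_desc _ _ _)

/-- The map from the suspension of the homotopy fiber of `F₁ ⟶ F₂` to `F₂ / F₁`. -/
noncomputable def κ : suspObj D.E ⟶ F.gr₂ :=
  cokernel.map (coneι D.E) F.i₂ D.s (D.q ≫ D.p₂) (by rw [← Category.assoc, coneι_q, s_i₂])

/-- The choice of `n₂` is immaterial: it and the extension induced by `q` agree on the base and land
in the contractible `P₂`. The form with `κ` is the one that is natural in the fiber data. -/
lemma toHo_suspToGr₂_totMap :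
    (toHo 𝒞).map (D.complex.suspToGr₂ ≫ D.totMap.gr₂) = (toHo 𝒞).map (suspMap D.ε ≫ D.κ) := by
  rw [suspToGr₂_totMap]
  have := toHo_cokernelMap_eq_of_factor D.isZero_P₂ F.i₂ (D.ε ≫ D.s) D.n₂ (coneMap D.ε ≫ D.q) D.p₂
    (by simp) D.coneι_n₂_p₂ (by
      rw [Category.assoc, coneι_coneMap_assoc, ← Category.assoc (coneι D.E), coneι_q,
        Category.assoc, s_i₂])
  rw [this]
  congr 1
  apply cokernel_hom_ext
  rw [π_cokernelMap, π_suspMap_assoc, κ, π_cokernelMap]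
  simp only [Category.assoc]

variable [StableModelCategory 𝒞]

/-- `X₂` is the homotopy fiber of `0 ⟶ E`, and the mapping cone of `X₂ ⟶ 0` is `ΣX₂`: in the stable
setting the suspension of the loops on `E` is `E`. -/
instance : WeakEquivalence D.σ := by
  have sq : (0 : D.X₂ ⟶ (0 : 𝒞)) ≫ (0 : (0 : 𝒞) ⟶ D.E) = (D.x₂ ≫ pullback.snd _ _) ≫ D.p₁ := by
    rw [Category.assoc, ← pullback.condition, comp_zero, comp_zero, comp_zero]
  have e : pullback.lift 0 (D.x₂ ≫ pullback.snd _ _) sq = D.x₂ := by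
    apply pullback.hom_ext
    · exact (isZero_zero 𝒞).eq_of_tgt _ _
    · rw [pullback.lift_snd]
  have : WeakEquivalence (pullback.lift 0 (D.x₂ ≫ pullback.snd _ _) sq) := by
    rw [e]
    infer_instance
  have := weakEquivalence_mappingCone_homotopyFiber (0 : (0 : 𝒞) ⟶ D.E) D.p₁ D.isZero_P₁
    (0 : D.X₂ ⟶ (0 : 𝒞)) (D.x₂ ≫ pullback.snd _ _) sq (coneMap D.d₂ ≫ D.n₁)
    (by rw [coneι_coneMap_assoc, coneι_n₁, d₂_y₁])
  have := weakEquivalence_pushoutDesc_zero_π (0 : D.X₂ ⟶ (0 : 𝒞)) (coneι D.X₂) isZero_toHo_zero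
  refine weakEquivalence_of_precomp_of_fac (f := (pushout.desc 0 (cokernel.π (coneι D.X₂))
    _ : pushout (0 : D.X₂ ⟶ (0 : 𝒞)) (coneι D.X₂) ⟶ _)) (fg := pushout.desc 0
      ((coneMap D.d₂ ≫ D.n₁) ≫ D.p₁) _) ?_
  apply pushout.hom_ext
  · exact (isZero_zero 𝒞).eq_of_src _ _
  · rw [pushout.inr_desc_assoc, pushout.inr_desc, σ, cokernel.π_desc]

instance : WeakEquivalence D.ε := by
  unfold ε
  infer_instance

/-- `X₁` is the homotopy fiber of `F₀ ⟶ F₁`, and through `ε` the double cone of `X₂` is that of `F₁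
⟶ F₂`. Both higher subquotients are thus cases of `weakEquivalence_mappingCone_homotopyFiber`. -/
lemma isWeakEquivalence_totMap : D.totMap.IsWeakEquivalence := by
  refine D.totMap.isWeakEquivalence_of_gr ?_ ?_ ?_
  · exact (inferInstance : WeakEquivalence (𝟙 F.X₀))
  · have e : pullback.lift D.d₁ D.y₁ D.d₁_i₁ = D.x₁ := by
      apply pullback.hom_ext
      · exact pullback.lift_fst _ _ _
      · exact pullback.lift_snd _ _ _
    have : WeakEquivalence (pullback.lift D.d₁ D.y₁ D.d₁_i₁) := by
      rw [e]
      exact D.weakEquivalence_x₁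
    have := weakEquivalence_mappingCone_homotopyFiber F.i₁ (D.p₁ ≫ D.s) D.isZero_P₁ D.d₁ D.y₁
      D.d₁_i₁ D.n₁ D.coneι_n₁
    have := weakEquivalence_suspObj_cokernel_of_mappingCone D.d₁ F.i₁ (D.n₁ ≫ D.p₁ ≫ D.s)
      (by rw [coneι_n₁_assoc, D.d₁_i₁])
    exact weakEquivalence_of_precomp_of_fac D.suspToGr₁_totMap
  · have sq : (D.ε ≫ D.s) ≫ F.i₂ = (D.ε ≫ D.t) ≫ D.p₂ := by
      rw [Category.assoc, s_i₂, Category.assoc]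
    have e : pullback.lift (D.ε ≫ D.s) (D.ε ≫ D.t) sq = D.ε ≫ D.e := by
      apply pullback.hom_ext
      · rw [pullback.lift_fst, s, Category.assoc]
      · rw [pullback.lift_snd, t, Category.assoc]
    have : WeakEquivalence (pullback.lift (D.ε ≫ D.s) (D.ε ≫ D.t) sq) := by
      rw [e]
      infer_instance
    have := weakEquivalence_mappingCone_homotopyFiber F.i₂ D.p₂ D.isZero_P₂ (D.ε ≫ D.s)
      (D.ε ≫ D.t) sq D.n₂ D.coneι_n₂
    have := weakEquivalence_suspObj_cokernel_of_mappingCone (D.ε ≫ D.s) F.i₂ (D.n₂ ≫ D.p₂)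
      D.coneι_n₂_p₂
    exact weakEquivalence_of_precomp_of_fac D.suspToGr₂_totMap

end

lemma exists_lift {F : ThreeStage 𝒞} (D : FiberData F) {A B : 𝒞} (j : A ⟶ B) [Cofibration j]
    (a : A ⟶ D.X₁) (b : B ⟶ F.X₀) (c : B ⟶ D.P₁) (h : b ≫ F.i₁ = c ≫ D.p₁ ≫ D.s)
    (hb : a ≫ D.d₁ = j ≫ b) (hc : a ≫ D.y₁ = j ≫ c) :
    ∃ l : B ⟶ D.X₁, j ≫ l = a ∧ l ≫ D.d₁ = b ∧ l ≫ D.y₁ = c := by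
  change b ≫ F.i₁ = c ≫ D.p₁ ≫ D.e ≫ pullback.fst _ _ at h
  have sq : CommSq a j D.x₁ (pullback.lift b c h) := by
    constructor
    apply pullback.hom_ext
    · refine (Category.assoc _ _ _).trans (hb.trans ?_)
      rw [Category.assoc, pullback.lift_fst]
    · refine (Category.assoc _ _ _).trans (hc.trans ?_)
      rw [Category.assoc, pullback.lift_snd]
  refine ⟨sq.lift, sq.fac_left, ?_, ?_⟩
  · refine (Category.assoc _ _ _).symm.trans ?_
    rw [sq.fac_right]
    exact pullback.lift_fst _ _ _
  · refine (Category.assoc _ _ _).symm.trans ?_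
    rw [sq.fac_right]
    exact pullback.lift_snd _ _ _

/-- A strict map of iterated homotopy fibers. -/
structure Hom {F F' : ThreeStage 𝒞} (D : FiberData F) (D' : FiberData F')
    (φ : ThreeStage.Hom F F') where
  fP₂ : D.P₂ ⟶ D'.P₂
  fE : D.E ⟶ D'.E
  fP₁ : D.P₁ ⟶ D'.P₁
  f₁ : D.X₁ ⟶ D'.X₁
  f₂ : D.X₂ ⟶ D'.X₂
  fP₂_p₂ : fP₂ ≫ D'.p₂ = D.p₂ ≫ φ.f₂
  fE_s : fE ≫ D'.s = D.s ≫ φ.f₁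
  fE_t : fE ≫ D'.t = D.t ≫ fP₂
  fP₁_p₁ : fP₁ ≫ D'.p₁ = D.p₁ ≫ fE
  f₁_d₁ : f₁ ≫ D'.d₁ = D.d₁ ≫ φ.f₀
  f₁_y₁ : f₁ ≫ D'.y₁ = D.y₁ ≫ fP₁
  f₂_d₂ : f₂ ≫ D'.d₂ = D.d₂ ≫ f₁

namespace Hom

variable {F F' : ThreeStage 𝒞} {D : FiberData F} {D' : FiberData F'} {φ : ThreeStage.Hom F F'}

/-- Lifting properties give the maps in the order `P₂`, `E`, `P₁`, `X₂`, `X₁`. The last is lifted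
relative to the cofibration `d₂`, so that the squares commute strictly; this is what makes the Toda
class vanish. -/
lemma nonempty (D : FiberData F) (D' : FiberData F') (φ : ThreeStage.Hom F F') :
    Nonempty (Hom D D' φ) := by
  have sq₁ : CommSq (0 : (0 : 𝒞) ⟶ D'.P₂) (0 : (0 : 𝒞) ⟶ D.P₂) D'.p₂ (D.p₂ ≫ φ.f₂) := ⟨by simp⟩
  have sqE : CommSq (initial.to _) (initial.to D.E) D'.e (pullback.lift (D.s ≫ φ.f₁)
    (D.t ≫ sq₁.lift) (by
      rw [Category.assoc, ← φ.comm₂, ← Category.assoc, s_i₂, Category.assoc, Category.assoc,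
        sq₁.fac_right])) := { }
  have sq₂ : CommSq (0 : (0 : 𝒞) ⟶ D'.P₁) (0 : (0 : 𝒞) ⟶ D.P₁) D'.p₁ (D.p₁ ≫ sqE.lift) :=
    ⟨by simp⟩
  have hE : sqE.lift ≫ D'.s = D.s ≫ φ.f₁ := by
    change sqE.lift ≫ D'.e ≫ pullback.fst _ _ = _
    rw [← Category.assoc, sqE.fac_right, pullback.lift_fst]
  have sq₃ : CommSq (initial.to _) (initial.to D.X₂) D'.x₂ (pullback.lift 0
    ((D.x₂ ≫ pullback.snd _ _) ≫ sq₂.lift) (by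
      rw [zero_comp, Category.assoc, sq₂.fac_right, Category.assoc, ← pullback.condition_assoc,
        zero_comp, comp_zero, comp_zero])) := { }
  have h₀ : (D.d₁ ≫ φ.f₀) ≫ F'.i₁ = (D.y₁ ≫ sq₂.lift) ≫ D'.p₁ ≫ D'.s := by
    rw [Category.assoc D.y₁, ← Category.assoc sq₂.lift, sq₂.fac_right, Category.assoc D.p₁, hE,
      Category.assoc, ← φ.comm₁, ← Category.assoc, D.d₁_i₁]
    simp only [Category.assoc]
  have h₁ : (sq₃.lift ≫ D'.d₂) ≫ D'.y₁ = D.d₂ ≫ D.y₁ ≫ sq₂.lift := by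
    rw [Category.assoc, D'.d₂_y₁, ← Category.assoc, sq₃.fac_right, pullback.lift_snd, ← D.d₂_y₁,
      Category.assoc]
  have h₂ : (sq₃.lift ≫ D'.d₂) ≫ D'.d₁ = D.d₂ ≫ D.d₁ ≫ φ.f₀ := by
    rw [Category.assoc, D'.d₂_d₁, comp_zero, ← Category.assoc, D.d₂_d₁, zero_comp]
  obtain ⟨l, hl, hl₁, hl₂⟩ := D'.exists_lift D.d₂ (sq₃.lift ≫ D'.d₂) (D.d₁ ≫ φ.f₀)
    (D.y₁ ≫ sq₂.lift) h₀ h₂ h₁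
  refine ⟨sq₁.lift, sqE.lift, sq₂.lift, l, sq₃.lift, sq₁.fac_right, hE, ?_, sq₂.fac_right, hl₁,
    hl₂, hl.symm⟩
  change sqE.lift ≫ D'.e ≫ pullback.snd _ _ = _
  rw [← Category.assoc, sqE.fac_right, pullback.lift_snd]

variable [F.IsStagewiseFibrant] [F'.IsStagewiseFibrant] (f : Hom D D' φ)

include f

/-- The two sides come from two extensions of the same map to the contractible `D'.P₁`, hence agree
modulo the base. -/
lemma toHo_gr₁ : (toHo 𝒞).map (D.complex.suspToGr₁ ≫ (D.totMap.comp φ).gr₁) =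
    (toHo 𝒞).map (suspMap f.f₁ ≫ D'.complex.suspToGr₁ ≫ D'.totMap.gr₁) := by
  rw [ThreeStage.Hom.comp_gr₁, ← Category.assoc, suspToGr₁_totMap, suspToGr₁_totMap]
  have h₁ : coneι D.X₁ ≫ (D.n₁ ≫ f.fP₁) ≫ D'.p₁ ≫ D'.s = (D.d₁ ≫ φ.f₀) ≫ F'.i₁ := by
    rw [Category.assoc, coneι_n₁_assoc, ← Category.assoc f.fP₁, f.fP₁_p₁, Category.assoc,
      f.fE_s, Category.assoc, ← φ.comm₁, ← Category.assoc D.d₁, d₁_i₁]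
    simp only [Category.assoc]
  have h₂ : coneι D.X₁ ≫ (D.n₁ ≫ f.fP₁) = coneι D.X₁ ≫ coneMap f.f₁ ≫ D'.n₁ := by
    rw [coneι_n₁_assoc, coneι_coneMap_assoc, coneι_n₁, f.f₁_y₁]
  have h₃ : coneι D.X₁ ≫ (coneMap f.f₁ ≫ D'.n₁) ≫ D'.p₁ ≫ D'.s = (D.d₁ ≫ φ.f₀) ≫ F'.i₁ := by
    rw [← h₁, ← Category.assoc, ← h₂, Category.assoc]
  have := toHo_cokernelMap_eq_of_factor D'.isZero_P₁ F'.i₁ (D.d₁ ≫ φ.f₀) (D.n₁ ≫ f.fP₁)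
    (coneMap f.f₁ ≫ D'.n₁) (D'.p₁ ≫ D'.s) h₂ h₁ h₃
  convert this using 2
  · apply cokernel_hom_ext
    rw [π_cokernelMap_assoc, π_cokernelMap, π_cokernelMap]
    simp only [Category.assoc]
    rw [← Category.assoc f.fP₁, f.fP₁_p₁, Category.assoc, ← Category.assoc f.fE, f.fE_s,
      Category.assoc]
  · apply cokernel_hom_ext
    rw [π_suspMap_assoc, π_cokernelMap, π_cokernelMap]
    simp only [Category.assoc]

lemma toHo_σ : (toHo 𝒞).map (D.σ ≫ f.fE) = (toHo 𝒞).map (suspMap f.f₂ ≫ D'.σ) := by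
  have h₂ : coneι D.X₂ ≫ coneMap D.d₂ ≫ D.n₁ ≫ f.fP₁ =
      coneι D.X₂ ≫ coneMap f.f₂ ≫ coneMap D'.d₂ ≫ D'.n₁ := by
    rw [coneι_coneMap_assoc, coneι_coneMap_assoc, coneι_coneMap_assoc, coneι_n₁_assoc, coneι_n₁,
      ← f.f₁_y₁, ← Category.assoc, ← f.f₂_d₂, Category.assoc]
  have h₁ : coneι D.X₂ ≫ (coneMap f.f₂ ≫ coneMap D'.d₂ ≫ D'.n₁) ≫ D'.p₁ = 0 := by
    rw [Category.assoc, Category.assoc, coneι_coneMap_assoc, coneι_coneMap_assoc, coneι_n₁_assoc,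
      d₂_y₁_p₁, comp_zero]
  have := toHo_cokernelDesc_eq_of_factor D'.isZero_P₁ (coneMap D.d₂ ≫ D.n₁ ≫ f.fP₁)
    (coneMap f.f₂ ≫ coneMap D'.d₂ ≫ D'.n₁) D'.p₁ h₂
    (by rw [← Category.assoc, h₂, Category.assoc, h₁]) h₁
  convert this using 2
  · apply cokernel_hom_ext
    rw [σ, cokernel.π_desc_assoc, cokernel.π_desc]
    simp only [Category.assoc]
    rw [f.fP₁_p₁]
  · apply cokernel_hom_ext
    rw [π_suspMap_assoc, σ, cokernel.π_desc, cokernel.π_desc]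
    simp only [Category.assoc]

lemma toHo_κ : (toHo 𝒞).map (D.κ ≫ φ.gr₂) = (toHo 𝒞).map (suspMap f.fE ≫ D'.κ) := by
  have h₁ : coneι D.E ≫ (D.q ≫ f.fP₂) ≫ D'.p₂ = (D.s ≫ φ.f₁) ≫ F'.i₂ := by
    rw [Category.assoc, f.fP₂_p₂, ← Category.assoc D.q, ← Category.assoc, ← Category.assoc, coneι_q,
      ← s_i₂, Category.assoc, Category.assoc, φ.comm₂]
  have h₂ : coneι D.E ≫ D.q ≫ f.fP₂ = coneι D.E ≫ coneMap f.fE ≫ D'.q := by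
    rw [coneι_coneMap_assoc, coneι_q, f.fE_t, ← Category.assoc, coneι_q]
  have := toHo_cokernelMap_eq_of_factor D'.isZero_P₂ F'.i₂ (D.s ≫ φ.f₁) (D.q ≫ f.fP₂)
    (coneMap f.fE ≫ D'.q) D'.p₂ h₂ h₁ (by rw [← h₁, ← Category.assoc, ← h₂, Category.assoc])
  convert this using 2
  · apply cokernel_hom_ext
    rw [κ, π_cokernelMap_assoc, π_cokernelMap, π_cokernelMap]
    simp only [Category.assoc]
    rw [← Category.assoc f.fP₂, f.fP₂_p₂, Category.assoc]
  · apply cokernel_hom_ext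
    rw [π_suspMap_assoc, κ, π_cokernelMap, π_cokernelMap]
    simp only [Category.assoc]

/-- Naturality is split at `E`: `toHo_σ` compares the double cones with the homotopy fibers, and
`toHo_κ` compares the homotopy fibers with `F₂ / F₁`. -/
lemma toHo_gr₂ : (toHo 𝒞).map (D.complex.suspToGr₂ ≫ (D.totMap.comp φ).gr₂) =
    (toHo 𝒞).map (suspMap (dblConeMap f.f₂) ≫ D'.complex.suspToGr₂ ≫ D'.totMap.gr₂) := by
  have h : (toHo 𝒞).map (D.ε ≫ f.fE) = (toHo 𝒞).map (dblConeMap f.f₂ ≫ D'.ε) := by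
    rw [ε, ε, ← Category.assoc (dblConeMap f.f₂), dblConeMap_dblConeπ, Category.assoc,
      Category.assoc, Functor.map_comp, f.toHo_σ, ← Functor.map_comp]
  rw [ThreeStage.Hom.comp_gr₂, ← Category.assoc, Functor.map_comp, toHo_suspToGr₂_totMap,
    ← Functor.map_comp, Category.assoc, Functor.map_comp, f.toHo_κ, Functor.map_comp,
    ← Category.assoc, ← toHo_suspMap_comp, toHo_suspMap_congr h, toHo_suspMap_comp,
    Functor.map_comp (toHo 𝒞) (suspMap (dblConeMap f.f₂)), toHo_suspToGr₂_totMap, Functor.map_comp,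
    Category.assoc]

end Hom

end FiberData

end

end StableTot

namespace StableTot

/-! ### A filtered map makes the Toda bracket vanish -/

section

variable {𝒞 : Type u} [Category.{v} 𝒞] [HasZeroMorphisms 𝒞] [HasZeroObject 𝒞] [ModelCategory 𝒞]

/-- A formal cancellation, stated in an abstract category because it is needed at all three stages.
It transfers the prescribed effect `θ` of the filtered map `ψ` to the map `Φ` of the complexes. -/
lemma comp_eq_comp_of_agrees {H : Type*} [Category* H] {M M' F F' G G' A A' : H} {m : M ⟶ F}
    {m' : M' ⟶ F'} {ψ : F ⟶ F'} {j : G ⟶ F} {j' : G' ⟶ F'} [IsIso j'] {Φ : M ⟶ M'} (α : G ≅ A)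
    (β : G' ≅ A') {e : M ⟶ A} {e' : M' ⟶ A'} {θ : A ⟶ A'} (hm : m = (e ≫ α.inv) ≫ j)
    (hm' : m' = (e' ≫ β.inv) ≫ j') (hψ : j ≫ ψ = (α.hom ≫ θ ≫ β.inv) ≫ j')
    (hΦ : m ≫ ψ = Φ ≫ m') : Φ ≫ e' = e ≫ θ := by
  rw [← cancel_mono β.inv, ← cancel_mono j', Category.assoc, Category.assoc, ← Category.assoc e',
    ← hm', ← hΦ, hm, Category.assoc, hψ]
  simp

namespace HomotopySquares

/-- Strictly commutative squares, with constant homotopies. -/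
lemma exists_of_comm {K K' : CoherentComplex 𝒞} (φ₀ : K.X₀ ⟶ K'.X₀) (φ₁ : K.X₁ ⟶ K'.X₁)
    (φ₂ : K.X₂ ⟶ K'.X₂) (h₁ : φ₁ ≫ K'.d₁ = K.d₁ ≫ φ₀) (h₂ : φ₂ ≫ K'.d₂ = K.d₂ ≫ φ₁) :
    ∃ s : HomotopySquares K K', s.φ₀ = φ₀ ∧ s.φ₁ = φ₁ ∧ s.φ₂ = φ₂ ∧
      s.homotopy.h = (s.I₂.trans s.I₂').π ≫ K.d₂ ≫ K.d₁ ≫ s.φ₀ := by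
  obtain ⟨I₁, _⟩ := Cylinder.exists_very_good K.X₁
  obtain ⟨I₂, _⟩ := Cylinder.exists_very_good K.X₂
  have sq : CommSq (coprod.desc (K.d₂ ≫ I₁.i₀) (K.d₂ ≫ I₁.i₁)) I₂.i I₁.π (I₂.π ≫ K.d₂) := by
    constructor
    apply coprod.hom_ext
    · rw [coprod.inl_desc_assoc, Category.assoc, I₁.i₀_π, I₂.inl_i_assoc, I₂.i₀_π_assoc,
        Category.comp_id]
    · rw [coprod.inr_desc_assoc, Category.assoc, I₁.i₁_π, I₂.inr_i_assoc, I₂.i₁_π_assoc,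
        Category.comp_id]
  refine ⟨{
    φ₀ := φ₀
    φ₁ := φ₁
    φ₂ := φ₂
    I₁ := I₁
    I₂ := I₂
    I₂' := I₂
    good₁ := inferInstance
    good₂ := inferInstance
    good₂' := inferInstance
    J := sq.lift
    i₀_J := by rw [← I₂.inl_i, Category.assoc, sq.fac_left, coprod.inl_desc]
    i₁_J := by rw [← I₂.inr_i, Category.assoc, sq.fac_left, coprod.inr_desc]
    J_π := sq.fac_right
    H₁ :=
      { h := I₁.π ≫ K.d₁ ≫ φ₀
        h₀ := by simp
        h₁ := by simp [h₁] }
    H₂ :=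
      { h := I₂.π ≫ K.d₂ ≫ φ₁
        h₀ := by simp
        h₁ := by simp [h₂] } }, rfl, rfl, rfl, ?_⟩
  apply pushout.hom_ext
  · refine (pushout.inl_desc _ _ _).trans ?_
    refine Eq.trans ?_ (pushout.inl_desc_assoc _ _ _ _).symm
    exact (sq.fac_right_assoc _).trans (Category.assoc _ _ _)
  · refine (pushout.inr_desc _ _ _).trans ?_
    refine Eq.trans ?_ (pushout.inr_desc_assoc _ _ _ _).symm
    simp only [Category.assoc, h₁]

lemma isTodaClass_zero {K K' : CoherentComplex 𝒞} (s : HomotopySquares K K')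
    (h : s.homotopy.h = 0) (hN : K.N = 0) (hN' : K'.N = 0) : s.IsTodaClass 0 := by
  dsimp only [IsTodaClass, IsGluing]
  rw [comp_zero, comp_zero, ← toHo_map_zero]
  congr 1
  apply pushout.hom_ext
  · rw [pushout.inl_desc, h, comp_zero]
  · rw [pushout.inr_desc, hN, hN', zero_comp, comp_zero, comp_zero]
    apply coprod.hom_ext
    · rw [coprod.inl_desc, comp_zero]
    · rw [coprod.inr_desc, comp_zero]

end HomotopySquares

variable [StableModelCategory 𝒞]

instance isEquivalence_suspIter (k : ℕ) : (suspIter 𝒞 k).IsEquivalence := by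
  induction k with
  | zero => exact inferInstanceAs (𝟭 _).IsEquivalence
  | succ k ih => exact inferInstanceAs (suspIter 𝒞 k ⋙ susp 𝒞).IsEquivalence

/-- A filtered weak equivalence with a total object determines the maps of the complex. -/
lemma CoherentComplex.exists_isos (K : CoherentComplex 𝒞) {G : ThreeStage 𝒞}
    (g : ThreeStage.HoMap K.tot G) (hg : g.IsWeakEquivalence) {A₀ A₁ A₂ : Ho 𝒞}
    (α₀ : (toHo 𝒞).obj G.X₀ ≅ A₀) (α₁ : (toHo 𝒞).obj G.gr₁ ≅ (susp 𝒞).obj A₁)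
    (α₂ : (toHo 𝒞).obj G.gr₂ ≅ (susp 𝒞).obj ((susp 𝒞).obj A₂)) :
    ∃ (e₀ : (toHo 𝒞).obj K.X₀ ≅ A₀) (e₁ : (toHo 𝒞).obj K.X₁ ≅ A₁)
      (e₂ : (toHo 𝒞).obj K.X₂ ≅ A₂), g.AgreesWith (e₀.hom ≫ α₀.inv)
        (K.totGr₁ ≫ (susp 𝒞).map e₁.hom ≫ α₁.inv)
        (K.totGr₂ ≫ (susp 𝒞).map ((susp 𝒞).map e₂.hom) ≫ α₂.inv) := by
  have := g.hb.1
  have := toHo_isIso g.b.f₀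
  have := g.hb.gr₁
  have := toHo_isIso g.b.gr₁
  have := g.hb.gr₂
  have := toHo_isIso g.b.gr₂
  have hg₀ := hg.1
  let u : (toHo 𝒞).obj K.X₀ ⟶ (toHo 𝒞).obj g.Z.X₀ := (toHo 𝒞).map g.a.f₀
  have : IsIso u := toHo_isIso g.a.f₀
  have := ThreeStage.Hom.IsWeakEquivalence.gr₁ hg
  have := toHo_isIso g.a.gr₁
  have := ThreeStage.Hom.IsWeakEquivalence.gr₂ hg
  have := toHo_isIso g.a.gr₂
  let ε₀ : (toHo 𝒞).obj K.X₀ ≅ A₀ :=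
    asIso u ≪≫ (asIso ((toHo 𝒞).map g.b.f₀)).symm ≪≫ α₀
  let ε₁ : (susp 𝒞).obj ((toHo 𝒞).obj K.X₁) ≅ (susp 𝒞).obj A₁ := (asIso K.totGr₁).symm ≪≫
    asIso ((toHo 𝒞).map g.a.gr₁) ≪≫ (asIso ((toHo 𝒞).map g.b.gr₁)).symm ≪≫ α₁
  let ε₂ : (susp 𝒞).obj ((susp 𝒞).obj ((toHo 𝒞).obj K.X₂)) ≅ (susp 𝒞).obj ((susp 𝒞).obj A₂) :=
    (asIso K.totGr₂).symm ≪≫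
      asIso ((toHo 𝒞).map g.a.gr₂) ≪≫ (asIso ((toHo 𝒞).map g.b.gr₂)).symm ≪≫ α₂
  -- The isomorphisms on subquotients are forced up to `Σ` and `Σ²`, and full faithfulness removes
  -- the suspensions.
  refine ⟨ε₀, (susp 𝒞).preimageIso ε₁, (susp 𝒞).preimageIso ((susp 𝒞).preimageIso ε₂), ?_, ?_, ?_⟩
  · change u = ((u ≫ inv ((toHo 𝒞).map g.b.f₀) ≫ α₀.hom) ≫ α₀.inv) ≫ (toHo 𝒞).map g.b.f₀
    simp only [Category.assoc, Iso.hom_inv_id_assoc, IsIso.inv_hom_id, Category.comp_id]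
  · simp [ε₁]
  · simp [ε₂]

namespace Totalization

variable {C D : SimplicialObject (Ho 𝒞)} (S : Totalization C) (T : Totalization D)

open Simplicial

/-- The identification of the middle subquotient of `Gr³`. -/
noncomputable def gr3IsoSusp₁ (k : ℕ) :
    (toHo 𝒞).obj (S.gr3 k).gr₁ ≅ (susp 𝒞).obj ((suspIter 𝒞 k).obj (C _⦋k + 1⦌)) :=
  (toHo 𝒞).mapIso (S.gr3Iso₁ k) ≪≫ S.grIso (k + 1)

/-- The identification of the top subquotient of `Gr³`. -/
noncomputable def gr3IsoSusp₂ (k : ℕ) : (toHo 𝒞).obj (S.gr3 k).gr₂ ≅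
    (susp 𝒞).obj ((susp 𝒞).obj ((suspIter 𝒞 k).obj (C _⦋k + 2⦌))) :=
  (toHo 𝒞).mapIso (S.gr3Iso₂ k) ≪≫ S.grIso (k + 2)

variable {S T}

/-- The iterates `Σᵏ⁺¹` and `Σᵏ⁺²` are by definition suspensions of `Σᵏ`; in this form full
faithfulness of `Σ` can be applied. -/
lemma gr3MapAgrees_iff (f : C ⟶ D) (k : ℕ) (g : ThreeStage.HoMap (S.gr3 k) (T.gr3 k)) :
    S.Gr3MapAgrees T f k g ↔ g.AgreesWith
      ((S.grIso k).hom ≫ (suspIter 𝒞 k).map (f.app (op ⦋k⦌)) ≫ (T.grIso k).inv)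
      ((S.gr3IsoSusp₁ k).hom ≫ (susp 𝒞).map ((suspIter 𝒞 k).map (f.app (op ⦋k + 1⦌))) ≫
        (T.gr3IsoSusp₁ k).inv)
      ((S.gr3IsoSusp₂ k).hom ≫ (susp 𝒞).map ((susp 𝒞).map
        ((suspIter 𝒞 k).map (f.app (op ⦋k + 2⦌)))) ≫ (T.gr3IsoSusp₂ k).inv) := by
  have h₁ : (toHo 𝒞).map (S.gr3Iso₁ k).hom ≫
      ((S.grIso (k + 1)).hom ≫ (suspIter 𝒞 (k + 1)).map (f.app (op ⦋k + 1⦌)) ≫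
        (T.grIso (k + 1)).inv) ≫ (toHo 𝒞).map (T.gr3Iso₁ k).inv =
      (S.gr3IsoSusp₁ k).hom ≫ (susp 𝒞).map ((suspIter 𝒞 k).map (f.app (op ⦋k + 1⦌))) ≫
        (T.gr3IsoSusp₁ k).inv := by
    simp only [Category.assoc]
    exact (Category.assoc _ _ _).symm
  have h₂ : (toHo 𝒞).map (S.gr3Iso₂ k).hom ≫
      ((S.grIso (k + 2)).hom ≫ (suspIter 𝒞 (k + 2)).map (f.app (op ⦋k + 2⦌)) ≫
        (T.grIso (k + 2)).inv) ≫ (toHo 𝒞).map (T.gr3Iso₂ k).inv =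
      (S.gr3IsoSusp₂ k).hom ≫ (susp 𝒞).map ((susp 𝒞).map
        ((suspIter 𝒞 k).map (f.app (op ⦋k + 2⦌)))) ≫ (T.gr3IsoSusp₂ k).inv := by
    simp only [Category.assoc]
    exact (Category.assoc _ _ _).symm
  rw [Gr3MapAgrees, h₁, h₂]

/-- A strict map between stagewise fibrant models of `Gr³` shows that the Toda bracket vanishes. -/
lemma zero_mem_todaBracket_of_homMap (f : C ⟶ D) (k : ℕ)
    (g : ThreeStage.HoMap (S.gr3 k) (T.gr3 k)) (hg : S.Gr3MapAgrees T f k g) :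
    0 ∈ todaBracket S T f k := by
  rw [gr3MapAgrees_iff] at hg
  obtain ⟨a₀, a₁, a₂⟩ := hg
  -- Stagewise fibrant models `F`, `F'` of the two `Gr³` are chosen so that `g` becomes a strict map
  -- `φ : F ⟶ F'`.
  obtain ⟨F', κ, _, hκ, -⟩ := g.Z.exists_fibrantReplacement
  obtain ⟨F, j, _, hj, hext⟩ := (S.gr3 k).exists_fibrantReplacement
  obtain ⟨φ, hφ⟩ := hext F' (g.a.comp κ)
  have hj' : (g.b.comp κ).IsWeakEquivalence := g.hb.comp hκ
  obtain ⟨A⟩ := FiberData.nonempty F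
  obtain ⟨B⟩ := FiberData.nonempty F'
  obtain ⟨ψ⟩ := FiberData.Hom.nonempty A B φ
  let p : ThreeStage.HoMap A.complex.tot (S.gr3 k) := ⟨F, A.totMap, j, hj⟩
  let q : ThreeStage.HoMap B.complex.tot (T.gr3 k) := ⟨F', B.totMap, g.b.comp κ, hj'⟩
  obtain ⟨e₀, e₁, e₂, p₀, p₁, p₂⟩ := A.complex.exists_isos p A.isWeakEquivalence_totMap (S.grIso k)
    (S.gr3IsoSusp₁ k) (S.gr3IsoSusp₂ k)
  obtain ⟨e₀', e₁', e₂', q₀, q₁, q₂⟩ := B.complex.exists_isos q B.isWeakEquivalence_totMap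
    (T.grIso k) (T.gr3IsoSusp₁ k) (T.gr3IsoSusp₂ k)
  have w₀ := hj'.1
  have := toHo_isIso (g.b.comp κ).f₀
  have w₁ := hj'.gr₁
  have := toHo_isIso (g.b.comp κ).gr₁
  have w₂ := hj'.gr₂
  have := toHo_isIso (g.b.comp κ).gr₂
  have c₀ : (toHo 𝒞).map φ.f₀ ≫ e₀'.hom = e₀.hom ≫ (suspIter 𝒞 k).map (f.app (op ⦋k⦌)) := by
    refine comp_eq_comp_of_agrees (S.grIso k) (T.grIso k) (j' := (toHo 𝒞).map (g.b.comp κ).f₀)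
      p₀ q₀ (ψ := (toHo 𝒞).map φ.f₀) ?_ ?_
    · have e : (toHo 𝒞).map j.f₀ ≫ (toHo 𝒞).map φ.f₀ =
          (toHo 𝒞).map g.a.f₀ ≫ (toHo 𝒞).map κ.f₀ := by
        rw [← Functor.map_comp, ← ThreeStage.Hom.comp_f₀, hφ, ThreeStage.Hom.comp_f₀,
          Functor.map_comp]
      exact e.trans ((congrArg (· ≫ (toHo 𝒞).map κ.f₀) a₀).trans ((Category.assoc _ _ _).trans
        (congrArg (_ ≫ ·) ((toHo 𝒞).map_comp _ _).symm)))
    · change (toHo 𝒞).map (𝟙 F.X₀) ≫ _ = _ ≫ (toHo 𝒞).map (𝟙 F'.X₀)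
      simp
  have c₁ : (toHo 𝒞).map ψ.f₁ ≫ e₁'.hom =
      e₁.hom ≫ (suspIter 𝒞 k).map (f.app (op ⦋k + 1⦌)) := by
    apply (susp 𝒞).map_injective
    have h := comp_eq_comp_of_agrees (S.gr3IsoSusp₁ k) (T.gr3IsoSusp₁ k)
      (m := (toHo 𝒞).map (A.complex.suspToGr₁ ≫ A.totMap.gr₁))
      (m' := (toHo 𝒞).map (B.complex.suspToGr₁ ≫ B.totMap.gr₁))
      (e := (toHo 𝒞).map A.complex.suspToGr₁ ≫ A.complex.totGr₁ ≫ (susp 𝒞).map e₁.hom)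
      (e' := (toHo 𝒞).map B.complex.suspToGr₁ ≫ B.complex.totGr₁ ≫ (susp 𝒞).map e₁'.hom)
      (θ := (susp 𝒞).map ((suspIter 𝒞 k).map (f.app (op ⦋k + 1⦌))))
      (j := (toHo 𝒞).map j.gr₁) (j' := (toHo 𝒞).map (g.b.comp κ).gr₁)
      (ψ := (toHo 𝒞).map φ.gr₁) (Φ := (toHo 𝒞).map (suspMap ψ.f₁))
      (by rw [Functor.map_comp, p₁]; simp only [Category.assoc]; rfl)
      (by rw [Functor.map_comp, q₁]; simp only [Category.assoc]; rfl)
      (by rw [← Functor.map_comp, ← ThreeStage.Hom.comp_gr₁, hφ, ThreeStage.Hom.comp_gr₁,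
            Functor.map_comp, a₁, Category.assoc, ← Functor.map_comp,
            ← ThreeStage.Hom.comp_gr₁])
      (by rw [← Functor.map_comp, Category.assoc, ← ThreeStage.Hom.comp_gr₁, ψ.toHo_gr₁,
            Functor.map_comp])
    have h' := CoherentComplex.suspMap_suspToGr₁ (K := A.complex) (K' := B.complex) ψ.f₁
    rw [← Category.assoc, ← h'] at h
    rw [← cancel_epi A.complex.totGr₁, ← cancel_epi ((toHo 𝒞).map A.complex.suspToGr₁)]
    simpa using h
  have c₂ : (toHo 𝒞).map ψ.f₂ ≫ e₂'.hom =
      e₂.hom ≫ (suspIter 𝒞 k).map (f.app (op ⦋k + 2⦌)) := by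
    apply (susp 𝒞).map_injective
    apply (susp 𝒞).map_injective
    have h := comp_eq_comp_of_agrees (S.gr3IsoSusp₂ k) (T.gr3IsoSusp₂ k)
      (m := (toHo 𝒞).map (A.complex.suspToGr₂ ≫ A.totMap.gr₂))
      (m' := (toHo 𝒞).map (B.complex.suspToGr₂ ≫ B.totMap.gr₂))
      (e := (toHo 𝒞).map A.complex.suspToGr₂ ≫ A.complex.totGr₂ ≫
        (susp 𝒞).map ((susp 𝒞).map e₂.hom))
      (e' := (toHo 𝒞).map B.complex.suspToGr₂ ≫ B.complex.totGr₂ ≫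
        (susp 𝒞).map ((susp 𝒞).map e₂'.hom))
      (θ := (susp 𝒞).map ((susp 𝒞).map ((suspIter 𝒞 k).map (f.app (op ⦋k + 2⦌)))))
      (j := (toHo 𝒞).map j.gr₂) (j' := (toHo 𝒞).map (g.b.comp κ).gr₂)
      (ψ := (toHo 𝒞).map φ.gr₂) (Φ := (toHo 𝒞).map (suspMap (dblConeMap ψ.f₂)))
      (by rw [Functor.map_comp, p₂]; simp only [Category.assoc]; rfl)
      (by rw [Functor.map_comp, q₂]; simp only [Category.assoc]; rfl)
      (by rw [← Functor.map_comp, ← ThreeStage.Hom.comp_gr₂, hφ, ThreeStage.Hom.comp_gr₂,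
            Functor.map_comp, a₂, Category.assoc, ← Functor.map_comp,
            ← ThreeStage.Hom.comp_gr₂])
      (by rw [← Functor.map_comp, Category.assoc, ← ThreeStage.Hom.comp_gr₂, ψ.toHo_gr₂,
            Functor.map_comp])
    have h' := CoherentComplex.suspMap_suspToGr₂ (K := A.complex) (K' := B.complex) ψ.f₂
    rw [← Category.assoc, ← h'] at h
    rw [← cancel_epi A.complex.totGr₂, ← cancel_epi ((toHo 𝒞).map A.complex.suspToGr₂)]
    simpa using h
  obtain ⟨s, s₀, s₁, s₂, hs⟩ := HomotopySquares.exists_of_comm (K := A.complex) (K' := B.complex)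
    φ.f₀ ψ.f₁ ψ.f₂ ψ.f₁_d₁ ψ.f₂_d₂
  refine ⟨⟨A.complex, e₀, e₁, e₂, p, A.isWeakEquivalence_totMap, p₀, p₁.trans ?_, p₂.trans ?_⟩,
    ⟨B.complex, e₀', e₁', e₂', q, B.isWeakEquivalence_totMap, q₀, q₁.trans ?_, q₂.trans ?_⟩,
    s, ?_, ?_, ?_, ?_⟩
  · rfl
  · rfl
  · rfl
  · rfl
  · rw [s₀, c₀]
  · rw [s₁, c₁]
  · rw [s₂, c₂]
  · convert s.isTodaClass_zero ?_ rfl rfl using 1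
    · simp
    -- The homotopy is constant at a map that factors through `d₂ ≫ d₁`, which is zero in the strict
    -- complex.
    · rw [hs, ← Category.assoc (A.complex.d₂), A.d₂_d₁, zero_comp, comp_zero]

end Totalization

end

end StableTot

namespace StableTot

/-! ### A vanishing Toda class yields a filtered map -/

section

variable {𝒞 : Type u} [Category.{v} 𝒞] [HasZeroMorphisms 𝒞] [HasZeroObject 𝒞] [ModelCategory 𝒞]

section

variable {X X' B₀ B : 𝒞} [IsCofibrant X] (I : Cylinder X) [I.IsGood] (f : X ⟶ X') {x : X ⟶ B₀}
  {w : X' ⟶ B₀} (j : B₀ ⟶ B) (h : I.LeftHomotopy x (f ≫ w)) (n' : cone X' ⟶ B)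

/-- A nullhomotopy is transported along a homotopy. -/
lemma exists_coneCyl_map_of_homotopy [IsFibrant B] (hn' : coneι X' ≫ n' = w ≫ j) :
    ∃ e : coneCyl I ⟶ B, coneCylMid I ≫ e = h.h ≫ j ∧ coneCyl₁ I ≫ e = coneMap f ≫ n' := by
  obtain ⟨e, he⟩ := ThreeStage.exists_extension_of_isFibrant (coneCylHalf I)
    (pushout.desc (h.h ≫ j) (coneMap f ≫ n') (by
      rw [h.h₁_assoc, coneι_coneMap_assoc, hn', Category.assoc]))
  refine ⟨e, ?_, ?_⟩
  · have := pushout.inl _ _ ≫= he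
    rwa [pushout.inl_desc, pushout.inl_desc_assoc] at this
  · have := pushout.inr _ _ ≫= he
    rwa [pushout.inr_desc, pushout.inr_desc_assoc] at this

/-- The two ends of `coneCyl` agree modulo the cylinder, so the transported nullhomotopy induces the
same map of cofibers as the original one. This reads off the effect on subquotients of a map built
from homotopies. -/
lemma toHo_cokernelMap_of_coneCyl_map (hn' : coneι X' ≫ n' = w ≫ j) (e : coneCyl I ⟶ B)
    (he : coneCylMid I ≫ e = h.h ≫ j) (he' : coneCyl₁ I ≫ e = coneMap f ≫ n')
    (hn : coneι X ≫ coneCyl₀ I ≫ e = x ≫ j) :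
    (toHo 𝒞).map (cokernel.map (coneι X) j x (coneCyl₀ I ≫ e) hn) =
      (toHo 𝒞).map (suspMap f ≫ cokernel.map (coneι X') j w n' hn') := by
  have e₀ : cokernel.map (coneι X) j x (coneCyl₀ I ≫ e) hn =
      cokernel.map (coneι X) (coneCylMid I) I.i₀ (coneCyl₀ I) (coneι_coneCyl₀ I) ≫
        cokernel.map (coneCylMid I) j h.h e he := by
    apply cokernel_hom_ext
    rw [π_cokernelMap, π_cokernelMap_assoc, π_cokernelMap, Category.assoc]
  have e₁ : suspMap f ≫ cokernel.map (coneι X') j w n' hn' =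
      cokernel.map (coneι X) (coneCylMid I) I.i₁ (coneCyl₁ I) (coneι_coneCyl₁ I) ≫
        cokernel.map (coneCylMid I) j h.h e he := by
    apply cokernel_hom_ext
    rw [π_suspMap_assoc, π_cokernelMap, π_cokernelMap_assoc, π_cokernelMap, ← Category.assoc, ← he',
      Category.assoc]
  rw [e₀, e₁, Functor.map_comp, Functor.map_comp, toHo_cokernelMap_coneCyl]

end

variable [StableModelCategory 𝒞]

/-- Gluing two maps out of the cylinder of a cone along the cylinder of the base. -/
lemma toHo_dblConeDesc_eq {X Y : 𝒞} [IsCofibrant X] [IsFibrant Y] (I : Cylinder X) [I.IsGood]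
    (h : I.I ⟶ Y) (a b c d : cone X ⟶ Y) (ha : I.i₀ ≫ h = coneι X ≫ a)
    (hb : I.i₁ ≫ h = coneι X ≫ b) (hc : I.i₀ ≫ h = coneι X ≫ c) (hd : I.i₁ ≫ h = coneι X ≫ d)
    (hab : (toHo 𝒞).map (cappedCylDesc I h a b ha hb) = 0)
    (hcd : (toHo 𝒞).map (cappedCylDesc I h c d hc hd) = 0) :
    (toHo 𝒞).map (pushout.desc a c (by rw [← ha, hc]) : dblCone X ⟶ Y) =
      (toHo 𝒞).map (pushout.desc b d (by rw [← hb, hd]) : dblCone X ⟶ Y) := by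
  obtain ⟨K₁, hK₁⟩ := exists_extension_of_toHo_eq_zero (coneι _) _ hab
  obtain ⟨a₁, a₂, a₃⟩ := coneCyl_desc I K₁ hK₁
  obtain ⟨K₂, hK₂⟩ := exists_extension_of_toHo_eq_zero (coneι _) _ hcd
  obtain ⟨c₁, c₂, c₃⟩ := coneCyl_desc I K₂ hK₂
  obtain ⟨r, r₁, r₂, r₃⟩ := exists_coneCyl_retraction I
  -- Two copies of `coneCyl` glued along the cylinder form a cylinder for the double cone: its ends
  -- `v₀` and `v₁` are sections of the weak equivalence `ρ`.
  let V := pushout (coneCylMid I) (coneCylMid I)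
  let v₀ : dblCone X ⟶ V := pushout.desc (coneCyl₀ I ≫ pushout.inl _ _)
    (coneCyl₀ I ≫ pushout.inr _ _) (by
      rw [coneι_coneCyl₀_assoc, coneι_coneCyl₀_assoc, pushout.condition])
  let v₁ : dblCone X ⟶ V := pushout.desc (coneCyl₁ I ≫ pushout.inl _ _)
    (coneCyl₁ I ≫ pushout.inr _ _) (by
      rw [coneι_coneCyl₁_assoc, coneι_coneCyl₁_assoc, pushout.condition])
  let K : V ⟶ Y := pushout.desc K₁ K₂ (by rw [a₁, c₁])
  let ρ : V ⟶ dblCone X := pushout.desc (r ≫ pushout.inl _ _) (r ≫ pushout.inr _ _) (by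
    rw [← Category.assoc, r₁, Category.assoc, pushout.condition, ← Category.assoc, ← r₁,
      Category.assoc])
  have e₀ : v₀ ≫ ρ = 𝟙 _ := by
    apply pushout.hom_ext
    · rw [pushout.inl_desc_assoc, Category.assoc, pushout.inl_desc, reassoc_of% r₂,
        Category.comp_id]
    · rw [pushout.inr_desc_assoc, Category.assoc, pushout.inr_desc, reassoc_of% r₂,
        Category.comp_id]
  have e₁ : v₁ ≫ ρ = 𝟙 _ := by
    apply pushout.hom_ext
    · rw [pushout.inl_desc_assoc, Category.assoc, pushout.inl_desc, reassoc_of% r₃,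
        Category.comp_id]
    · rw [pushout.inr_desc_assoc, Category.assoc, pushout.inr_desc, reassoc_of% r₃,
        Category.comp_id]
  have hw : WeakEquivalence (cokernel.map (pushout.inl (coneι X) (coneι X))
      (pushout.inl (coneCylMid I) (coneCylMid I)) (coneCyl₀ I) v₀ (pushout.inl_desc _ _ _)) := by
    have := weakEquivalence_cokernelMap_of_weakEquivalence (coneι X) (coneCylMid I) I.i₀
      (coneCyl₀ I) (coneι_coneCyl₀ I)
    refine weakEquivalence_of_precomp_of_fac (f := cokernel.map (coneι X)
      (pushout.inl (coneι X) (coneι X)) (coneι X) (pushout.inr (coneι X) (coneι X))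
      pushout.condition.symm) (fg := cokernel.map (coneι X) (coneCylMid I) I.i₀
      (coneCyl₀ I) (coneι_coneCyl₀ I) ≫ cokernel.map (coneCylMid I)
      (pushout.inl (coneCylMid I) (coneCylMid I)) (coneCylMid I)
      (pushout.inr (coneCylMid I) (coneCylMid I)) pushout.condition.symm) ?_
    apply cokernel_hom_ext
    rw [π_cokernelMap_assoc, π_cokernelMap, π_cokernelMap_assoc, π_cokernelMap, ← Category.assoc,
      pushout.inr_desc, Category.assoc]
  have := weakEquivalence_of_cokernelMap _ _ _ _ _ hw
  have : WeakEquivalence ρ := weakEquivalence_of_precomp_of_fac e₀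
  have key := toHo_eq_of_retraction v₀ v₁ ρ (e₀.trans e₁.symm)
  have h₀ : pushout.desc a c (by rw [← ha, hc]) = v₀ ≫ K := by
    apply pushout.hom_ext
    · rw [pushout.inl_desc, pushout.inl_desc_assoc, Category.assoc, pushout.inl_desc, a₂]
    · rw [pushout.inr_desc, pushout.inr_desc_assoc, Category.assoc, pushout.inr_desc, c₂]
  have h₁ : pushout.desc b d (by rw [← hb, hd]) = v₁ ≫ K := by
    apply pushout.hom_ext
    · rw [pushout.inl_desc, pushout.inl_desc_assoc, Category.assoc, pushout.inl_desc, a₃]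
    · rw [pushout.inr_desc, pushout.inr_desc_assoc, Category.assoc, pushout.inr_desc, c₃]
  rw [h₀, h₁, Functor.map_comp, key, Functor.map_comp]

namespace HomotopySquares

variable {K K' : CoherentComplex 𝒞} (s : HomotopySquares K K')

/-- The homotopies in the squares are compatible with the nullhomotopies of the differentials in
the mapping cones. -/
lemma toHo_cappedCylDesc_eq_zero {Y : 𝒞} (ι : K'.X₀ ⟶ Y) (n' : cone K'.X₁ ⟶ Y)
    (hn' : coneι _ ≫ n' = K'.d₁ ≫ ι) (e : coneCyl s.I₁ ⟶ Y)
    (he : coneCylMid s.I₁ ≫ e = s.H₁.h ≫ ι) (he' : coneCyl₁ s.I₁ ≫ e = coneMap s.φ₁ ≫ n')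
    (h₀ : (s.I₂.trans s.I₂').i₀ ≫ s.homotopy.h ≫ ι =
      coneι K.X₂ ≫ coneMap K.d₂ ≫ coneCyl₀ s.I₁ ≫ e)
    (h₁ : (s.I₂.trans s.I₂').i₁ ≫ s.homotopy.h ≫ ι =
      coneι K.X₂ ≫ coneMap s.φ₂ ≫ coneMap K'.d₂ ≫ n') :
    (toHo 𝒞).map (cappedCylDesc (s.I₂.trans s.I₂') (s.homotopy.h ≫ ι)
      (coneMap K.d₂ ≫ coneCyl₀ s.I₁ ≫ e) (coneMap s.φ₂ ≫ coneMap K'.d₂ ≫ n') h₀ h₁) = 0 := by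
  -- The whole capped cylinder factors through this contractible object: the first half of the
  -- homotopy lives in `coneCyl s.I₁` and the second half in the cone on `K'.X₁`.
  let Γ := pushout (coneCyl₁ s.I₁) (coneMap s.φ₁)
  have hΓ : IsZero ((toHo 𝒞).obj Γ) :=
    isZero_toHo_of_weakEquivalence (pushout.inr (coneCyl₁ s.I₁) (coneMap s.φ₁)) (isZero_toHo_cone _)
  let g : Γ ⟶ Y := pushout.desc e n' he'
  let m : (s.I₂.trans s.I₂').I ⟶ Γ := pushout.desc (s.J ≫ coneCylMid s.I₁ ≫ pushout.inl _ _)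
    (s.H₂.h ≫ coneι _ ≫ pushout.inr _ _) (by
      rw [reassoc_of% s.i₁_J, ← coneι_coneCyl₁_assoc, pushout.condition, coneι_coneMap_assoc,
        s.H₂.h₀_assoc, Category.assoc])
  have m₀ : (s.I₂.trans s.I₂').i₀ ≫ m =
      coneι K.X₂ ≫ coneMap K.d₂ ≫ coneCyl₀ s.I₁ ≫ pushout.inl _ _ := by
    refine (Category.assoc _ _ _).trans
      ((congrArg (s.I₂.i₀ ≫ ·) (pushout.inl_desc _ _ _)).trans ?_)
    rw [reassoc_of% s.i₀_J, ← coneι_coneCyl₀_assoc, coneι_coneMap_assoc]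
  have m₁ : (s.I₂.trans s.I₂').i₁ ≫ m =
      coneι K.X₂ ≫ coneMap s.φ₂ ≫ coneMap K'.d₂ ≫ pushout.inr _ _ := by
    refine (Category.assoc _ _ _).trans
      ((congrArg (s.I₂'.i₁ ≫ ·) (pushout.inr_desc _ _ _)).trans ?_)
    rw [s.H₂.h₁_assoc, coneι_coneMap_assoc, coneι_coneMap_assoc, Category.assoc]
  have key : cappedCylDesc (s.I₂.trans s.I₂') (s.homotopy.h ≫ ι)
      (coneMap K.d₂ ≫ coneCyl₀ s.I₁ ≫ e) (coneMap s.φ₂ ≫ coneMap K'.d₂ ≫ n') h₀ h₁ =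
      cappedCylDesc (s.I₂.trans s.I₂') m _ _ m₀ m₁ ≫ g := by
    apply pushout.hom_ext
    · rw [pushout.inl_desc, pushout.inl_desc_assoc]
      apply pushout.hom_ext
      · refine (pushout.inl_desc_assoc _ _ _ _).trans ?_
        refine Eq.trans ?_ (pushout.inl_desc_assoc _ _ _ _).symm
        rw [Category.assoc, Category.assoc, Category.assoc, pushout.inl_desc, he]
      · refine (pushout.inr_desc_assoc _ _ _ _).trans ?_
        refine Eq.trans ?_ (pushout.inr_desc_assoc _ _ _ _).symm
        rw [Category.assoc, Category.assoc, Category.assoc, pushout.inr_desc, hn']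
    · rw [pushout.inr_desc, pushout.inr_desc_assoc]
      apply coprod.hom_ext
      · rw [coprod.inl_desc, coprod.inl_desc_assoc, Category.assoc, Category.assoc,
          pushout.inl_desc]
      · rw [coprod.inr_desc, coprod.inr_desc_assoc, Category.assoc, Category.assoc,
          pushout.inr_desc]
  rw [key]
  exact toHo_map_eq_zero_of_factor hΓ _ _

/-- If the Toda class of the squares vanishes, they extend to a filtration-preserving map of total
objects. -/
lemma exists_homMap (hs : s.IsTodaClass 0) :
    ∃ g : ThreeStage.HoMap K.tot K'.tot, g.AgreesWith ((toHo 𝒞).map s.φ₀)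
      (K.totGr₁ ≫ (susp 𝒞).map ((toHo 𝒞).map s.φ₁) ≫ inv K'.totGr₁)
      (K.totGr₂ ≫ (susp 𝒞).map ((susp 𝒞).map ((toHo 𝒞).map s.φ₂)) ≫ inv K'.totGr₂) := by
  obtain ⟨Z, k, _, hk, -⟩ := K'.tot.exists_fibrantReplacement
  let k₀ : K'.X₀ ⟶ Z.X₀ := k.f₀
  let k₁ : K'.mappingCone ⟶ Z.X₁ := k.f₁
  let k₂ : pushout K'.attach (coneι K'.doubleCone) ⟶ Z.X₂ := k.f₂
  have hk₁ : pushout.inl _ _ ≫ k₁ = k₀ ≫ Z.i₁ := k.comm₁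
  have hk₂ : pushout.inl _ _ ≫ k₂ = k₁ ≫ Z.i₂ := k.comm₂
  let n' : cone K'.X₁ ⟶ Z.X₁ := pushout.inr _ _ ≫ k₁
  have hn' : coneι K'.X₁ ≫ n' = K'.d₁ ≫ k₀ ≫ Z.i₁ := by
    rw [← hk₁, pushout.condition_assoc]
  -- Along `H₁`, the canonical nullhomotopy `n'` for `K'` is transported to one for `K.d₁ ≫ φ₀`,
  -- which defines the map `a₁` on mapping cones.
  obtain ⟨e, he, he'⟩ := exists_coneCyl_map_of_homotopy s.I₁ s.φ₁ (k₀ ≫ Z.i₁) s.H₁ n' hn'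
  have hn : coneι K.X₁ ≫ coneCyl₀ s.I₁ ≫ e = (K.d₁ ≫ s.φ₀ ≫ k₀) ≫ Z.i₁ := by
    rw [coneι_coneCyl₀_assoc, he, s.H₁.h₀_assoc]
    simp only [Category.assoc]
  let a₁ : K.mappingCone ⟶ Z.X₁ := pushout.desc (s.φ₀ ≫ k₀ ≫ Z.i₁) (coneCyl₀ s.I₁ ≫ e)
    (by rw [hn]; simp only [Category.assoc])
  let I := s.I₂.trans s.I₂'
  have hα : I.i₀ ≫ s.homotopy.h ≫ k₀ ≫ Z.i₁ = coneι K.X₂ ≫ K.N ≫ s.φ₀ ≫ k₀ ≫ Z.i₁ := by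
    rw [s.homotopy.h₀_assoc, reassoc_of% K.hN]
    simp only [Category.assoc]
  have hβ : I.i₁ ≫ s.homotopy.h ≫ k₀ ≫ Z.i₁ =
      coneι K.X₂ ≫ coneMap s.φ₂ ≫ K'.N ≫ k₀ ≫ Z.i₁ := by
    rw [s.homotopy.h₁_assoc, coneι_coneMap_assoc, reassoc_of% K'.hN]
    simp only [Category.assoc]
  have hγ : I.i₀ ≫ s.homotopy.h ≫ k₀ ≫ Z.i₁ =
      coneι K.X₂ ≫ coneMap K.d₂ ≫ coneCyl₀ s.I₁ ≫ e := by
    rw [s.homotopy.h₀_assoc, coneι_coneMap_assoc, hn]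
    simp only [Category.assoc]
  have hδ : I.i₁ ≫ s.homotopy.h ≫ k₀ ≫ Z.i₁ =
      coneι K.X₂ ≫ coneMap s.φ₂ ≫ coneMap K'.d₂ ≫ n' := by
    rw [s.homotopy.h₁_assoc, coneι_coneMap_assoc, coneι_coneMap_assoc, hn']
    simp only [Category.assoc]
  -- Capping the homotopy by the nullhomotopies `N` of the two complexes gives a null map; this is
  -- where the vanishing of the Toda class is used.
  have z₁ : (toHo 𝒞).map (cappedCylDesc I (s.homotopy.h ≫ k₀ ≫ Z.i₁) (K.N ≫ s.φ₀ ≫ k₀ ≫ Z.i₁)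
      (coneMap s.φ₂ ≫ K'.N ≫ k₀ ≫ Z.i₁) hα hβ) = 0 := by
    dsimp only [IsTodaClass, IsGluing] at hs
    rw [comp_zero, comp_zero] at hs
    have := congrArg (· ≫ (toHo 𝒞).map (k₀ ≫ Z.i₁)) hs
    rw [zero_comp, ← Functor.map_comp] at this
    rw [← this]
    congr 1
    apply pushout.hom_ext
    · rw [pushout.inl_desc, pushout.inl_desc_assoc]
    · rw [pushout.inr_desc, pushout.inr_desc_assoc, coprod.desc_comp]
      simp only [Category.assoc]
  -- Capping the same homotopy by the mapping cone nullhomotopies gives a null map for any choice of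
  -- squares. Gluing with `z₁` along the cylinder shows that the two composites of attaching maps
  -- agree in `Ho`.
  have z₂ := s.toHo_cappedCylDesc_eq_zero (k₀ ≫ Z.i₁) n' hn' e he he' hγ hδ
  have key := toHo_dblConeDesc_eq I _ _ _ _ _ hα hβ hγ hδ z₁ z₂
  have e₁ : (toHo 𝒞).map (K.attach ≫ a₁) = (toHo 𝒞).map (dblConeMap s.φ₂ ≫ K'.attach ≫ k₁) := by
    refine Eq.trans ?_ (key.trans ?_)
    · congr 1
      apply pushout.hom_ext
      · rw [CoherentComplex.attach, pushout.inl_desc_assoc, Category.assoc, pushout.inl_desc,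
          pushout.inl_desc]
      · rw [CoherentComplex.attach, pushout.inr_desc_assoc, Category.assoc, pushout.inr_desc,
          pushout.inr_desc]
    · congr 1
      apply pushout.hom_ext
      · rw [CoherentComplex.attach, pushout.inl_desc, inl_dblConeMap_assoc, pushout.inl_desc_assoc,
          Category.assoc, hk₁]
      · rw [CoherentComplex.attach, pushout.inr_desc, inr_dblConeMap_assoc, pushout.inr_desc_assoc,
          Category.assoc]
  obtain ⟨P, _⟩ := Cylinder.exists_very_good K.doubleCone
  obtain ⟨h₂⟩ := exists_leftHomotopy P _ _ e₁
  let m' : cone K'.doubleCone ⟶ Z.X₂ := pushout.inr _ _ ≫ k₂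
  have hm' : coneι K'.doubleCone ≫ m' = (K'.attach ≫ k₁) ≫ Z.i₂ := by
    rw [Category.assoc, ← hk₂, pushout.condition_assoc]
  -- The homotopy between the attaching maps is treated as `H₁` was, and yields the map of third
  -- stages.
  obtain ⟨c, hc, hc'⟩ := exists_coneCyl_map_of_homotopy P (dblConeMap s.φ₂) Z.i₂ h₂ m' hm'
  have hm : coneι K.doubleCone ≫ coneCyl₀ P ≫ c = (K.attach ≫ a₁) ≫ Z.i₂ := by
    rw [coneι_coneCyl₀_assoc, hc, h₂.h₀_assoc]
  let a : ThreeStage.Hom K.tot Z :=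
    { f₀ := s.φ₀ ≫ k₀
      f₁ := a₁
      f₂ := pushout.desc (a₁ ≫ Z.i₂) (coneCyl₀ P ≫ c) (by rw [hm, Category.assoc])
      comm₁ := (pushout.inl_desc _ _ _).trans (Category.assoc _ _ _).symm
      comm₂ := pushout.inl_desc _ _ _ }
  refine ⟨⟨Z, a, k, hk⟩, CoherentComplex.agreesWith_tot _ _ _ _ ?_ ?_ ?_⟩
  · exact (toHo 𝒞).map_comp _ _
  · let h₁ : s.I₁.LeftHomotopy (K.d₁ ≫ s.φ₀ ≫ k₀) (s.φ₁ ≫ K'.d₁ ≫ k₀) :=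
      { h := s.H₁.h ≫ k₀
        h₀ := by rw [s.H₁.h₀_assoc, Category.assoc]
        h₁ := by rw [s.H₁.h₁_assoc, Category.assoc] }
    have := toHo_cokernelMap_of_coneCyl_map s.I₁ s.φ₁ Z.i₁ h₁ n' (by rw [hn', Category.assoc]) e
      (he.trans (Category.assoc _ _ _).symm) he' hn
    refine Eq.trans ?_ (this.trans ?_)
    · congr 1
      apply cokernel_hom_ext
      refine (K.π_suspToGr₁_gr₁ a).trans ?_
      rw [π_cokernelMap]
      exact congrArg (· ≫ cokernel.π Z.i₁) (pushout.inr_desc _ _ _)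
    · congr 1
      apply cokernel_hom_ext
      rw [π_suspMap_assoc, π_suspMap_assoc, π_cokernelMap]
      exact congrArg (coneMap s.φ₁ ≫ ·) (K'.π_suspToGr₁_gr₁ k).symm
  · have := toHo_cokernelMap_of_coneCyl_map P (dblConeMap s.φ₂) Z.i₂ h₂ m' hm' c hc hc' hm
    refine Eq.trans ?_ (this.trans ?_)
    · congr 1
      apply cokernel_hom_ext
      refine (K.π_suspToGr₂_gr₂ a).trans ?_
      rw [π_cokernelMap]
      exact congrArg (· ≫ cokernel.π Z.i₂) (pushout.inr_desc _ _ _)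
    · congr 1
      apply cokernel_hom_ext
      rw [π_suspMap_assoc, π_suspMap_assoc, π_cokernelMap]
      exact congrArg (coneMap (dblConeMap s.φ₂) ≫ ·) (K'.π_suspToGr₂_gr₂ k).symm

end HomotopySquares

end

end StableTot

namespace StableTot

/-! ### Transfer to totalizations and the main theorem -/

namespace Totalization

variable {𝒞 : Type u} [Category.{v} 𝒞] [HasZeroMorphisms 𝒞] [HasZeroObject 𝒞] [ModelCategory 𝒞]
  [StableModelCategory 𝒞] {C D : SimplicialObject (Ho 𝒞)} {S : Totalization C}
  {T : Totalization D}

/-- The map of total objects is preceded by the inverse of the presentation of `S` and followed by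
the presentation of `T`. -/
lemma exists_homMap_of_zero_mem_todaBracket (f : C ⟶ D) (k : ℕ) (h : 0 ∈ todaBracket S T f k) :
    ∃ g : ThreeStage.HoMap (S.gr3 k) (T.gr3 k), S.Gr3MapAgrees T f k g := by
  obtain ⟨p, q, s, h₀, h₁, h₂, hs⟩ := h
  have hs' : s.IsTodaClass 0 := by
    convert hs using 1
    simp
  obtain ⟨g, hg⟩ := s.exists_homMap hs'
  have hp : p.g.AgreesWith (p.e₀.hom ≫ (S.grIso k).inv)
      (p.K.totGr₁ ≫ (susp 𝒞).map p.e₁.hom ≫ (S.gr3IsoSusp₁ k).inv)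
      (p.K.totGr₂ ≫ (susp 𝒞).map ((susp 𝒞).map p.e₂.hom) ≫ (S.gr3IsoSusp₂ k).inv) := p.agrees
  have hq : q.g.AgreesWith (q.e₀.hom ≫ (T.grIso k).inv)
      (q.K.totGr₁ ≫ (susp 𝒞).map q.e₁.hom ≫ (T.gr3IsoSusp₁ k).inv)
      (q.K.totGr₂ ≫ (susp 𝒞).map ((susp 𝒞).map q.e₂.hom) ≫ (T.gr3IsoSusp₂ k).inv) := q.agrees
  have hinv : ((S.grIso k).hom ≫ p.e₀.inv) ≫ p.e₀.hom ≫ (S.grIso k).inv =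
      𝟙 ((toHo 𝒞).obj (S.gr k)) := by simp
  have hf₀ : (S.grIso k).hom ≫ (suspIter 𝒞 k).map (f.app (op (SimplexCategory.mk k))) ≫
      (T.grIso k).inv = ((S.grIso k).hom ≫ p.e₀.inv) ≫ (toHo 𝒞).map s.φ₀ ≫ q.e₀.hom ≫
        (T.grIso k).inv := by
    rw [← Iso.inv_comp_eq] at h₀
    rw [← h₀]
    simp
  have hp' := hp.symm p.isWeakEquivalence (ψ₀ := (S.grIso k).hom ≫ p.e₀.inv)
    (ψ₁ := (S.gr3IsoSusp₁ k).hom ≫ (susp 𝒞).map p.e₁.inv ≫ inv p.K.totGr₁)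
    (ψ₂ := (S.gr3IsoSusp₂ k).hom ≫ (susp 𝒞).map ((susp 𝒞).map p.e₂.inv) ≫ inv p.K.totGr₂)
    hinv (by simp [← Functor.map_comp_assoc]) (by simp [← Functor.map_comp_assoc])
  obtain ⟨g₁, hg₁, -⟩ := ThreeStage.HoMap.exists_comp _ g hp' hg
  obtain ⟨g₂, hg₂, -⟩ := ThreeStage.HoMap.exists_comp g₁ q.g hg₁ hq
  refine ⟨g₂, (gr3MapAgrees_iff f k g₂).2 ?_⟩
  convert hg₂ using 1
  · exact hf₀.trans (Category.assoc _ _ _).symm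
  · rw [← Iso.inv_comp_eq] at h₁
    rw [← h₁]
    simp
  · rw [← Iso.inv_comp_eq] at h₂
    rw [← h₂]
    simp

lemma isWeakEquivalence_of_gr3MapAgrees (f : C ⟶ D) (k : ℕ)
    (hf : ∀ m ∈ Set.Icc k (k + 2), IsIso (f.app (op (SimplexCategory.mk m))))
    (g : ThreeStage.HoMap (S.gr3 k) (T.gr3 k)) (hg : S.Gr3MapAgrees T f k g) :
    g.IsWeakEquivalence := by
  rw [gr3MapAgrees_iff] at hg
  have := hf k ⟨le_rfl, by omega⟩
  have := hf (k + 1) ⟨by omega, by omega⟩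
  have := hf (k + 2) ⟨by omega, le_rfl⟩
  have i₀ : IsIso ((S.grIso k).hom ≫ (suspIter 𝒞 k).map (f.app (op (SimplexCategory.mk k))) ≫
    (T.grIso k).inv) := inferInstance
  exact @ThreeStage.HoMap.AgreesWith.isWeakEquivalence _ _ _ _ _ _ _ _ _ _ _ _ hg i₀
    inferInstance inferInstance

end Totalization

end StableTot

/-- Here `k = n - 2`. In (b) the map from (a) needs no modification: inducing isomorphisms on all
subquotients already makes it a weak equivalence. -/
theorem mainTheorem5 {𝒞 : Type u} [Category.{v} 𝒞] [HasZeroMorphisms 𝒞] [HasZeroObject 𝒞]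
    [ModelCategory 𝒞] [StableModelCategory 𝒞] {C D : SimplicialObject (Ho 𝒞)}
    (S : Totalization C) (T : Totalization D) (f : C ⟶ D) (k : ℕ) :
    ((∃ g : ThreeStage.HoMap (S.gr3 k) (T.gr3 k), S.Gr3MapAgrees T f k g) ↔
      0 ∈ todaBracket S T f k) ∧
    ((∀ m ∈ Set.Icc k (k + 2), IsIso (f.app (op (SimplexCategory.mk m)))) →
      ((∃ g : ThreeStage.HoMap (S.gr3 k) (T.gr3 k),
        g.IsWeakEquivalence ∧ S.Gr3MapAgrees T f k g) ↔ 0 ∈ todaBracket S T f k)) := by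
  have h : (∃ g : ThreeStage.HoMap (S.gr3 k) (T.gr3 k), S.Gr3MapAgrees T f k g) ↔
      0 ∈ todaBracket S T f k :=
    ⟨fun ⟨g, hg⟩ => Totalization.zero_mem_todaBracket_of_homMap f k g hg,
      Totalization.exists_homMap_of_zero_mem_todaBracket f k⟩
  refine ⟨h, fun hf => ⟨fun ⟨g, _, hg⟩ => h.1 ⟨g, hg⟩, fun h0 => ?_⟩⟩
  obtain ⟨g, hg⟩ := h.2 h0
  exact ⟨g, Totalization.isWeakEquivalence_of_gr3MapAgrees f k hf g hg, hg⟩
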